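/- Let $A$ be a finite alphabet and let $X$ be a non-empty subshift over $A$, one-sided ($X\subset A^{\mathbb N}$, $\mathbb N=\{0,1,2,\dots\}$) or two-sided ($X\subset A^{\mathbb Z}$): a closed shift-invariant set, with shift $\sigma(x)_i=x_{i+1}$. Let $\varphi\colon X\to\mathbb R$ be continuous and $S_n\varphi=\sum_{k=0}^{n-1}\varphi\circ\sigma^k$. For a finite word $w$ of length $|w|$ let $[w]=\{x\in X: x_0x_1\cdots x_{|w|-1}=w\}$, let $\mathcal L=\{w:[w]\neq\emptyset\}$ be the language of $X$, and for $w\in\mathcal L$ with $|w|=n$ put $\varphi_n(w)=\sup_{x\in[w]}S_n\varphi(x)$. For $\mathcal D\subset\mathcal L$ let $\mathcal D_n$ be the set of words of length $n$ in $\mathcal D$, and put $$\Lambda_n(\mathcal D,\varphi)=\sum_{w\in\mathcal D_n}e^{\varphi_n(w)},\qquad P(\varphi)=\limsup_{n\to\infty}\tfrac1n\log\Lambda_n(\mathcal L,\varphi).$$ For a shift-invariant Borel probability measure $\mu$ on $X$ let $h(\mu)$ be its Kolmogorov--Sinai entropy; $\mu$ is an equilibrium state for $\varphi$ if it attains the supremum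 of $h(\mu)+\int\varphi\,d\mu$ over all such measures. A collection $\mathcal D\subset\mathcal L$ has (S)-specification with gap size $t\in\mathbb N$ if for all $m\ge1$ and $w^1,\dots,w^m\in\mathcal D$ there are $v^1,\dots,v^{m-1}\in\mathcal L$ of length exactly $t$ such that $x:=w^1v^1w^2\cdots v^{m-1}w^m\in\mathcal L$; it has (Per)-specification with gap size $t$ if moreover $v^1,\dots,v^{m-1}$ can be chosen so that $[x]$ contains a point $y$ with $\sigma^{|x|+t}y=y$. Suppose that there are $\mathcal C^p,\mathcal G,\mathcal C^s\subset\mathcal L$ (the empty word may belong to any of them) such that every non-empty word of $\mathcal L$ is of the form $uvw$ with $u\in\mathcal C^p$, $v\in\mathcal G$, $w\in\mathcal C^s$. For $M\in\mathbb N$ let $\mathcal G(M)=\{uvw\in\mathcal L: u\in\mathcal C^p, v\in\mathcal G, w\in\mathcal C^s, |u|\le M, |w|\le M\}$. Assume: 1. for every $M$ the collection $\mathcal G(M)$ has (S)-specification with some gap size $t_M$; 2. $\varphi$ has the Bowen property on $\mathcal G$: $\sup\{|S_n\varphi(x)-S_n\varphi(y)| : n\in\mathbb N,\ w\in\mathcal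 G_n,\ x,y\in[w]\}<\infty$; 3. $\sum_{n\ge1}\Lambda_n(\mathcal C^p\cup\mathcal C^s,\varphi)\,e^{-nP(\varphi)}<\infty$. Then $\varphi$ has a unique equilibrium state $\mu_\varphi$, and it has the following weak Gibbs property: there are constants $K'>0$ and $K_M>0$ ($M\in\mathbb N$) such that for all $M$, all $n$ and all $w\in\mathcal G(M)_n$, $$K_M\le\frac{\mu_\varphi([w])}{e^{-nP(\varphi)+\varphi_n(w)}}\le K'.$$ If, moreover, for every $M$ the collection $\mathcal G(M)$ has (Per)-specification with some gap size, then, with $\mathrm{Per}_n=\{x\in X:\sigma^nx=x\}$, $$\mu_\varphi=\lim_{n\to\infty}\frac{1}{\sum_{x\in\mathrm{Per}_n}e^{S_n\varphi(x)}}\sum_{x\in\mathrm{Per}_n}e^{S_n\varphi(x)}\,\delta_x$$ in the weak* topology. -/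

import Mathlib

open Filter Topology MeasureTheory
open SymbolicDynamics.FullShift (Subshift)

noncomputable section

/-! ### Measure-theoretic (Kolmogorov-Sinai) entropy -/

namespace Entropy

variable {Ω : Type*} [MeasurableSpace Ω]

/-- `H_μ(ξ ∨ T⁻¹ξ ∨ ⋯ ∨ T⁻⁽ⁿ⁻¹⁾ξ)`, where the finite partition `ξ` into at most `k` cells is given
by the map sending a point to the label of its cell. -/
def joinEntropy (T : Ω → Ω) (μ : Measure Ω) {k : ℕ} (ξ : Ω → Fin k) (n : ℕ) : ℝ :=
  ∑ c : Fin n → Fin k, Real.negMulLog (μ.real {x | ∀ i : Fin n, ξ (T^[(i : ℕ)] x) = c i})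

/-- `h_μ(T, ξ) = lim (1/n) H_μ(ξ ∨ ⋯ ∨ T⁻⁽ⁿ⁻¹⁾ξ)`; the limit exists when `μ` is `T`-invariant. -/
def partitionEntropy (T : Ω → Ω) (μ : Measure Ω) {k : ℕ} (ξ : Ω → Fin k) : EReal :=
  limsup (fun n : ℕ => ((joinEntropy T μ ξ n / n : ℝ) : EReal)) atTop

/-- The entropy `h_μ(T)`: the supremum of `h_μ(T, ξ)` over all finite measurable partitions. -/
def measureEntropy (T : Ω → Ω) (μ : Measure Ω) : EReal :=
  ⨆ (k : ℕ) (ξ : Ω → Fin k) (_ : Measurable ξ), partitionEntropy T μ ξ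

end Entropy

/-! ### Subshifts

One-sided subshifts are `Subshift A ℕ` and two-sided ones are `Subshift A ℤ`; the definitions treat
both at once, through an index monoid `I` with a distinguished element `1`. -/

namespace Symbolic

variable {A I : Type*} [TopologicalSpace A] [AddMonoidWithOne I]

/-- The shift map `σ(x)_i = x_{1+i}` of a subshift. -/
def shiftMap (X : Subshift A I) : X.carrier → X.carrier :=
  (X.mapsTo 1).restrict

/-- The cylinder `[w]`: the points of `X` whose coordinates `0, 1, …, |w| - 1` spell `w`. -/
def cyl (X : Subshift A I) (w : List A) : Set X.carrier :=
  {x | ∀ (i : ℕ) (hi : i < w.length), x.1 (i : I) = w[i]}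

/-- The language of `X`. -/
def language (X : Subshift A I) : Set (List A) :=
  {w | (cyl X w).Nonempty}

/-- The Birkhoff sum `S_n φ(x) = φ(x) + φ(σ x) + ⋯ + φ(σⁿ⁻¹ x)`. -/
def S (X : Subshift A I) (φ : C(X.carrier, ℝ)) (n : ℕ) (x : X.carrier) : ℝ :=
  birkhoffSum (shiftMap X) φ n x

/-- `φ_n(w) = sup {S_n φ(x) : x ∈ [w]}` with `n = |w|`. -/
def wordWeight (X : Subshift A I) (φ : C(X.carrier, ℝ)) (w : List A) : ℝ :=
  sSup (S X φ w.length '' cyl X w)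

/-- The finite set of words of length `n` of a collection `D`. -/
def wordsOfLength [Finite A] (D : Set (List A)) (n : ℕ) : Finset (List A) :=
  ((List.finite_length_eq A n).subset
    (fun _ hw => hw.2 : D ∩ {w | w.length = n} ⊆ {w | w.length = n})).toFinset

/-- `Λ_n(D, φ) = ∑_{w ∈ D_n} exp (φ_n(w))`. -/
def partitionSum [Finite A] (X : Subshift A I) (φ : C(X.carrier, ℝ)) (D : Set (List A))
    (n : ℕ) : ℝ :=
  ∑ w ∈ wordsOfLength D n, Real.exp (wordWeight X φ w)

/-- The topological pressure `P(φ) = limsup (1/n) log Λ_n(L, φ)`. -/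
def pressure [Finite A] (X : Subshift A I) (φ : C(X.carrier, ℝ)) : ℝ :=
  limsup (fun n : ℕ => Real.log (partitionSum X φ (language X) n) / n) atTop

/-- `w⁰ v⁰ w¹ v¹ ⋯ vᵐ⁻¹ wᵐ`. -/
def glue {m : ℕ} (w : Fin (m + 1) → List A) (v : Fin m → List A) : List A :=
  w 0 ++ (List.ofFn fun i : Fin m => v i ++ w i.succ).flatten

/-- (S)-specification on `D` with gap size `t`. -/
def HasSpecS (X : Subshift A I) (D : Set (List A)) (t : ℕ) : Prop :=
  ∀ (m : ℕ) (w : Fin (m + 1) → List A), (∀ i, w i ∈ D) →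
    ∃ v : Fin m → List A, (∀ i, v i ∈ language X ∧ (v i).length = t) ∧ glue w v ∈ language X

/-- (Per)-specification on `D` with gap size `t`: in addition, the cylinder of the glued word `x`
contains a point fixed by `σ^{|x| + t}`. -/
def HasSpecPer (X : Subshift A I) (D : Set (List A)) (t : ℕ) : Prop :=
  ∀ (m : ℕ) (w : Fin (m + 1) → List A), (∀ i, w i ∈ D) →
    ∃ v : Fin m → List A, (∀ i, v i ∈ language X ∧ (v i).length = t) ∧ glue w v ∈ language X ∧
      ∃ y ∈ cyl X (glue w v), Function.IsPeriodicPt (shiftMap X) ((glue w v).length + t) y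

/-- The Bowen property of `φ` on `D`: `sup_n V_n(D, S_n φ) < ∞`. -/
def HasBowen (X : Subshift A I) (φ : C(X.carrier, ℝ)) (D : Set (List A)) : Prop :=
  ∃ V : ℝ, ∀ w ∈ D, ∀ x ∈ cyl X w, ∀ y ∈ cyl X w, |S X φ w.length x - S X φ w.length y| ≤ V

/-- `L = Cᵖ G Cˢ`: the three collections consist of words of the language, and every non-empty word
of the language is a concatenation of words from `Cᵖ`, `G` and `Cˢ` (any of which may be empty). -/
def IsDecomposition (X : Subshift A I) (Cp G Cs : Set (List A)) : Prop :=
  Cp ⊆ language X ∧ G ⊆ language X ∧ Cs ⊆ language X ∧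
    ∀ y ∈ language X, y ≠ [] → ∃ u ∈ Cp, ∃ v ∈ G, ∃ w ∈ Cs, y = u ++ v ++ w

/-- The fattened collection `G(M)`. -/
def fatten (X : Subshift A I) (Cp G Cs : Set (List A)) (M : ℕ) : Set (List A) :=
  {y | y ∈ language X ∧ ∃ u ∈ Cp, ∃ v ∈ G, ∃ w ∈ Cs,
    u.length ≤ M ∧ w.length ≤ M ∧ y = u ++ v ++ w}

variable [MeasurableSpace A]

/-- `μ` is a shift-invariant probability measure on `X`. -/
def IsInvariantProb (X : Subshift A I) (μ : Measure X.carrier) : Prop :=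
  IsProbabilityMeasure μ ∧ MeasurePreserving (shiftMap X) μ μ

/-- The free energy `h(μ) + ∫ φ dμ`. -/
def freeEnergy (X : Subshift A I) (φ : C(X.carrier, ℝ)) (μ : Measure X.carrier) : EReal :=
  Entropy.measureEntropy (shiftMap X) μ + ((∫ x, φ x ∂μ : ℝ) : EReal)

/-- `μ` is an equilibrium state for `φ`: it maximises the free energy among all shift-invariant
probability measures. -/
def IsEquilibriumState (X : Subshift A I) (φ : C(X.carrier, ℝ)) (μ : Measure X.carrier) : Prop :=
  IsInvariantProb X μ ∧ ∀ ν, IsInvariantProb X ν → freeEnergy X φ ν ≤ freeEnergy X φ μ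

/-- The weighted periodic orbit measure
`(∑_{x ∈ Per_n} exp (S_n φ(x)))⁻¹ ∑_{x ∈ Per_n} exp (S_n φ(x)) δ_x`,
where `Per_n` is the set of fixed points of `σⁿ`. -/
def periodicMeasure (X : Subshift A I) (φ : C(X.carrier, ℝ)) (n : ℕ) : Measure X.carrier :=
  (∑' x : Function.ptsOfPeriod (shiftMap X) n, ENNReal.ofReal (Real.exp (S X φ n x)))⁻¹ •
    Measure.sum fun x : Function.ptsOfPeriod (shiftMap X) n =>
      ENNReal.ofReal (Real.exp (S X φ n x)) • Measure.dirac (x : X.carrier)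

end Symbolic

end

/-! Give a word w of length n the weight exp(φ_n(w) - nP), and let the mass of a finite set of words
be the sum of its weights (`gibbs`, `mass`). The core of the argument is that the mass of L_n stays
between two positive constants. Fekete's lemma gives mass(L_n) ≥ 1 (`one_le_mass`). Conversely,
words with specification and the Bowen property can be glued freely, so their mass is bounded:
otherwise gluing many of them would produce growth faster than the pressure (`mass_le_of_hasSpecS`).
Summability over Cᵖ ∪ Cˢ carries the bound over to all of L_n (`exists_mass_language_le`), and shows
that all but ε of the mass lies in G(M), with M independent of n
(`exists_mass_filter_not_mem_fatten_le`).

Existence: μ is a weak limit of weighted orbit averages over points chosen in the cylinders of L_n.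
Submultiplicativity of weights gives the upper Gibbs bound; gluing gives the lower Gibbs bound on
G(M) and a positive correlation between sets of good words (`exists_gibbs_measure`). The upper bound
alone forces maximal free energy (`IsGenerating.pressure_le_freeEnergy`), and the correlation gives
ergodicity (`IsGenerating.ergodic`).

Uniqueness: if ν is an equilibrium state, an entropy count shows that a set of words of ν-measure at
least a has mass at least c(a) > 0 (`IsGenerating.exists_le_mass`). A definite part of it is good,
hence has definite μ-measure by the lower Gibbs bound. So ν ≪ μ, and ergodicity of μ gives ν = μ.
The periodic orbit measures satisfy an upper Gibbs bound uniformly in n, so each of their limit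
points is an equilibrium state, that is, μ.

One- and two-sided shifts are handled together: words are read at the coordinates 0, 1, 2, … only,
and `IsGenerating` is the sole property that has to be checked separately for ℕ and for ℤ. -/

set_option linter.unusedSectionVars false

noncomputable section

namespace Symbolic

/-! ### Words, cylinders, and functions determined by finitely many coordinates -/

section Words

variable {A I : Type*} [TopologicalSpace A] [AddMonoidWithOne I] (X : Subshift A I)

/-- The word spelled by the coordinates `0, …, n - 1` of `x`. -/
def word (n : ℕ) (x : X.carrier) : List A :=
  List.ofFn fun i : Fin n => x.1 ((i : ℕ) : I)

@[simp] lemma length_word (n : ℕ) (x : X.carrier) : (word X n x).length = n := by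
  simp [word]

lemma mem_cyl_iff {w : List A} {x : X.carrier} : x ∈ cyl X w ↔ word X w.length x = w := by
  constructor
  · intro h
    apply List.ext_getElem
    · simp
    · intro i h1 h2
      simp only [word, List.getElem_ofFn]
      exact h i h2
  · intro h i hi
    have h1 : (word X w.length x)[i]'(by simpa using hi) = w[i] := by
      simp only [h]
    simpa [word, List.getElem_ofFn] using h1

lemma mem_cyl_word (n : ℕ) (x : X.carrier) : x ∈ cyl X (word X n x) := by
  rw [mem_cyl_iff, length_word]

lemma word_mem_language (n : ℕ) (x : X.carrier) : word X n x ∈ language X :=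
  ⟨x, mem_cyl_word X n x⟩

lemma iterate_shiftMap_apply (k : ℕ) (x : X.carrier) (i : I) :
    ((shiftMap X)^[k] x).1 i = x.1 (k + i) := by
  induction k generalizing x with
  | zero => simp
  | succ k ih =>
    rw [Function.iterate_succ_apply, ih]
    change x.1 (1 + (k + i)) = _
    rw [← add_assoc]
    rw [add_comm k 1, Nat.cast_add, Nat.cast_one]

lemma mem_cyl_append {u v : List A} {x : X.carrier} :
    x ∈ cyl X (u ++ v) ↔ x ∈ cyl X u ∧ (shiftMap X)^[u.length] x ∈ cyl X v := by
  constructor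
  · intro h
    refine ⟨fun i hi => ?_, fun i hi => ?_⟩
    · have := h i (by simp; omega)
      rwa [List.getElem_append_left hi] at this
    · have := h (u.length + i) (by simp; omega)
      rw [List.getElem_append_right (by omega)] at this
      rw [iterate_shiftMap_apply, ← Nat.cast_add, this]
      simp
  · rintro ⟨h1, h2⟩ i hi
    by_cases hiu : i < u.length
    · rw [List.getElem_append_left hiu]; exact h1 i hiu
    · rw [List.getElem_append_right (by omega)]
      have := h2 (i - u.length) (by simp at hi; omega)
      rw [iterate_shiftMap_apply, ← Nat.cast_add, Nat.add_sub_cancel' (by omega)] at this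
      exact this

variable {X} in
lemma left_mem_language {u v : List A} (h : u ++ v ∈ language X) : u ∈ language X := by
  obtain ⟨x, hx⟩ := h
  exact ⟨x, ((mem_cyl_append X).1 hx).1⟩

variable {X} in
lemma right_mem_language {u v : List A} (h : u ++ v ∈ language X) : v ∈ language X := by
  obtain ⟨x, hx⟩ := h
  exact ⟨_, ((mem_cyl_append X).1 hx).2⟩

lemma word_add (m n : ℕ) (x : X.carrier) :
    word X (m + n) x = word X m x ++ word X n ((shiftMap X)^[m] x) := by
  have h : x ∈ cyl X (word X m x ++ word X n ((shiftMap X)^[m] x)) := by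
    rw [mem_cyl_append]
    refine ⟨mem_cyl_word X m x, ?_⟩
    rw [length_word]
    exact mem_cyl_word X n _
  rw [mem_cyl_iff] at h
  simpa using h

/-- Every continuous function is, after a shift, nearly determined by finitely many of the
coordinates `0, 1, 2, …`. -/
def IsGenerating : Prop :=
  ∀ f : C(X.carrier, ℝ), ∀ ε : ℝ, 0 < ε → ∃ m N : ℕ, 0 < N ∧ ∀ x y : X.carrier,
    word X N x = word X N y → |f ((shiftMap X)^[m] x) - f ((shiftMap X)^[m] y)| < ε

lemma continuous_shiftMap : Continuous (shiftMap X) :=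
  (SymbolicDynamics.FullShift.continuous_shift (1 : I)).restrict (X.mapsTo 1)

lemma continuous_S (φ : C(X.carrier, ℝ)) (n : ℕ) : Continuous (S X φ n) := by
  unfold S birkhoffSum
  exact continuous_finsetSum _ fun k _ =>
    φ.continuous.comp ((continuous_shiftMap X).iterate k)

lemma isClopen_cyl [DiscreteTopology A] (w : List A) : IsClopen (cyl X w) := by
  have : cyl X w = ⋂ i : Fin w.length, {x : X.carrier | x.1 ((i : ℕ) : I) = w[i]} := by
    ext x
    simp only [cyl, Set.mem_ofPred_eq, Set.mem_iInter]
    exact ⟨fun h i => h i i.2, fun h i hi => h ⟨i, hi⟩⟩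
  rw [this]
  refine isClopen_iInter_of_finite fun i => ?_
  have hc : Continuous fun x : X.carrier => x.1 ((i : ℕ) : I) :=
    (continuous_apply _).comp continuous_subtype_val
  exact (isClopen_discrete {w[i]}).preimage hc

instance [Finite A] : CompactSpace X.carrier :=
  isCompact_iff_compactSpace.1 X.isClosed.isCompact

/-- Compactness: the closed set of pairs whose values under `f` differ by at least ε misses the
diagonal, which is the directed intersection of the closed sets of pairs agreeing on a finite set of
coordinates. -/
lemma exists_finset_of_continuous [Finite A] [DiscreteTopology A] (f : C(X.carrier, ℝ)) {ε : ℝ}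
    (hε : 0 < ε) :
    ∃ s : Finset I, ∀ x y : X.carrier, (∀ i ∈ s, x.1 i = y.1 i) → |f x - f y| < ε := by
  classical
  let F : Set (X.carrier × X.carrier) := {p | ε ≤ |f p.1 - f p.2|}
  have hF : IsClosed F := isClosed_le continuous_const (by fun_prop)
  let E : Finset I → Set (X.carrier × X.carrier) := fun s => {p | ∀ i ∈ s, p.1.1 i = p.2.1 i}
  have hE : ∀ s, IsClosed (E s) := by
    intro s
    have : E s = ⋂ i ∈ s, {p : X.carrier × X.carrier | p.1.1 i = p.2.1 i} := by
      ext p; simp [E]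
    rw [this]
    refine isClosed_biInter fun i _ => isClosed_eq ?_ ?_
    · exact (continuous_apply i).comp (continuous_subtype_val.comp continuous_fst)
    · exact (continuous_apply i).comp (continuous_subtype_val.comp continuous_snd)
  have hdir : Directed (fun a b => b ⊆ a) E := by
    intro s t
    exact ⟨s ∪ t, fun p hp i hi => hp i (Finset.mem_union_left _ hi),
      fun p hp i hi => hp i (Finset.mem_union_right _ hi)⟩
  have hempty : F ∩ ⋂ s, E s = ∅ := by
    rw [Set.eq_empty_iff_forall_notMem]
    rintro ⟨x, y⟩ ⟨h1, h2⟩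
    have hxy : x = y := by
      apply Subtype.ext
      funext i
      exact Set.mem_iInter.1 h2 {i} i (by simp)
    subst hxy
    simp only [F, Set.mem_ofPred_eq, sub_self, abs_zero] at h1
    linarith
  obtain ⟨s, hs⟩ := hF.isCompact.elim_directed_family_closed E hE hempty hdir
  refine ⟨s, fun x y hxy => ?_⟩
  by_contra hcon
  have : (x, y) ∈ F ∩ E s := ⟨not_lt.1 hcon, hxy⟩
  rw [hs] at this
  exact this

lemma isGenerating_nat [Finite A] [DiscreteTopology A] (X : Subshift A ℕ) : IsGenerating X := by
  intro f ε hε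
  obtain ⟨s, hs⟩ := exists_finset_of_continuous X f hε
  refine ⟨0, s.sup id + 1, Nat.succ_pos _, fun x y hxy => hs x y fun i hi => ?_⟩
  have hi' : i < s.sup id + 1 := Nat.lt_succ_of_le (Finset.le_sup (f := id) hi)
  have := congrFun (List.ofFn_injective hxy) ⟨i, hi'⟩
  simpa using this

/-- After m shifts the window [-m, m] becomes [0, 2m], which a word of length 2m + 1 sees. -/
lemma isGenerating_int [Finite A] [DiscreteTopology A] (X : Subshift A ℤ) : IsGenerating X := by
  intro f ε hε
  obtain ⟨s, hs⟩ := exists_finset_of_continuous X f hε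
  set m := s.sup Int.natAbs with hm
  refine ⟨m, 2 * m + 1, Nat.succ_pos _, fun x y hxy => hs _ _ fun i hi => ?_⟩
  have hi' : i.natAbs ≤ m := Finset.le_sup (f := Int.natAbs) hi
  have := congrFun (List.ofFn_injective hxy) ⟨(m + i).toNat, by omega⟩
  rw [iterate_shiftMap_apply, iterate_shiftMap_apply]
  have h0 : (((m + i).toNat : ℕ) : ℤ) = m + i := by omega
  simp only [h0] at this
  exact this

/-- Periodicity extends the agreement to all words. Coordinates out of reach of words (the negative
ones over ℤ) are handled by testing the indicator of {z : z_i = x_i} at σ^(mn - m) of both points: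
the m further shifts in `IsGenerating` bring them back to x and y. -/
lemma IsGenerating.eq_of_forall_word {X : Subshift A I} [Finite A] [DiscreteTopology A]
    (hgen : IsGenerating X) {x y : X.carrier}
    {n : ℕ} (hn : 0 < n) (hx : Function.IsPeriodicPt (shiftMap X) n x)
    (hy : Function.IsPeriodicPt (shiftMap X) n y) (h : word X n x = word X n y) : x = y := by
  have hall : ∀ k, word X (k * n) x = word X (k * n) y := by
    intro k
    induction k with
    | zero => simp [word]
    | succ k ih =>
      rw [add_mul, one_mul, word_add, word_add, ih]
      rw [(hx.const_mul k).eq, (hy.const_mul k).eq, h]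
  have hall' : ∀ N, word X N x = word X N y := by
    intro N
    have h1 := hall N
    have h2 : N * n = N + (N * n - N) := by
      have := Nat.le_mul_of_pos_right N hn
      omega
    rw [h2, word_add, word_add] at h1
    exact (List.append_inj h1 (by simp)).1
  by_contra hne
  obtain ⟨i, hi⟩ : ∃ i, x.1 i ≠ y.1 i := by
    by_contra hcon
    push Not at hcon
    exact hne (Subtype.ext (funext hcon))
  have hclop : IsClopen {z : X.carrier | z.1 i = x.1 i} := by
    have hc : Continuous fun z : X.carrier => z.1 i :=
      (continuous_apply _).comp continuous_subtype_val
    exact (isClopen_discrete {x.1 i}).preimage hc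
  let f : C(X.carrier, ℝ) := ⟨Set.indicator {z : X.carrier | z.1 i = x.1 i} (fun _ => 1),
    (continuous_indicator (by simp [hclop.frontier_eq]) continuousOn_const)⟩
  obtain ⟨m, N, -, hmN⟩ := hgen f (1 / 2) (by norm_num)
  have hshift : ∀ z : X.carrier, Function.IsPeriodicPt (shiftMap X) n z →
      (shiftMap X)^[m] ((shiftMap X)^[m * n - m] z) = z := by
    intro z hz
    rw [← Function.iterate_add_apply]
    have := Nat.le_mul_of_pos_right m hn
    rw [Nat.add_sub_cancel' this]
    exact (hz.const_mul m).eq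
  have hw : word X N ((shiftMap X)^[m * n - m] x) = word X N ((shiftMap X)^[m * n - m] y) := by
    have h1 := hall' (m * n - m + N)
    rw [word_add, word_add] at h1
    exact (List.append_inj h1 (by simp)).2
  have h2 := hmN _ _ hw
  rw [hshift x hx, hshift y hy] at h2
  have hfx : f x = 1 := by simp [f]
  have hfy : f y = 0 := by simp [f, Ne.symm hi]
  rw [hfx, hfy] at h2
  norm_num at h2

end Words

lemma sum_le_sum_of_injOn {α β : Type*} {Y : Finset α} {Q : Finset β} {F : α → ℝ} {G : β → ℝ}
    (i : α → β) (hi : ∀ y ∈ Y, i y ∈ Q ∧ F y ≤ G (i y)) (hinj : Set.InjOn i Y)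
    (hG : ∀ q ∈ Q, 0 ≤ G q) : ∑ y ∈ Y, F y ≤ ∑ q ∈ Q, G q := by
  classical
  calc ∑ y ∈ Y, F y ≤ ∑ y ∈ Y, G (i y) := Finset.sum_le_sum fun y hy => (hi y hy).2
    _ = ∑ q ∈ Y.image i, G q := (Finset.sum_image hinj).symm
    _ ≤ ∑ q ∈ Q, G q := by
        refine Finset.sum_le_sum_of_subset_of_nonneg ?_ fun q hq _ => hG q hq
        intro q hq
        obtain ⟨y, hy, rfl⟩ := Finset.mem_image.1 hq
        exact (hi y hy).1

/-- A choice of preimages under `e` is automatically injective. This is the counting tool for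
concatenation and gluing: only a way of recovering the pieces, or of assembling them, has to be
exhibited. -/
lemma sum_le_sum_of_section {α β : Type*} {Y : Finset α} {Q : Finset β} {F : α → ℝ} {G : β → ℝ}
    (e : β → α) (hY : ∀ y ∈ Y, ∃ q ∈ Q, e q = y ∧ F y ≤ G q) (hG : ∀ q ∈ Q, 0 ≤ G q) :
    ∑ y ∈ Y, F y ≤ ∑ q ∈ Q, G q := by
  rcases Y.eq_empty_or_nonempty with rfl | ⟨y₀, hy₀⟩
  · simpa using Finset.sum_nonneg hG
  have : Nonempty β := ⟨(hY y₀ hy₀).choose⟩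
  choose! i hi using hY
  refine sum_le_sum_of_injOn i (fun y hy => ⟨(hi y hy).1, (hi y hy).2.2⟩) ?_ hG
  intro a ha b hb hab
  rw [← (hi a ha).2.1, ← (hi b hb).2.1, hab]

@[simp] lemma mem_wordsOfLength {A : Type*} [Finite A] {D : Set (List A)} {n : ℕ} {w : List A} :
    w ∈ wordsOfLength D n ↔ w ∈ D ∧ w.length = n := by
  simp [wordsOfLength]

/-! ### Pressure and normalised masses of words -/

section Pressure

variable {A I : Type*} [TopologicalSpace A] [AddMonoidWithOne I] [Finite A]
  (X : Subshift A I) (φ : C(X.carrier, ℝ))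

lemma S_add (m n : ℕ) (x : X.carrier) :
    S X φ (m + n) x = S X φ m x + S X φ n ((shiftMap X)^[m] x) :=
  birkhoffSum_add _ _ _ _ _

lemma abs_S_le (n : ℕ) (x : X.carrier) : |S X φ n x| ≤ n * ‖φ‖ := by
  unfold S birkhoffSum
  calc |∑ k ∈ Finset.range n, φ ((shiftMap X)^[k] x)|
      ≤ ∑ k ∈ Finset.range n, |φ ((shiftMap X)^[k] x)| := Finset.abs_sum_le_sum_abs _ _
    _ ≤ ∑ k ∈ Finset.range n, ‖φ‖ := Finset.sum_le_sum fun k _ => φ.norm_coe_le_norm _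
    _ = n * ‖φ‖ := by simp

variable {X} in
lemma S_le_wordWeight {w : List A} {x : X.carrier} (hx : x ∈ cyl X w) :
    S X φ w.length x ≤ wordWeight X φ w := by
  refine le_csSup ⟨w.length * ‖φ‖, ?_⟩ ⟨x, hx, rfl⟩
  rintro _ ⟨y, -, rfl⟩
  exact (abs_le.1 (abs_S_le X φ _ y)).2

variable {X} in
lemma wordWeight_le {w : List A} (hw : w ∈ language X) {c : ℝ}
    (h : ∀ x ∈ cyl X w, S X φ w.length x ≤ c) : wordWeight X φ w ≤ c := by
  refine csSup_le (hw.image _) ?_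
  rintro _ ⟨y, hy, rfl⟩
  exact h y hy

variable {X} in
lemma abs_wordWeight_le {w : List A} (hw : w ∈ language X) :
    |wordWeight X φ w| ≤ w.length * ‖φ‖ := by
  rw [abs_le]
  constructor
  · obtain ⟨x, hx⟩ := hw
    exact (abs_le.1 (abs_S_le X φ _ x)).1.trans (S_le_wordWeight φ hx)
  · exact wordWeight_le φ hw fun x _ => (abs_le.1 (abs_S_le X φ _ x)).2

variable {X} in
lemma wordWeight_append_le {u v : List A} (h : u ++ v ∈ language X) :
    wordWeight X φ (u ++ v) ≤ wordWeight X φ u + wordWeight X φ v := by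
  refine wordWeight_le φ h fun x hx => ?_
  rw [mem_cyl_append] at hx
  rw [List.length_append, S_add]
  exact add_le_add (S_le_wordWeight φ hx.1) (S_le_wordWeight φ hx.2)

lemma exp_le_partitionSum [Nonempty X.carrier] (n : ℕ) :
    Real.exp (-(n * ‖φ‖)) ≤ partitionSum X φ (language X) n := by
  obtain ⟨x⟩ := ‹Nonempty X.carrier›
  have hw : word X n x ∈ wordsOfLength (language X) n := by simp [word_mem_language]
  have h1 := Finset.single_le_sum
    (f := fun w => Real.exp (wordWeight X φ w)) (fun _ _ => (Real.exp_pos _).le) hw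
  refine le_trans (Real.exp_le_exp.2 ?_) h1
  have := abs_wordWeight_le φ (word_mem_language X n x)
  rw [length_word] at this
  exact (abs_le.1 this).1

lemma partitionSum_pos [Nonempty X.carrier] (n : ℕ) : 0 < partitionSum X φ (language X) n :=
  (Real.exp_pos _).trans_le (exp_le_partitionSum X φ n)

lemma partitionSum_add_le (m n : ℕ) :
    partitionSum X φ (language X) (m + n) ≤
      partitionSum X φ (language X) m * partitionSum X φ (language X) n := by
  unfold partitionSum
  rw [Finset.sum_mul_sum, ← Finset.sum_product']
  refine sum_le_sum_of_section (fun p => p.1 ++ p.2) ?_ fun _ _ => by positivity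
  intro y hy
  rw [mem_wordsOfLength] at hy
  have hsplit : y.take m ++ y.drop m = y := List.take_append_drop m y
  have hyL := hy.1
  rw [← hsplit] at hyL
  refine ⟨(y.take m, y.drop m), ?_, hsplit, ?_⟩
  · simp [left_mem_language hyL, right_mem_language hyL, hy.2]
  · rw [← Real.exp_add, Real.exp_le_exp]
    have := wordWeight_append_le φ hyL
    rwa [hsplit] at this

lemma subadditive_log_partitionSum [Nonempty X.carrier] :
    Subadditive fun n => Real.log (partitionSum X φ (language X) n) := by
  intro m n
  rw [← Real.log_mul (partitionSum_pos X φ m).ne' (partitionSum_pos X φ n).ne']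
  exact Real.log_le_log (partitionSum_pos X φ _) (partitionSum_add_le X φ m n)

lemma bddBelow_log_partitionSum [Nonempty X.carrier] :
    BddBelow (Set.range fun n : ℕ => Real.log (partitionSum X φ (language X) n) / n) := by
  refine ⟨-‖φ‖, ?_⟩
  rintro _ ⟨n, rfl⟩
  rcases Nat.eq_zero_or_pos n with rfl | hn
  · simp
  · have hn' : (0 : ℝ) < n := by exact_mod_cast hn
    simp only
    rw [le_div_iff₀ hn', Real.le_log_iff_exp_le (partitionSum_pos X φ n)]
    refine le_trans (le_of_eq ?_) (exp_le_partitionSum X φ n)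
    ring_nf

lemma pressure_eq_lim [Nonempty X.carrier] :
    pressure X φ = (subadditive_log_partitionSum X φ).lim :=
  ((subadditive_log_partitionSum X φ).tendsto_lim (bddBelow_log_partitionSum X φ)).limsup_eq

lemma tendsto_log_partitionSum [Nonempty X.carrier] :
    Tendsto (fun n : ℕ => Real.log (partitionSum X φ (language X) n) / n) atTop
      (𝓝 (pressure X φ)) := by
  rw [pressure_eq_lim]
  exact (subadditive_log_partitionSum X φ).tendsto_lim (bddBelow_log_partitionSum X φ)

lemma partitionSum_zero_le (D : Set (List A)) (hD : D ⊆ language X) :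
    partitionSum X φ D 0 ≤ 1 := by
  have h1 : ∀ w ∈ wordsOfLength D 0, Real.exp (wordWeight X φ w) ≤ 1 := by
    intro w hw
    rw [mem_wordsOfLength] at hw
    have := abs_wordWeight_le φ (hD hw.1)
    rw [hw.2] at this
    simp at this
    simp [this]
  have h2 : (wordsOfLength D 0).card ≤ 1 := by
    rw [Finset.card_le_one]
    intro a ha b hb
    rw [mem_wordsOfLength] at ha hb
    rw [List.length_eq_zero_iff.1 ha.2, List.length_eq_zero_iff.1 hb.2]
  calc partitionSum X φ D 0 ≤ ∑ w ∈ wordsOfLength D 0, 1 := Finset.sum_le_sum h1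
    _ ≤ 1 := by simpa using h2

/-- By Fekete the limit of a subadditive sequence divided by n is an infimum, so the bound holds for
every n and not only asymptotically. -/
lemma exp_pressure_le_partitionSum [Nonempty X.carrier] (n : ℕ) :
    Real.exp (n * pressure X φ) ≤ partitionSum X φ (language X) n := by
  rcases Nat.eq_zero_or_pos n with rfl | hn
  · have := exp_le_partitionSum X φ 0
    simpa using this
  · rw [← Real.le_log_iff_exp_le (partitionSum_pos X φ n)]
    have h := (subadditive_log_partitionSum X φ).lim_le_div (bddBelow_log_partitionSum X φ) hn.ne'
    rw [← pressure_eq_lim] at h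
    have hn' : (0 : ℝ) < n := by exact_mod_cast hn
    rw [le_div_iff₀ hn'] at h
    linarith

/-- The weight `exp (φ_n(w) - n P(φ))` of a word `w` of length `n`. -/
def gibbs (w : List A) : ℝ :=
  Real.exp (-(w.length : ℝ) * pressure X φ + wordWeight X φ w)

lemma gibbs_pos (w : List A) : 0 < gibbs X φ w := Real.exp_pos _

/-- The total normalised weight of a finite set of words. -/
def mass (E : Finset (List A)) : ℝ := ∑ w ∈ E, gibbs X φ w

lemma mass_nonneg (E : Finset (List A)) : 0 ≤ mass X φ E :=
  Finset.sum_nonneg fun _ _ => (gibbs_pos X φ _).le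

lemma mass_mono {E F : Finset (List A)} (h : E ⊆ F) : mass X φ E ≤ mass X φ F :=
  Finset.sum_le_sum_of_subset_of_nonneg h fun _ _ _ => (gibbs_pos X φ _).le

lemma sum_exp_wordWeight {E : Finset (List A)} {n : ℕ} (hE : ∀ w ∈ E, w.length = n) :
    ∑ w ∈ E, Real.exp (wordWeight X φ w) = Real.exp (n * pressure X φ) * mass X φ E := by
  unfold mass
  rw [Finset.mul_sum]
  refine Finset.sum_congr rfl fun w hw => ?_
  rw [gibbs, ← Real.exp_add, hE w hw]
  congr 1; ring

lemma partitionSum_eq_mass (D : Set (List A)) (n : ℕ) :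
    partitionSum X φ D n = Real.exp (n * pressure X φ) * mass X φ (wordsOfLength D n) :=
  sum_exp_wordWeight X φ fun _ hw => (mem_wordsOfLength.1 hw).2

lemma mass_wordsOfLength (D : Set (List A)) (n : ℕ) :
    mass X φ (wordsOfLength D n) = partitionSum X φ D n * Real.exp (-(n : ℝ) * pressure X φ) := by
  rw [partitionSum_eq_mass, mul_comm, ← mul_assoc, ← Real.exp_add]
  simp

lemma one_le_mass [Nonempty X.carrier] (n : ℕ) :
    1 ≤ mass X φ (wordsOfLength (language X) n) := by
  have h := exp_pressure_le_partitionSum X φ n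
  rw [partitionSum_eq_mass] at h
  exact le_of_mul_le_mul_left (by simpa using h) (Real.exp_pos (n * pressure X φ))

variable {X} in
lemma gibbs_append_le {u v : List A} (h : u ++ v ∈ language X) :
    gibbs X φ (u ++ v) ≤ gibbs X φ u * gibbs X φ v := by
  unfold gibbs
  rw [← Real.exp_add, Real.exp_le_exp, List.length_append]
  have := wordWeight_append_le φ h
  push_cast
  linarith

end Pressure

/-! ### Gluing words by specification -/

section Gluing

variable {A I : Type*} [TopologicalSpace A] [AddMonoidWithOne I] [Finite A]
  (X : Subshift A I) (φ : C(X.carrier, ℝ))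

/-- The position of the `i`-th of several blocks of lengths `n 0, …, n m` separated by gaps of
length `t`. -/
def gluePos (t : ℕ) {m : ℕ} (n : Fin (m + 1) → ℕ) (i : Fin (m + 1)) : ℕ :=
  ∑ j, if j < i then n j + t else 0

lemma gluePos_zero (t : ℕ) {m : ℕ} (n : Fin (m + 1) → ℕ) : gluePos t n 0 = 0 := by
  simp [gluePos]

lemma gluePos_succ (t : ℕ) {m : ℕ} (n : Fin (m + 2) → ℕ) (i : Fin (m + 1)) :
    gluePos t n i.succ = n 0 + (t + gluePos t (fun j => n j.succ) i) := by
  unfold gluePos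
  rw [Fin.sum_univ_succ, if_pos (Fin.succ_pos i), add_assoc]
  simp only [Fin.succ_lt_succ_iff]

lemma glue_succ {m : ℕ} (w : Fin (m + 2) → List A) (v : Fin (m + 1) → List A) :
    glue w v = w 0 ++ (v 0 ++ glue (fun i => w i.succ) (fun i => v i.succ)) := by
  unfold glue
  rw [List.ofFn_succ, List.flatten_cons]
  simp

lemma glue_zero (w : Fin 1 → List A) (v : Fin 0 → List A) : glue w v = w 0 := by
  simp [glue]

lemma length_glue {t m : ℕ} (w : Fin (m + 1) → List A) (v : Fin m → List A)
    (hv : ∀ i, (v i).length = t) : (glue w v).length = ∑ i, (w i).length + m * t := by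
  induction m with
  | zero => simp [glue_zero]
  | succ m ih =>
    rw [glue_succ, List.length_append, List.length_append, ih _ _ fun i => hv i.succ, hv,
      Fin.sum_univ_succ (n := m + 1)]
    ring

lemma mem_cyl_of_mem_cyl_glue {t m : ℕ} (w : Fin (m + 1) → List A) (v : Fin m → List A)
    (hv : ∀ i, (v i).length = t) {x : X.carrier} (hx : x ∈ cyl X (glue w v)) (i : Fin (m + 1)) :
    (shiftMap X)^[gluePos t (fun j => (w j).length) i] x ∈ cyl X (w i) := by
  induction m generalizing x with
  | zero =>
    obtain rfl : i = 0 := by ext; omega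
    rw [gluePos_zero]
    rwa [glue_zero] at hx
  | succ m ih =>
    rw [glue_succ, mem_cyl_append, mem_cyl_append] at hx
    obtain ⟨h0, -, h2⟩ := hx
    refine Fin.cases ?_ (fun i => ?_) i
    · rw [gluePos_zero]; exact h0
    · rw [gluePos_succ]
      have := ih (fun i => w i.succ) (fun i => v i.succ) (fun i => hv i.succ) h2 i
      rwa [← Function.iterate_add_apply, ← Function.iterate_add_apply, hv,
        show gluePos t (fun j => (w j.succ).length) i + t + (w 0).length =
          (w 0).length + (t + gluePos t (fun j => (w j.succ).length) i) by ring] at this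

lemma le_S_of_mem_cyl_glue {t m : ℕ} {V : ℝ} (w : Fin (m + 1) → List A) (v : Fin m → List A)
    (hw : ∀ i, ∀ x ∈ cyl X (w i), wordWeight X φ (w i) - V ≤ S X φ (w i).length x)
    (hv : ∀ i, (v i).length = t) {x : X.carrier} (hx : x ∈ cyl X (glue w v)) :
    ∑ i, wordWeight X φ (w i) - ((m + 1) * V + m * t * ‖φ‖) ≤ S X φ (glue w v).length x := by
  induction m generalizing x with
  | zero =>
    rw [glue_zero] at hx ⊢
    simpa using hw 0 x hx
  | succ m ih =>
    rw [glue_succ] at hx ⊢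
    rw [mem_cyl_append, mem_cyl_append] at hx
    obtain ⟨h0, -, h2⟩ := hx
    have h3 := ih (fun i => w i.succ) (fun i => v i.succ) (fun i => hw i.succ)
      (fun i => hv i.succ) h2
    have h4 := (abs_le.1 (abs_S_le X φ (v 0).length ((shiftMap X)^[(w 0).length] x))).1
    have h5 := hw 0 x h0
    rw [List.length_append, List.length_append, S_add, S_add, Fin.sum_univ_succ]
    rw [hv] at h3 h4 ⊢
    push_cast
    linarith

/-- Words of `D` can be glued freely; the glued words have a comparable total mass. -/
lemma prod_mass_le_mass_glue {D : Set (List A)} {t : ℕ} (hD : HasSpecS X D t) {V : ℝ}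
    (hV : ∀ w ∈ D, ∀ x ∈ cyl X w, wordWeight X φ w - V ≤ S X φ w.length x)
    {m : ℕ} (n : Fin (m + 1) → ℕ) (E : Fin (m + 1) → Finset (List A))
    (hE : ∀ i, ∀ w ∈ E i, w ∈ D ∧ w.length = n i) (R : List A → Prop) [DecidablePred R]
    (hR : ∀ r ∈ language X, (∃ w : Fin (m + 1) → List A, (∀ i, w i ∈ E i) ∧
      ∀ x ∈ cyl X r, ∀ i, (shiftMap X)^[gluePos t n i] x ∈ cyl X (w i)) → R r) :
    Real.exp (-((m + 1) * V + m * t * (‖φ‖ + pressure X φ))) * ∏ i, mass X φ (E i) ≤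
      mass X φ ((wordsOfLength (language X) (∑ i, n i + m * t)).filter R) := by
  classical
  unfold mass
  rw [Finset.prod_univ_sum, Finset.mul_sum]
  -- Gluing loses nothing: the blocks of `r` are read off at the positions `gluePos` along any point
  -- of its cylinder. The value `[]` for an empty cylinder is never used.
  refine sum_le_sum_of_section (fun r i => if h : (cyl X r).Nonempty then
    word X (n i) ((shiftMap X)^[gluePos t n i] h.some) else []) ?_ fun _ _ => (gibbs_pos X φ _).le
  intro w hw
  rw [Fintype.mem_piFinset] at hw
  obtain ⟨v, hv, hg⟩ := hD m w fun i => (hE i _ (hw i)).1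
  have hn : (fun i => (w i).length) = n := funext fun i => (hE i _ (hw i)).2
  have hlen : (glue w v).length = ∑ i, n i + m * t := by
    rw [length_glue w v fun i => (hv i).2, ← hn]
  have hmem : ∀ x ∈ cyl X (glue w v), ∀ i,
      (shiftMap X)^[gluePos t n i] x ∈ cyl X (w i) := by
    intro x hx i
    have := mem_cyl_of_mem_cyl_glue X w v (fun i => (hv i).2) hx i
    rwa [hn] at this
  refine ⟨glue w v, ?_, ?_, ?_⟩
  · rw [Finset.mem_filter, mem_wordsOfLength]
    exact ⟨⟨hg, hlen⟩, hR _ hg ⟨w, hw, hmem⟩⟩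
  · funext i
    have hne : (cyl X (glue w v)).Nonempty := hg
    simp only [dif_pos hne]
    have := (mem_cyl_iff X).1 (hmem _ hne.some_mem i)
    rwa [(hE i _ (hw i)).2] at this
  · unfold gibbs
    rw [← Real.exp_sum, ← Real.exp_add, Real.exp_le_exp]
    obtain ⟨x, hx⟩ := hg
    have h1 := le_S_of_mem_cyl_glue X φ w v (fun i => hV _ (hE i _ (hw i)).1)
      (fun i => (hv i).2) hx
    have h2 := S_le_wordWeight φ hx
    rw [hlen, Finset.sum_add_distrib, ← Finset.sum_mul, Finset.sum_neg_distrib]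
    have h3 : ∑ i, ((w i).length : ℝ) = ((∑ i, n i : ℕ) : ℝ) := by
      rw [← hn]; push_cast; rfl
    rw [h3]
    rw [hlen] at h1 h2
    push_cast at *
    linarith

/-- A collection with specification and the Bowen property has at most exponential growth at rate
the pressure. -/
lemma mass_le_of_hasSpecS [Nonempty X.carrier] {D : Set (List A)} {t : ℕ} (hD : HasSpecS X D t)
    (hDL : D ⊆ language X) {V : ℝ} (hV0 : 0 ≤ V)
    (hV : ∀ w ∈ D, ∀ x ∈ cyl X w, wordWeight X φ w - V ≤ S X φ w.length x) (n : ℕ) :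
    mass X φ (wordsOfLength D n) ≤ Real.exp (V + t * (‖φ‖ + |pressure X φ|)) := by
  classical
  have hnn : 0 ≤ (t : ℝ) * (‖φ‖ + |pressure X φ|) := by positivity
  rcases Nat.eq_zero_or_pos n with rfl | hn
  · rw [mass_wordsOfLength]
    have := partitionSum_zero_le X φ D hDL
    simp only [CharP.cast_eq_zero, neg_zero, zero_mul, Real.exp_zero, mul_one]
    exact this.trans (Real.one_le_exp (by positivity))
  set a := mass X φ (wordsOfLength D n) with ha
  rcases (mass_nonneg X φ (wordsOfLength D n)).eq_or_lt with h0 | hapos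
  · rw [ha, ← h0]; positivity
  rw [← ha] at hapos
  rw [← Real.log_le_iff_le_exp hapos]
  set P := pressure X φ with hP
  -- The length of m + 1 words of length n glued with m gaps.
  set N : ℕ → ℕ := fun m => (m + 1) * n + m * t with hN
  have hNpos : ∀ m, 0 < N m := fun m => by positivity
  have key : ∀ m : ℕ, (m + 1) * (Real.log a - V - t * (‖φ‖ + |P|)) + N m * P ≤
      Real.log (partitionSum X φ (language X) (N m)) := by
    intro m
    have h1 := prod_mass_le_mass_glue X φ hD hV (fun _ : Fin (m + 1) => n)
      (fun _ => wordsOfLength D n) (fun _ w hw => mem_wordsOfLength.1 hw) (fun _ => True)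
      (fun _ _ _ => trivial)
    rw [Finset.prod_const, Finset.card_univ, Fintype.card_fin, Finset.filter_true,
      Finset.sum_const, Finset.card_univ, Fintype.card_fin, smul_eq_mul, ← ha] at h1
    change _ ≤ mass X φ (wordsOfLength (language X) (N m)) at h1
    rw [Real.le_log_iff_exp_le (partitionSum_pos X φ _), partitionSum_eq_mass, add_comm,
      Real.exp_add]
    refine mul_le_mul_of_nonneg_left (le_trans ?_ h1) (Real.exp_pos _).le
    rw [← Real.exp_log hapos, ← Real.exp_nat_mul, ← Real.exp_add, Real.exp_le_exp,
      Real.log_exp]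
    have h2 : 0 ≤ (t : ℝ) * (|P| - P) := mul_nonneg (by positivity) (by linarith [le_abs_self P])
    have h3 : 0 ≤ (m : ℝ) * (t * (|P| - P)) := mul_nonneg (by positivity) h2
    push_cast
    nlinarith
  have hlim := (tendsto_log_partitionSum X φ).comp
    (tendsto_atTop_mono (fun m => by
      have := Nat.le_mul_of_pos_right m hn
      simp only [hN, id, add_mul]; omega) tendsto_id : Tendsto N atTop atTop)
  by_contra hcon
  push Not at hcon
  -- An excess δ in each of the m + 1 blocks, over a length N m ≤ (m + 1)(n + t), would raise the
  -- growth rate above the pressure by δ / (n + t).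
  set δ := Real.log a - V - t * (‖φ‖ + |P|) with hδ
  have hδpos : 0 < δ := by linarith
  have hlow : ∀ m : ℕ, δ / (n + t) + P ≤
      Real.log (partitionSum X φ (language X) (N m)) / (N m) := by
    intro m
    have hN' : (0 : ℝ) < N m := by exact_mod_cast hNpos m
    have hn' : (0 : ℝ) < n := by exact_mod_cast hn
    have hnt : (0 : ℝ) < n + t := by positivity
    rw [le_div_iff₀ hN', add_mul]
    have h1 : δ / (n + t) * N m ≤ (m + 1) * δ := by
      rw [div_mul_eq_mul_div, div_le_iff₀ hnt]
      have : (N m : ℝ) ≤ (m + 1) * (n + t) := by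
        simp only [hN]; push_cast
        have : (0 : ℝ) ≤ t := by positivity
        nlinarith
      nlinarith
    linarith [key m]
  have := ge_of_tendsto' hlim hlow
  have : 0 < δ / (n + t) := by positivity
  linarith

end Gluing

/-! ### Masses under the decomposition into prefix, good core and suffix -/

section Decomposition

variable {A I : Type*} [TopologicalSpace A] [AddMonoidWithOne I] [Finite A]
  {X : Subshift A I} {φ : C(X.carrier, ℝ)} {Cp G Cs : Set (List A)}

lemma fatten_subset_language (M : ℕ) : fatten X Cp G Cs M ⊆ language X := fun _ h => h.1

lemma fatten_mono {M N : ℕ} (h : M ≤ N) : fatten X Cp G Cs M ⊆ fatten X Cp G Cs N := by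
  rintro y ⟨hy, u, hu, v, hv, w, hw, h1, h2, rfl⟩
  exact ⟨hy, u, hu, v, hv, w, hw, h1.trans h, h2.trans h, rfl⟩

lemma HasBowen.exists_fatten (hB : HasBowen X φ G) (M : ℕ) :
    ∃ V : ℝ, 0 ≤ V ∧ ∀ y ∈ fatten X Cp G Cs M, ∀ x ∈ cyl X y,
      wordWeight X φ y - V ≤ S X φ y.length x := by
  obtain ⟨V, hV⟩ := hB
  -- Prefix and suffix have length at most M, and each is compared at two points.
  refine ⟨|V| + 4 * M * ‖φ‖, by positivity, ?_⟩
  rintro y ⟨hy, u, hu, v, hv, w, hw, h1, h2, rfl⟩ x hx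
  rw [sub_le_iff_le_add]
  refine wordWeight_le φ hy fun z hz => ?_
  rw [mem_cyl_append, mem_cyl_append, List.length_append] at hx hz
  rw [List.length_append, List.length_append, S_add, S_add, S_add, S_add]
  have e1 := (abs_le.1 (hV v hv _ hz.1.2 _ hx.1.2)).2
  have e2 := (abs_le.1 (abs_S_le X φ u.length z)).2
  have e3 := (abs_le.1 (abs_S_le X φ u.length x)).1
  have e4 := (abs_le.1 (abs_S_le X φ w.length ((shiftMap X)^[u.length + v.length] z))).2
  have e5 := (abs_le.1 (abs_S_le X φ w.length ((shiftMap X)^[u.length + v.length] x))).1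
  have h1' : (u.length : ℝ) * ‖φ‖ ≤ M * ‖φ‖ := by gcongr
  have h2' : (w.length : ℝ) * ‖φ‖ ≤ M * ‖φ‖ := by gcongr
  linarith [le_abs_self V]

variable (X Cp G Cs) in
/-- The words of `G` that occur as the core of a decomposition. -/
def core : Set (List A) := {v | v ∈ G ∧ ∃ u ∈ Cp, ∃ w ∈ Cs, u ++ v ++ w ∈ language X}

lemma core_subset_language : core X Cp G Cs ⊆ language X := by
  rintro v ⟨-, u, -, w, -, h⟩
  exact right_mem_language (left_mem_language h)

/-- If the empty word is missing from Cᵖ or Cˢ, a word of G need not lie in any G(M). If it is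
missing from Cˢ, then in the decomposition of a one-letter word [b] the suffix must be all of [b],
so [b] ∈ Cˢ; likewise for Cᵖ, where moreover the suffix is then empty, so [] ∈ Cˢ. Hence one letter,
added on a fixed side, is enough. -/
lemma exists_extension_core [Nonempty X.carrier] (hdec : IsDecomposition X Cp G Cs) :
    ∃ i k : ℕ, ∀ v ∈ core X Cp G Cs, ∃ a b : List A, a.length = i ∧ b.length = k ∧
      a ++ v ++ b ∈ fatten X Cp G Cs 1 := by
  obtain ⟨-, -, -, hd⟩ := hdec
  by_cases hp : [] ∈ Cp
  · by_cases hs : [] ∈ Cs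
    · refine ⟨0, 0, fun v hv => ⟨[], [], rfl, rfl, ?_⟩⟩
      refine ⟨by simpa using core_subset_language hv, [], hp, v, hv.1, [], hs, ?_⟩
      simp
    · refine ⟨0, 1, ?_⟩
      rintro v ⟨hv, u, hu, w, hw, h⟩
      obtain ⟨b, w', rfl⟩ : ∃ b w', w = b :: w' := by
        cases w with
        | nil => exact absurd hw hs
        | cons b w' => exact ⟨b, w', rfl⟩
      have h' : u ++ (v ++ ([b] ++ w')) ∈ language X := by simpa using h
      have hb : [b] ∈ language X :=
        left_mem_language (right_mem_language (right_mem_language h'))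
      have hvb : v ++ [b] ∈ language X := by
        have := right_mem_language h'
        rw [← List.append_assoc] at this
        exact left_mem_language this
      obtain ⟨u₁, -, v₁, -, w₁, hw₁, he⟩ := hd [b] hb (by simp)
      have hw₁b : w₁ = [b] := by
        have hne : w₁ ≠ [] := fun h => hs (h ▸ hw₁)
        rcases List.append_eq_singleton_iff.1 he.symm with h | h
        · exact h.2
        · exact absurd h.2 hne
      exact ⟨[], [b], rfl, rfl, by simpa using hvb, [], hp, v, hv, [b], hw₁b ▸ hw₁, by simp⟩
  · refine ⟨1, 0, ?_⟩
    rintro v ⟨hv, u, hu, w, hw, h⟩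
    obtain ⟨u', a, rfl⟩ : ∃ u' a, u = u' ++ [a] := by
      rcases List.eq_nil_or_concat u with rfl | ⟨u', a, rfl⟩
      · exact absurd hu hp
      · exact ⟨u', a, List.concat_eq_append⟩
    have hav : [a] ++ v ∈ language X := by
      have := left_mem_language h
      rw [List.append_assoc] at this
      exact right_mem_language this
    obtain ⟨u₁, hu₁, v₁, -, w₁, hw₁, he⟩ := hd [a] (left_mem_language hav) (by simp)
    have hne : u₁ ≠ [] := fun h => hp (h ▸ hu₁)
    have hu₁a : u₁ = [a] ∧ w₁ = [] := by
      rcases List.append_eq_singleton_iff.1 he.symm with h | h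
      · exact absurd (List.append_eq_nil_iff.1 h.1).1 hne
      · rcases List.append_eq_singleton_iff.1 h.1 with h' | h'
        · exact absurd h'.1 hne
        · exact ⟨h'.1, h.2⟩
    exact ⟨[a], [], rfl, rfl, by simpa using hav, [a], hu₁a.1 ▸ hu₁, v, hv, [],
      hu₁a.2 ▸ hw₁, by simp⟩

/-- The extension by i + k letters injects the cores into G(1), where specification bounds the mass,
and changes weights by a bounded factor only. -/
lemma exists_mass_core_le [Nonempty X.carrier] (hdec : IsDecomposition X Cp G Cs)
    (hspec : ∀ M : ℕ, ∃ t : ℕ, HasSpecS X (fatten X Cp G Cs M) t) (hB : HasBowen X φ G) :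
    ∃ C : ℝ, 0 ≤ C ∧ ∀ n, mass X φ (wordsOfLength (core X Cp G Cs) n) ≤ C := by
  obtain ⟨t, ht⟩ := hspec 1
  obtain ⟨V₁, hV₁0, hV₁⟩ := HasBowen.exists_fatten (Cp := Cp) (Cs := Cs) hB 1
  obtain ⟨i, k, hik⟩ := exists_extension_core hdec
  obtain ⟨V, hV⟩ := hB
  have hfat := mass_le_of_hasSpecS X φ ht (fatten_subset_language 1) hV₁0 hV₁
  set C₁ := Real.exp (V₁ + t * (‖φ‖ + |pressure X φ|))
  set c := Real.exp (V + (i + k) * (‖φ‖ + |pressure X φ|)) with hc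
  refine ⟨c * C₁, by positivity, fun n => ?_⟩
  refine le_trans ?_ (mul_le_mul_of_nonneg_left (hfat (i + n + k)) (Real.exp_pos _).le)
  unfold mass
  rw [Finset.mul_sum]
  refine sum_le_sum_of_section (fun y => (y.drop i).take n) ?_
    fun _ _ => mul_nonneg (Real.exp_pos _).le (gibbs_pos X φ _).le
  intro v hv
  rw [mem_wordsOfLength] at hv
  obtain ⟨a, b, ha, hb, hab⟩ := hik v hv.1
  refine ⟨a ++ v ++ b, ?_, ?_, ?_⟩
  · rw [mem_wordsOfLength]
    exact ⟨hab, by simp [ha, hb, hv.2, add_assoc]⟩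
  · rw [List.append_assoc, ← ha, List.drop_left, ← hv.2, List.take_left]
  · unfold gibbs
    rw [← Real.exp_add, Real.exp_le_exp]
    obtain ⟨x, hx⟩ := hab.1
    have hS := S_le_wordWeight φ hx
    rw [List.length_append, List.length_append, S_add, S_add, ha, hb] at hS
    rw [mem_cyl_append, mem_cyl_append, ha] at hx
    have hw : wordWeight X φ v ≤ S X φ v.length ((shiftMap X)^[i] x) + V :=
      wordWeight_le φ (core_subset_language hv.1) fun z hz => by
        linarith [(abs_le.1 (hV v hv.1.1 z hz _ hx.1.2)).2]
    have e1 := (abs_le.1 (abs_S_le X φ i x)).1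
    have e2 := (abs_le.1 (abs_S_le X φ k ((shiftMap X)^[i + v.length] x))).1
    have e3 : 0 ≤ (i : ℝ) * (|pressure X φ| - pressure X φ) :=
      mul_nonneg (by positivity) (by linarith [le_abs_self (pressure X φ)])
    have e4 : 0 ≤ (k : ℝ) * (|pressure X φ| - pressure X φ) :=
      mul_nonneg (by positivity) (by linarith [le_abs_self (pressure X φ)])
    rw [List.length_append, List.length_append, ha, hb]
    push_cast
    nlinarith

/-- Weights are submultiplicative under concatenation, and the middle words that occur are cores, of
mass at most `C` for each length. `Q` records which pairs (|u|, |w|) are allowed. -/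
lemma mass_le_of_decomposition {C : ℝ}
    (hC : ∀ n, mass X φ (wordsOfLength (core X Cp G Cs) n) ≤ C) {n : ℕ} {Y : Finset (List A)}
    {Q : Finset (ℕ × ℕ)} (hYL : ∀ y ∈ Y, y ∈ language X ∧ y.length = n)
    (hY : ∀ y ∈ Y, ∃ u ∈ Cp, ∃ v ∈ G, ∃ w ∈ Cs, y = u ++ v ++ w ∧ (u.length, w.length) ∈ Q) :
    mass X φ Y ≤ C * ∑ q ∈ Q, mass X φ (wordsOfLength (Cp ∪ Cs) q.1) *
      mass X φ (wordsOfLength (Cp ∪ Cs) q.2) := by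
  have h1 : mass X φ Y ≤ ∑ p ∈ Q.sigma (fun q => wordsOfLength (Cp ∪ Cs) q.1 ×ˢ
      (wordsOfLength (Cp ∪ Cs) q.2 ×ˢ wordsOfLength (core X Cp G Cs) (n - q.1 - q.2))),
      gibbs X φ p.2.1 * (gibbs X φ p.2.2.1 * gibbs X φ p.2.2.2) := by
    refine sum_le_sum_of_section (fun p => p.2.1 ++ p.2.2.2 ++ p.2.2.1) ?_ ?_
    · intro y hy
      obtain ⟨u, hu, v, hv, w, hw, rfl, hq⟩ := hY y hy
      obtain ⟨hL, hlen⟩ := hYL _ hy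
      refine ⟨⟨(u.length, w.length), u, w, v⟩, ?_, rfl, ?_⟩
      · simp only [List.length_append] at hlen
        simp only [Finset.mem_sigma, Finset.mem_product, mem_wordsOfLength, hq, true_and]
        refine ⟨⟨Or.inl hu, trivial⟩, ⟨Or.inr hw, trivial⟩, ⟨hv, u, hu, w, hw, hL⟩, by omega⟩
      · have e1 := gibbs_append_le φ hL
        have e2 := gibbs_append_le φ (left_mem_language hL)
        have := gibbs_pos X φ w
        calc _ ≤ gibbs X φ (u ++ v) * gibbs X φ w := e1
          _ ≤ gibbs X φ u * gibbs X φ v * gibbs X φ w := by gcongr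
          _ = _ := by ring
    · intro p _
      exact mul_nonneg (gibbs_pos X φ _).le (mul_nonneg (gibbs_pos X φ _).le (gibbs_pos X φ _).le)
  refine h1.trans ?_
  rw [Finset.sum_sigma, Finset.mul_sum]
  refine Finset.sum_le_sum fun q _ => ?_
  rw [Finset.sum_product]
  simp only
  simp_rw [Finset.sum_product, ← Finset.mul_sum, ← Finset.sum_mul]
  change mass X φ _ * (mass X φ _ * mass X φ _) ≤ _
  have e1 := mass_nonneg X φ (wordsOfLength (Cp ∪ Cs) q.1)
  have e2 := mass_nonneg X φ (wordsOfLength (Cp ∪ Cs) q.2)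
  calc _ ≤ mass X φ (wordsOfLength (Cp ∪ Cs) q.1) *
        (mass X φ (wordsOfLength (Cp ∪ Cs) q.2) * C) := by gcongr; exact hC _
    _ = _ := by ring

lemma summable_mass (hsum : Summable fun n : ℕ => partitionSum X φ (Cp ∪ Cs) (n + 1) *
        Real.exp (-((n + 1 : ℕ) : ℝ) * pressure X φ)) :
    Summable fun n : ℕ => mass X φ (wordsOfLength (Cp ∪ Cs) n) := by
  rw [← summable_nat_add_iff 1]
  simpa only [mass_wordsOfLength] using hsum

lemma exists_mass_language_le [Nonempty X.carrier] (hdec : IsDecomposition X Cp G Cs)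
    (hspec : ∀ M : ℕ, ∃ t : ℕ, HasSpecS X (fatten X Cp G Cs M) t) (hB : HasBowen X φ G)
    (hsum : Summable fun n : ℕ => partitionSum X φ (Cp ∪ Cs) (n + 1) *
        Real.exp (-((n + 1 : ℕ) : ℝ) * pressure X φ)) :
    ∃ K : ℝ, 1 ≤ K ∧ ∀ n, mass X φ (wordsOfLength (language X) n) ≤ K := by
  obtain ⟨C, hC0, hC⟩ := exists_mass_core_le hdec hspec hB
  have hc := summable_mass hsum
  set c := fun n : ℕ => mass X φ (wordsOfLength (Cp ∪ Cs) n) with hcdef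
  have hc0 : ∀ n, 0 ≤ c n := fun n => mass_nonneg X φ _
  refine ⟨max 1 (C * ((∑' i, c i) * (∑' i, c i))), le_max_left _ _, fun n => ?_⟩
  -- The empty word need not have a decomposition.
  rcases Nat.eq_zero_or_pos n with rfl | hn
  · refine le_max_of_le_left ?_
    rw [mass_wordsOfLength]
    simpa using partitionSum_zero_le X φ _ le_rfl
  refine le_max_of_le_right ?_
  refine (mass_le_of_decomposition (Q := Finset.range (n + 1) ×ˢ Finset.range (n + 1)) hC
    (fun y hy => mem_wordsOfLength.1 hy) ?_).trans ?_
  · intro y hy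
    rw [mem_wordsOfLength] at hy
    obtain ⟨u, hu, v, hv, w, hw, h⟩ := hdec.2.2.2 y hy.1 (by rintro rfl; simp at hy; omega)
    have := congrArg List.length h
    simp only [List.length_append] at this
    refine ⟨u, hu, v, hv, w, hw, h, ?_⟩
    simp only [Finset.mem_product, Finset.mem_range]
    omega
  · rw [Finset.sum_product]
    simp only
    rw [← Finset.sum_mul_sum]
    have hle := hc.sum_le_tsum (Finset.range (n + 1)) fun i _ => hc0 i
    have h0 := Finset.sum_nonneg (s := Finset.range (n + 1)) fun i _ => hc0 i
    exact mul_le_mul_of_nonneg_left (mul_le_mul hle hle h0 (h0.trans hle)) hC0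

/-- Outside G(M) the prefix or the suffix is longer than M, so the mass is bounded by a tail of a
convergent series, uniformly in n. -/
lemma exists_mass_filter_not_mem_fatten_le [Nonempty X.carrier] (hdec : IsDecomposition X Cp G Cs)
    (hspec : ∀ M : ℕ, ∃ t : ℕ, HasSpecS X (fatten X Cp G Cs M) t) (hB : HasBowen X φ G)
    (hsum : Summable fun n : ℕ => partitionSum X φ (Cp ∪ Cs) (n + 1) *
        Real.exp (-((n + 1 : ℕ) : ℝ) * pressure X φ)) {ε : ℝ} (hε : 0 < ε) :
    ∃ M₀, ∀ M, M₀ ≤ M → ∀ n, 0 < n → ∀ Y : Finset (List A),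
      (∀ y ∈ Y, y ∈ language X ∧ y.length = n) → (∀ y ∈ Y, y ∉ fatten X Cp G Cs M) →
      mass X φ Y ≤ ε := by
  obtain ⟨C, hC0, hC⟩ := exists_mass_core_le hdec hspec hB
  have hc := summable_mass hsum
  set c := fun n : ℕ => mass X φ (wordsOfLength (Cp ∪ Cs) n) with hcdef
  have hc0 : ∀ n, 0 ≤ c n := fun n => mass_nonneg X φ _
  set Z := ∑' i, c i with hZ
  have hZ0 : 0 ≤ Z := tsum_nonneg hc0
  have hlim : Tendsto (fun M : ℕ => C * (2 * (Z * (Z - ∑ i ∈ Finset.range (M + 1), c i)))) atTop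
      (𝓝 (C * (2 * (Z * (Z - Z))))) :=
    ((((tendsto_const_nhds.sub ((tendsto_add_atTop_iff_nat 1).2
      hc.hasSum.tendsto_sum_nat)).const_mul Z).const_mul 2).const_mul C)
  rw [sub_self, mul_zero, mul_zero, mul_zero] at hlim
  obtain ⟨M₀, hM₀⟩ := eventually_atTop.1 (hlim.eventually (ge_mem_nhds hε))
  refine ⟨M₀, fun M hM n hn Y hYL hYM => le_trans ?_ (hM₀ M hM)⟩
  set R := Finset.range (n + 1)
  -- The lengths in (M, n].
  set R' := R \ Finset.range (M + 1) with hR'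
  refine (mass_le_of_decomposition (Q := R' ×ˢ R ∪ R ×ˢ R') hC hYL ?_).trans ?_
  · intro y hy
    obtain ⟨hyL, hylen⟩ := hYL y hy
    obtain ⟨u, hu, v, hv, w, hw, h⟩ := hdec.2.2.2 y hyL (by rintro rfl; simp at hylen; omega)
    have hnot : ¬ (u.length ≤ M ∧ w.length ≤ M) := fun hh =>
      hYM y hy ⟨hyL, u, hu, v, hv, w, hw, hh.1, hh.2, h⟩
    have := congrArg List.length h
    simp only [List.length_append] at this
    refine ⟨u, hu, v, hv, w, hw, h, ?_⟩
    simp only [Finset.mem_union, Finset.mem_product, Finset.mem_range, hR', Finset.mem_sdiff, R]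
    omega
  · have hle : ∑ i ∈ R, c i ≤ Z := hc.sum_le_tsum R fun i _ => hc0 i
    have h0 : 0 ≤ ∑ i ∈ R, c i := Finset.sum_nonneg fun i _ => hc0 i
    have h0' : 0 ≤ ∑ i ∈ R', c i := Finset.sum_nonneg fun i _ => hc0 i
    have hle' : ∑ i ∈ R', c i ≤ Z - ∑ i ∈ Finset.range (M + 1), c i := by
      rw [le_sub_iff_add_le, ← Finset.sum_union Finset.sdiff_disjoint]
      exact hc.sum_le_tsum _ fun i _ => hc0 i
    have hu := Finset.sum_union_inter (s₁ := R' ×ˢ R) (s₂ := R ×ˢ R')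
      (f := fun q : ℕ × ℕ => c q.1 * c q.2)
    have hi : 0 ≤ ∑ q ∈ (R' ×ˢ R) ∩ (R ×ˢ R'), c q.1 * c q.2 :=
      Finset.sum_nonneg fun q _ => mul_nonneg (hc0 _) (hc0 _)
    rw [Finset.sum_product, Finset.sum_product] at hu
    simp only at hu
    rw [← Finset.sum_mul_sum, ← Finset.sum_mul_sum] at hu
    have hprod := mul_le_mul hle hle' h0' hZ0
    have hfin : ∑ q ∈ R' ×ˢ R ∪ R ×ˢ R', c q.1 * c q.2 ≤
        2 * (Z * (Z - ∑ i ∈ Finset.range (M + 1), c i)) := by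
      linarith [mul_comm (∑ i ∈ R, c i) (∑ i ∈ R', c i)]
    exact mul_le_mul_of_nonneg_left hfin hC0

end Decomposition

end Symbolic

namespace Entropy

/-! ### Entropy inequalities for finite distributions -/

section Finite

lemma negMulLog_le {p q : ℝ} (hp : 0 ≤ p) (hq : 0 ≤ q) (hpq : 0 < p → 0 < q) :
    Real.negMulLog p ≤ p * -Real.log q + (q - p) := by
  rcases hp.eq_or_lt with rfl | hp'
  · simpa using hq
  · have hq' := hpq hp'
    have h := Real.log_le_sub_one_of_pos (div_pos hq' hp')
    rw [Real.log_div hq'.ne' hp'.ne'] at h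
    have h2 := mul_le_mul_of_nonneg_left h hp
    rw [mul_sub, mul_sub, mul_div_cancel₀ _ hp'.ne'] at h2
    unfold Real.negMulLog
    linarith

/-- Gibbs' inequality. -/
lemma sum_negMulLog_le {ι : Type*} (s : Finset ι) {p q : ι → ℝ} (hp : ∀ i ∈ s, 0 ≤ p i)
    (hq : ∀ i ∈ s, 0 ≤ q i) (hpq : ∀ i ∈ s, 0 < p i → 0 < q i)
    (hsum : ∑ i ∈ s, q i ≤ ∑ i ∈ s, p i) :
    ∑ i ∈ s, Real.negMulLog (p i) ≤ ∑ i ∈ s, p i * -Real.log (q i) := by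
  have := Finset.sum_le_sum fun i hi => negMulLog_le (hp i hi) (hq i hi) (hpq i hi)
  rw [Finset.sum_add_distrib, Finset.sum_sub_distrib] at this
  linarith

lemma negMulLog_sum_le {ι : Type*} (s : Finset ι) {p : ι → ℝ} (hp : ∀ i ∈ s, 0 ≤ p i) :
    Real.negMulLog (∑ i ∈ s, p i) ≤ ∑ i ∈ s, Real.negMulLog (p i) := by
  unfold Real.negMulLog
  rw [← Finset.sum_neg_distrib, Finset.sum_mul]
  refine Finset.sum_le_sum fun i hi => ?_
  rcases (hp i hi).eq_or_lt with h | h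
  · simp [← h]
  · have := Real.log_le_log h (Finset.single_le_sum hp hi)
    nlinarith

variable {Ω β : Type*} [MeasurableSpace Ω] (μ : Measure Ω) [IsFiniteMeasure μ]
  {t : Finset β} {W : Ω → β}

lemma comp_eq_sum_indicator (ht : ∀ x, W x ∈ t) (F : β → ℝ) :
    (fun x => F (W x)) = fun x => ∑ b ∈ t, (W ⁻¹' {b}).indicator (fun _ => F b) x := by
  funext x
  rw [Finset.sum_eq_single (W x)]
  · simp
  · intro b _ hb
    simp [Ne.symm hb]
  · intro h
    exact absurd (ht x) h

lemma integrable_comp_of_finite (ht : ∀ x, W x ∈ t) (hW : ∀ b, MeasurableSet (W ⁻¹' {b}))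
    (F : β → ℝ) : Integrable (fun x => F (W x)) μ := by
  rw [comp_eq_sum_indicator ht F]
  exact integrable_finsetSum _ fun b _ => (integrable_const _).indicator (hW b)

lemma integral_comp_of_finite (ht : ∀ x, W x ∈ t) (hW : ∀ b, MeasurableSet (W ⁻¹' {b}))
    (F : β → ℝ) : ∫ x, F (W x) ∂μ = ∑ b ∈ t, μ.real (W ⁻¹' {b}) * F b := by
  rw [comp_eq_sum_indicator ht F,
    integral_finsetSum _ fun b _ => (integrable_const _).indicator (hW b)]
  refine Finset.sum_congr rfl fun b _ => ?_
  rw [integral_indicator (hW b)]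
  simp

lemma sum_measureReal_preimage (ht : ∀ x, W x ∈ t) (hW : ∀ b, MeasurableSet (W ⁻¹' {b})) :
    ∑ b ∈ t, μ.real (W ⁻¹' {b}) = μ.real Set.univ := by
  have := integral_comp_of_finite μ ht hW fun _ => 1
  simpa using this.symm

lemma sum_measureReal_inter_preimage (ht : ∀ x, W x ∈ t) (hW : ∀ b, MeasurableSet (W ⁻¹' {b}))
    (B : Set Ω) :
    ∑ b ∈ t, μ.real (B ∩ W ⁻¹' {b}) = μ.real B := by
  have := sum_measureReal_preimage (μ.restrict B) ht hW
  simp only [measureReal_restrict_apply (hW _)] at this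
  simpa [Set.inter_comm] using this

variable [IsProbabilityMeasure μ]

/-- If a vector of letters is well predicted, coordinate by coordinate, by a random variable `W`,
then its entropy is not much larger than that of `W`. -/
lemma sum_negMulLog_le_of_approx (ht : ∀ x, W x ∈ t) (hW : ∀ b, MeasurableSet (W ⁻¹' {b}))
    {n k : ℕ} {Z : Ω → Fin n → Fin k} (hZ : Measurable Z) (g : β → Fin n → Fin k) {δ : ℝ}
    (hδ : 0 < δ) (hδ1 : δ < 1) :
    ∑ c, Real.negMulLog (μ.real (Z ⁻¹' {c})) ≤
      ∑ b ∈ t, Real.negMulLog (μ.real (W ⁻¹' {b})) +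
        ∑ i, (-Real.log (1 - δ) + μ.real {x | Z x i ≠ g (W x) i} * Real.log (k / δ)) := by
  classical
  have hZm : ∀ c, MeasurableSet (Z ⁻¹' {c}) := fun c => hZ (measurableSet_singleton c)
  rcases Nat.eq_zero_or_pos n with rfl | hn
  · have hz : ∑ c, Real.negMulLog (μ.real (Z ⁻¹' {c})) = 0 := by
      refine Finset.sum_eq_zero fun c _ => ?_
      have : Z ⁻¹' {c} = Set.univ := by ext x; simp [Subsingleton.elim (Z x) c]
      simp [this]
    rw [hz]
    simp only [Finset.univ_eq_empty, Finset.sum_empty, add_zero]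
    exact Finset.sum_nonneg fun b _ => Real.negMulLog_nonneg measureReal_nonneg measureReal_le_one
  have hk : 0 < k := by
    obtain ⟨x⟩ : Nonempty Ω := nonempty_of_isProbabilityMeasure μ
    exact (Z x ⟨0, hn⟩).pos
  have hk' : (1 : ℝ) ≤ k := by exact_mod_cast hk
  -- A noisy channel: the predicted letter has weight 1 - δ, every other letter δ / k. The joint law
  -- of Z and W is compared, through Gibbs' inequality, with the law that draws W correctly and then
  -- passes each predicted letter through this channel.
  set r : Fin k → Fin k → ℝ := fun a b => if a = b then 1 - δ else δ / k with hr
  have hrpos : ∀ a b, 0 < r a b := by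
    intro a b
    simp only [hr]
    split_ifs
    · linarith
    · positivity
  have hrsum : ∀ b, ∑ a, r a b ≤ 1 := by
    intro b
    have h1 : ∀ a, r a b ≤ (if a = b then 1 - δ else 0) + δ / k := by
      intro a
      simp only [hr]
      split_ifs
      · have : 0 < δ / k := by positivity
        linarith
      · simp
    calc ∑ a, r a b ≤ ∑ a, ((if a = b then 1 - δ else 0) + δ / k) :=
          Finset.sum_le_sum fun a _ => h1 a
      _ = 1 := by
          rw [Finset.sum_add_distrib]
          simp
          field_simp
          ring
  have hlogr : ∀ a b, -Real.log (r a b) ≤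
      -Real.log (1 - δ) + (if a ≠ b then 1 else 0) * Real.log (k / δ) := by
    intro a b
    simp only [hr]
    split_ifs with h1 h2
    · exact absurd h1 h2
    · simp
    · rw [← Real.log_inv, inv_div]
      have : Real.log (1 - δ) ≤ 0 := Real.log_nonpos (by linarith) (by linarith)
      linarith
  set V : Ω → (Fin n → Fin k) × β := fun x => (Z x, W x) with hV
  have hVt : ∀ x, V x ∈ Finset.univ ×ˢ t := fun x => by simp [hV, ht x]
  have hVpre : ∀ c b, V ⁻¹' {(c, b)} = Z ⁻¹' {c} ∩ W ⁻¹' {b} := by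
    intro c b; ext x; simp [hV, Prod.ext_iff]
  have hVm : ∀ b, MeasurableSet (V ⁻¹' {b}) := by
    rintro ⟨c, b⟩
    rw [hVpre]
    exact (hZm c).inter (hW b)
  set p : β → ℝ := fun b => μ.real (W ⁻¹' {b}) with hp
  have hpsum : ∑ b ∈ t, p b = 1 := by
    rw [hp, sum_measureReal_preimage μ ht hW]; simp
  set q : (Fin n → Fin k) × β → ℝ := fun y => p y.2 * ∏ i, r (y.1 i) (g y.2 i) with hq
  have hq0 : ∀ y, 0 ≤ q y := fun y =>
    mul_nonneg measureReal_nonneg (Finset.prod_nonneg fun i _ => (hrpos _ _).le)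
  have h1 : ∑ c, Real.negMulLog (μ.real (Z ⁻¹' {c})) ≤
      ∑ y ∈ Finset.univ ×ˢ t, Real.negMulLog (μ.real (V ⁻¹' {y})) := by
    rw [Finset.sum_product]
    refine Finset.sum_le_sum fun c _ => ?_
    rw [← sum_measureReal_inter_preimage μ ht hW]
    simp only [hVpre]
    exact negMulLog_sum_le _ fun _ _ => measureReal_nonneg
  have hppos : ∀ y : (Fin n → Fin k) × β, 0 < μ.real (V ⁻¹' {y}) → 0 < p y.2 := by
    rintro ⟨c, b⟩ hy
    rw [hVpre] at hy
    exact hy.trans_le (measureReal_mono Set.inter_subset_right)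
  have h2 : ∑ y ∈ Finset.univ ×ˢ t, Real.negMulLog (μ.real (V ⁻¹' {y})) ≤
      ∑ y ∈ Finset.univ ×ˢ t, μ.real (V ⁻¹' {y}) * -Real.log (q y) := by
    refine sum_negMulLog_le _ (fun _ _ => measureReal_nonneg) (fun y _ => hq0 y) ?_ ?_
    · intro y _ hy
      exact mul_pos (hppos y hy) (Finset.prod_pos fun i _ => hrpos _ _)
    · rw [sum_measureReal_preimage μ hVt hVm, Finset.sum_product_right]
      calc ∑ b ∈ t, ∑ c, q (c, b) ≤ ∑ b ∈ t, p b := by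
            refine Finset.sum_le_sum fun b _ => ?_
            simp only [hq]
            rw [← Finset.mul_sum]
            have h3 := Finset.prod_univ_sum (fun _ : Fin n => (Finset.univ : Finset (Fin k)))
              fun i a => r a (g b i)
            rw [Fintype.piFinset_univ] at h3
            rw [← h3]
            exact mul_le_of_le_one_right measureReal_nonneg
              (Finset.prod_le_one (fun i _ => Finset.sum_nonneg fun a _ => (hrpos _ _).le)
                fun i _ => hrsum _)
        _ = _ := by rw [hpsum]; simp
  set F : (Fin n → Fin k) × β → ℝ := fun y => -Real.log (p y.2) +
    ∑ i, (-Real.log (1 - δ) + (if y.1 i ≠ g y.2 i then 1 else 0) * Real.log (k / δ)) with hF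
  have h3 : ∑ y ∈ Finset.univ ×ˢ t, μ.real (V ⁻¹' {y}) * -Real.log (q y) ≤
      ∑ y ∈ Finset.univ ×ˢ t, μ.real (V ⁻¹' {y}) * F y := by
    refine Finset.sum_le_sum fun y _ => ?_
    rcases (measureReal_nonneg (μ := μ) (s := V ⁻¹' {y})).eq_or_lt with h0 | h0
    · simp [← h0]
    · refine mul_le_mul_of_nonneg_left ?_ h0.le
      simp only [hq, hF]
      rw [Real.log_mul (hppos y h0).ne' (Finset.prod_pos fun i _ => hrpos _ _).ne',
        Real.log_prod (fun i _ => (hrpos _ _).ne'), neg_add, ← Finset.sum_neg_distrib]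
      gcongr with i
      exact hlogr _ _
  refine h1.trans (h2.trans (h3.trans (le_of_eq ?_)))
  rw [← integral_comp_of_finite μ hVt hVm]
  have hi1 : Integrable (fun x => -Real.log (p (W x))) μ :=
    integrable_comp_of_finite μ ht hW fun b => -Real.log (p b)
  have hi2 : ∀ i, Integrable (fun x => -Real.log (1 - δ) +
      (if Z x i ≠ g (W x) i then 1 else 0) * Real.log (k / δ)) μ := fun i =>
    integrable_comp_of_finite μ hVt hVm fun y => -Real.log (1 - δ) +
      (if y.1 i ≠ g y.2 i then 1 else 0) * Real.log (k / δ)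
  have hi3 : ∀ i, Integrable (fun x => (if Z x i ≠ g (W x) i then (1 : ℝ) else 0)) μ := fun i =>
    integrable_comp_of_finite μ hVt hVm fun y => if y.1 i ≠ g y.2 i then (1 : ℝ) else 0
  have hm : ∀ i, MeasurableSet {x | Z x i ≠ g (W x) i} := by
    intro i
    have : {x | Z x i ≠ g (W x) i} = ⋃ y ∈ (Finset.univ ×ˢ t).filter
        (fun y : (Fin n → Fin k) × β => y.1 i ≠ g y.2 i), V ⁻¹' {y} := by
      ext x
      simp only [Set.mem_iUnion, Finset.mem_filter, Set.mem_preimage, Set.mem_singleton_iff]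
      constructor
      · intro hx
        exact ⟨V x, ⟨hVt x, hx⟩, rfl⟩
      · rintro ⟨y, ⟨-, hy⟩, rfl⟩
        exact hy
    rw [this]
    exact Finset.measurableSet_biUnion _ fun y _ => hVm y
  simp only [hF, hV]
  rw [integral_add hi1 (integrable_finsetSum _ fun i _ => hi2 i),
    integral_finsetSum _ fun i _ => hi2 i]
  congr 1
  · rw [integral_comp_of_finite μ ht hW fun b => -Real.log (p b)]
    refine Finset.sum_congr rfl fun b _ => ?_
    simp [Real.negMulLog, hp]
  · refine Finset.sum_congr rfl fun i _ => ?_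
    rw [integral_add (integrable_const _) ((hi3 i).mul_const _), integral_mul_const]
    simp only [integral_const, probReal_univ, one_smul]
    congr 2
    rw [← integral_indicator_one (hm i)]
    refine integral_congr_ae (ae_of_all _ fun x => ?_)
    by_cases hx : Z x i = g (W x) i <;> simp [hx]

end Finite

end Entropy

namespace Symbolic

open Entropy

/-! ### Kolmogorov–Sinai entropy computed from words -/

section WordEntropy

variable {A I : Type*} [TopologicalSpace A] [AddMonoidWithOne I] [Finite A] [DiscreteTopology A]
  [MeasurableSpace A] [BorelSpace A] [Countable I] {X : Subshift A I}

variable (X) in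
lemma cyl_eq_preimage (w : List A) : cyl X w = word X w.length ⁻¹' {w} := by
  ext x; rw [mem_cyl_iff]; rfl

variable (X) in
lemma measurableSet_cyl (w : List A) : MeasurableSet (cyl X w) := (isClopen_cyl X w).isOpen.measurableSet

variable (X) in
lemma word_mem_wordsOfLength (n : ℕ) (x : X.carrier) :
    word X n x ∈ wordsOfLength (language X) n := by
  rw [mem_wordsOfLength]; exact ⟨word_mem_language X n x, length_word X n x⟩

variable (X) in
lemma measurableSet_word_preimage (n : ℕ) (w : List A) : MeasurableSet (word X n ⁻¹' {w}) := by
  by_cases h : w.length = n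
  · subst h
    rw [← cyl_eq_preimage]; exact measurableSet_cyl X w
  · have : word X n ⁻¹' {w} = ∅ := by
      ext x
      simp only [Set.mem_preimage, Set.mem_singleton_iff, Set.mem_empty_iff_false, iff_false]
      rintro rfl
      exact h (length_word X n x)
    rw [this]; exact MeasurableSet.empty

lemma integral_word (ν : Measure X.carrier) [IsFiniteMeasure ν] (n : ℕ) (F : List A → ℝ) :
    ∫ x, F (word X n x) ∂ν = ∑ w ∈ wordsOfLength (language X) n, ν.real (cyl X w) * F w := by
  rw [integral_comp_of_finite ν (word_mem_wordsOfLength X n) (measurableSet_word_preimage X n)]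
  refine Finset.sum_congr rfl fun w hw => ?_
  rw [cyl_eq_preimage, (mem_wordsOfLength.1 hw).2]

lemma integrable_word (ν : Measure X.carrier) [IsFiniteMeasure ν] (n : ℕ) (F : List A → ℝ) :
    Integrable (fun x => F (word X n x)) ν :=
  integrable_comp_of_finite ν (word_mem_wordsOfLength X n) (measurableSet_word_preimage X n) F

lemma sum_measureReal_cyl (ν : Measure X.carrier) [IsProbabilityMeasure ν] (n : ℕ) :
    ∑ w ∈ wordsOfLength (language X) n, ν.real (cyl X w) = 1 := by
  have := integral_word ν n fun _ => 1
  simpa using this.symm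

/-- The entropy of the distribution of the words of length `n`. -/
def wordEntropy (ν : Measure X.carrier) (n : ℕ) : ℝ :=
  ∑ w ∈ wordsOfLength (language X) n, Real.negMulLog (ν.real (cyl X w))

lemma wordEntropy_eq_integral (ν : Measure X.carrier) [IsFiniteMeasure ν] (n : ℕ) :
    wordEntropy ν n = ∫ x, -Real.log (ν.real (cyl X (word X n x))) ∂ν := by
  rw [integral_word ν n fun w => -Real.log (ν.real (cyl X w))]
  unfold wordEntropy Real.negMulLog
  refine Finset.sum_congr rfl fun w _ => by ring

lemma wordEntropy_nonneg (ν : Measure X.carrier) [IsProbabilityMeasure ν] (n : ℕ) :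
    0 ≤ wordEntropy ν n :=
  Finset.sum_nonneg fun _ _ => Real.negMulLog_nonneg measureReal_nonneg measureReal_le_one

lemma measurable_shiftMap : Measurable (shiftMap X) := (continuous_shiftMap X).measurable

/-- Gibbs' inequality against the product of the laws of the first m and the last n letters. -/
lemma subadditive_wordEntropy {ν : Measure X.carrier} [IsProbabilityMeasure ν]
    (hν : MeasurePreserving (shiftMap X) ν ν) : Subadditive (wordEntropy ν) := by
  intro m n
  have htd : ∀ y ∈ wordsOfLength (language X) (m + n),
      y.take m ∈ wordsOfLength (language X) m ∧ y.drop m ∈ wordsOfLength (language X) n := by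
    intro y hy
    rw [mem_wordsOfLength] at hy
    have hyL := hy.1
    rw [← List.take_append_drop m y] at hyL
    simp [left_mem_language hyL, right_mem_language hyL, hy.2]
  set q : List A → ℝ := fun y => ν.real (cyl X (y.take m)) * ν.real (cyl X (y.drop m)) with hq
  have hpos : ∀ y ∈ wordsOfLength (language X) (m + n), 0 < ν.real (cyl X y) →
      0 < ν.real (cyl X (y.take m)) ∧ 0 < ν.real (cyl X (y.drop m)) := by
    intro y hy h
    have hlen : (y.take m).length = m := (mem_wordsOfLength.1 (htd y hy).1).2
    have hsub : cyl X y ⊆ cyl X (y.take m) ∩ (shiftMap X)^[m] ⁻¹' cyl X (y.drop m) := by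
      intro x hx
      rw [← List.take_append_drop m y, mem_cyl_append, hlen] at hx
      exact hx
    refine ⟨h.trans_le (measureReal_mono fun x hx => (hsub hx).1), ?_⟩
    rw [← (hν.iterate m).measureReal_preimage (measurableSet_cyl X _).nullMeasurableSet]
    exact h.trans_le (measureReal_mono fun x hx => (hsub hx).2)
  have h1 : wordEntropy ν (m + n) ≤ ∑ y ∈ wordsOfLength (language X) (m + n),
      ν.real (cyl X y) * -Real.log (q y) := by
    refine sum_negMulLog_le _ (fun _ _ => measureReal_nonneg)
      (fun _ _ => mul_nonneg measureReal_nonneg measureReal_nonneg)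
      (fun y hy h => mul_pos (hpos y hy h).1 (hpos y hy h).2) ?_
    rw [sum_measureReal_cyl]
    calc ∑ y ∈ wordsOfLength (language X) (m + n), q y
        ≤ ∑ p ∈ wordsOfLength (language X) m ×ˢ wordsOfLength (language X) n,
          ν.real (cyl X p.1) * ν.real (cyl X p.2) := by
          refine sum_le_sum_of_section (fun p => p.1 ++ p.2) (fun y hy => ?_)
            fun _ _ => mul_nonneg measureReal_nonneg measureReal_nonneg
          exact ⟨(y.take m, y.drop m), Finset.mem_product.2 (htd y hy),
            List.take_append_drop m y, le_rfl⟩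
      _ = 1 := by
          rw [Finset.sum_product]
          simp only
          rw [← Finset.sum_mul_sum, sum_measureReal_cyl, sum_measureReal_cyl, one_mul]
  refine h1.trans (le_of_eq ?_)
  have h2 : ∑ y ∈ wordsOfLength (language X) (m + n), ν.real (cyl X y) * -Real.log (q y) =
      ∑ y ∈ wordsOfLength (language X) (m + n), ν.real (cyl X y) *
        (-Real.log (ν.real (cyl X (y.take m))) + -Real.log (ν.real (cyl X (y.drop m)))) := by
    refine Finset.sum_congr rfl fun y hy => ?_
    rcases (measureReal_nonneg (μ := ν) (s := cyl X y)).eq_or_lt with h0 | h0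
    · simp [← h0]
    · simp only [hq]
      rw [Real.log_mul (hpos y hy h0).1.ne' (hpos y hy h0).2.ne', neg_add]
  rw [h2, ← integral_word ν (m + n) fun y => -Real.log (ν.real (cyl X (y.take m))) +
    -Real.log (ν.real (cyl X (y.drop m)))]
  have htake : ∀ x, (word X (m + n) x).take m = word X m x := fun x => by
    rw [word_add]
    nth_rewrite 1 [← length_word X m x]
    exact List.take_left
  have hdrop : ∀ x, (word X (m + n) x).drop m = word X n ((shiftMap X)^[m] x) := fun x => by
    rw [word_add]
    nth_rewrite 1 [← length_word X m x]
    exact List.drop_left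
  simp only [htake, hdrop]
  rw [wordEntropy_eq_integral, wordEntropy_eq_integral,
    integral_add (integrable_word ν m fun w => -Real.log (ν.real (cyl X w)))]
  · congr 1
    have hint := integrable_word ν n fun w => -Real.log (ν.real (cyl X w))
    have := integral_map (μ := ν) (hν.iterate m).aemeasurable
      (f := fun x => -Real.log (ν.real (cyl X (word X n x))))
      (by rw [(hν.iterate m).map_eq]; exact hint.aestronglyMeasurable)
    rw [(hν.iterate m).map_eq] at this
    exact this.symm
  · exact (hν.iterate m).integrable_comp_of_integrable
      (integrable_word ν n fun w => -Real.log (ν.real (cyl X w)))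

lemma bddBelow_wordEntropy (ν : Measure X.carrier) [IsProbabilityMeasure ν] :
    BddBelow (Set.range fun n : ℕ => wordEntropy ν n / n) := by
  refine ⟨0, ?_⟩
  rintro _ ⟨n, rfl⟩
  exact div_nonneg (wordEntropy_nonneg ν n) (Nat.cast_nonneg n)

/-- Up to a shift and a set of small measure, a finite measurable partition is determined by the
words of some fixed length. -/
lemma IsGenerating.exists_approx (hgen : IsGenerating X) [Nonempty X.carrier]
    {ν : Measure X.carrier} [IsFiniteMeasure ν] (hν : MeasurePreserving (shiftMap X) ν ν) {k : ℕ}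
    {ξ : X.carrier → Fin k} (hξ : Measurable ξ) {ε : ℝ} (hε : 0 < ε) :
    ∃ (m N : ℕ) (g : List A → Fin k), 0 < N ∧
      ν.real {x | ξ ((shiftMap X)^[m] x) ≠ g (word X N x)} ≤ ε := by
  classical
  set F : X.carrier → ℝ := fun x => ((ξ x : ℕ) : ℝ) with hF
  have hFm : Measurable F := by
    have : Measurable fun a : Fin k => ((a : ℕ) : ℝ) := measurable_of_finite _
    exact this.comp hξ
  have hFi : Integrable F ν := by
    refine Integrable.of_bound hFm.aestronglyMeasurable (k : ℝ) (ae_of_all _ fun x => ?_)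
    simp only [hF, Real.norm_natCast]
    exact_mod_cast (ξ x).2.le
  -- Labels are integers: if two points carry the same word and `f` is within 1/4 of the label at
  -- both, the labels differ by less than 3/4 and agree. By Markov's inequality at level 1/4, an L¹
  -- error of ε/4 leaves an exceptional set of measure at most ε.
  obtain ⟨f, hf, hfi⟩ := hFi.exists_boundedContinuous_integral_sub_le (ε := ε / 4) (by positivity)
  obtain ⟨m, N, hN, hmN⟩ := hgen f.toContinuousMap (1 / 4) (by norm_num)
  obtain ⟨x₀⟩ := ‹Nonempty X.carrier›
  set T := (shiftMap X)^[m] with hT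
  have hgood : ∀ x y : X.carrier, word X N x = word X N y → |F (T x) - f (T x)| < 1 / 4 →
      |F (T y) - f (T y)| < 1 / 4 → ξ (T x) = ξ (T y) := by
    intro x y hxy hx hy
    have h : |f (T x) - f (T y)| < 1 / 4 := hmN x y hxy
    have hlt : |F (T x) - F (T y)| < 1 := by
      rw [abs_lt] at *
      constructor <;> linarith
    simp only [hF] at hlt
    have h2 : |((ξ (T x) : ℕ) : ℤ) - ((ξ (T y) : ℕ) : ℤ)| < 1 := by exact_mod_cast hlt
    rw [Int.abs_lt_one_iff] at h2
    apply Fin.ext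
    omega
  -- The label of `w` is taken from any point with word `w` where the approximation is good;
  -- otherwise it is arbitrary.
  refine ⟨m, N, fun w => if h : ∃ x, word X N x = w ∧ |F (T x) - f (T x)| < 1 / 4 then
    ξ (T h.choose) else ξ x₀, hN, ?_⟩
  have hsub : {x | ξ (T x) ≠ (if h : ∃ y, word X N y = word X N x ∧
      |F (T y) - f (T y)| < 1 / 4 then ξ (T h.choose) else ξ x₀)} ⊆
      T ⁻¹' {x | 1 / 4 ≤ ‖F x - f x‖} := by
    intro x hx
    by_contra hcon
    have hlt : |F (T x) - f (T x)| < 1 / 4 := not_le.1 hcon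
    have hex : ∃ y, word X N y = word X N x ∧ |F (T y) - f (T y)| < 1 / 4 := ⟨x, rfl, hlt⟩
    apply hx
    rw [dif_pos hex]
    exact hgood _ _ hex.choose_spec.1.symm hlt hex.choose_spec.2
  refine (measureReal_mono hsub).trans ?_
  have hmeas : MeasurableSet {x | 1 / 4 ≤ ‖F x - f x‖} :=
    measurableSet_le measurable_const (hFm.sub f.continuous.measurable).norm
  rw [(hν.iterate m).measureReal_preimage hmeas.nullMeasurableSet]
  have hmk := mul_meas_ge_le_integral_of_nonneg (μ := ν) (f := fun x => ‖F x - f x‖)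
    (ae_of_all _ fun x => norm_nonneg _) (hFi.sub hfi).norm (1 / 4)
  linarith

lemma IsGenerating.joinEntropy_le (hgen : IsGenerating X) [Nonempty X.carrier]
    {ν : Measure X.carrier} [IsProbabilityMeasure ν] (hν : MeasurePreserving (shiftMap X) ν ν)
    {k : ℕ} {ξ : X.carrier → Fin k} (hξ : Measurable ξ) {ε : ℝ} (hε : 0 < ε) :
    ∃ N : ℕ, ∀ n, joinEntropy (shiftMap X) ν ξ n ≤ wordEntropy ν (n + N) + n * ε := by
  classical
  -- The order of choices matters: δ makes the cost of correct predictions at most ε/2 per letter,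
  -- and only then is the probability of error made small compared with 1 / log(k/δ).
  obtain ⟨δ, hδ0, hδ1, hδ⟩ : ∃ δ : ℝ, 0 < δ ∧ δ < 1 ∧ -Real.log (1 - δ) ≤ ε / 2 := by
    refine ⟨1 - Real.exp (-(ε / 2)), ?_, ?_, ?_⟩
    · have : Real.exp (-(ε / 2)) < 1 := by
        simpa using Real.exp_lt_exp.2 (show -(ε / 2) < 0 by linarith)
      linarith
    · have := Real.exp_pos (-(ε / 2)); linarith
    · rw [sub_sub_cancel, Real.log_exp]; linarith
  set L := |Real.log (k / δ)| + 1 with hL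
  have hLpos : 0 < L := by positivity
  obtain ⟨m, N, g, -, hg⟩ := hgen.exists_approx hν hξ (ε := ε / (2 * L)) (by positivity)
  refine ⟨N, fun n => ?_⟩
  -- The extra m shifts do not change the entropy, by invariance, and make each label predictable
  -- from N letters, so that n labels need a word of length n + N.
  set Z : X.carrier → Fin n → Fin k :=
    fun x i => ξ ((shiftMap X)^[(i : ℕ)] ((shiftMap X)^[m] x)) with hZ
  have hZm : Measurable Z := measurable_pi_lambda _ fun i =>
    hξ.comp ((measurable_shiftMap.iterate _).comp (measurable_shiftMap.iterate _))
  have h1 : joinEntropy (shiftMap X) ν ξ n = ∑ c, Real.negMulLog (ν.real (Z ⁻¹' {c})) := by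
    unfold joinEntropy
    refine Finset.sum_congr rfl fun c _ => ?_
    congr 1
    have hmeas : MeasurableSet {x | ∀ i : Fin n, ξ ((shiftMap X)^[(i : ℕ)] x) = c i} := by
      rw [Set.ofPred_forall]
      exact MeasurableSet.iInter fun i =>
        (hξ.comp (measurable_shiftMap.iterate _)) (measurableSet_singleton _)
    rw [← (hν.iterate m).measureReal_preimage hmeas.nullMeasurableSet]
    congr 1
    ext x
    simp only [Set.mem_preimage, Set.mem_ofPred_eq, Set.mem_singleton_iff, hZ, funext_iff]
  rw [h1]
  refine (sum_negMulLog_le_of_approx ν (word_mem_wordsOfLength X (n + N))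
    (measurableSet_word_preimage X (n + N)) hZm
    (fun w i => g ((w.drop (i : ℕ)).take N)) hδ0 hδ1).trans ?_
  refine add_le_add (le_of_eq ?_) ?_
  · unfold wordEntropy
    refine Finset.sum_congr rfl fun w hw => ?_
    rw [cyl_eq_preimage, (mem_wordsOfLength.1 hw).2]
  · have hterm : ∀ i : Fin n, -Real.log (1 - δ) +
        ν.real {x | Z x i ≠ g (((word X (n + N) x).drop (i : ℕ)).take N)} * Real.log (k / δ)
          ≤ ε := by
      intro i
      have hw : ∀ x, ((word X (n + N) x).drop (i : ℕ)).take N =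
          word X N ((shiftMap X)^[(i : ℕ)] x) := by
        intro x
        have hsplit : n + N = i + (N + (n - i)) := by omega
        rw [hsplit, word_add, word_add]
        nth_rewrite 1 [← length_word X i x]
        rw [List.drop_left]
        nth_rewrite 1 [← length_word X N ((shiftMap X)^[(i : ℕ)] x)]
        rw [List.take_left]
      have hset : ν.real {x | Z x i ≠ g (((word X (n + N) x).drop (i : ℕ)).take N)} ≤
          ε / (2 * L) := by
        simp only [hw, hZ]
        have heq : {x | ξ ((shiftMap X)^[(i : ℕ)] ((shiftMap X)^[m] x)) ≠
            g (word X N ((shiftMap X)^[(i : ℕ)] x))} =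
            (shiftMap X)^[(i : ℕ)] ⁻¹' {x | ξ ((shiftMap X)^[m] x) ≠ g (word X N x)} := by
          ext x
          simp only [Set.mem_preimage, Set.mem_ofPred_eq, ← Function.iterate_add_apply,
            add_comm m]
        rw [heq, (hν.iterate i).measureReal_preimage]
        · exact hg
        · refine MeasurableSet.nullMeasurableSet ?_
          have hgm : Measurable fun x => g (word X N x) := by
            intro s _
            have : (fun x => g (word X N x)) ⁻¹' s =
                ⋃ w ∈ (wordsOfLength (language X) N).filter (fun w => g w ∈ s),
                  word X N ⁻¹' {w} := by
              ext x
              simp only [Set.mem_preimage, Set.mem_iUnion, Finset.mem_filter,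
                Set.mem_singleton_iff, exists_prop]
              constructor
              · intro hx; exact ⟨_, ⟨word_mem_wordsOfLength X N x, hx⟩, rfl⟩
              · rintro ⟨w, ⟨-, hw⟩, rfl⟩; exact hw
            rw [this]
            exact Finset.measurableSet_biUnion _ fun w _ => measurableSet_word_preimage X N w
          have : {x | ξ ((shiftMap X)^[m] x) ≠ g (word X N x)} =
              {x | ξ ((shiftMap X)^[m] x) = g (word X N x)}ᶜ := rfl
          rw [this]
          exact (measurableSet_eq_fun (hξ.comp (measurable_shiftMap.iterate m)) hgm).compl
      have h2 : ν.real {x | Z x i ≠ g (((word X (n + N) x).drop (i : ℕ)).take N)} *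
          Real.log (k / δ) ≤ ε / (2 * L) * L :=
        (mul_le_mul_of_nonneg_left (by linarith [le_abs_self (Real.log (k / δ))])
          measureReal_nonneg).trans (mul_le_mul_of_nonneg_right hset hLpos.le)
      have h3 : ε / (2 * L) * L = ε / 2 := by field_simp
      linarith
    calc _ ≤ ∑ _i : Fin n, ε := Finset.sum_le_sum fun i _ => hterm i
      _ = n * ε := by simp

/-- The Kolmogorov–Sinai theorem for the partition according to the zeroth letter. -/
lemma IsGenerating.measureEntropy_le (hgen : IsGenerating X) [Nonempty X.carrier]
    {ν : Measure X.carrier} [IsProbabilityMeasure ν] (hν : MeasurePreserving (shiftMap X) ν ν)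
    {n : ℕ} (hn : n ≠ 0) :
    measureEntropy (shiftMap X) ν ≤ ((wordEntropy ν n / n : ℝ) : EReal) := by
  have hsub := subadditive_wordEntropy hν
  have hbdd := bddBelow_wordEntropy ν
  refine iSup_le fun k => iSup_le fun ξ => iSup_le fun hξ => ?_
  refine le_trans ?_ (EReal.coe_le_coe_iff.2 (hsub.lim_le_div hbdd hn))
  have hε : ∀ ε : ℝ, 0 < ε →
      partitionEntropy (shiftMap X) ν ξ ≤ ((hsub.lim + ε : ℝ) : EReal) := by
    intro ε hε
    obtain ⟨N, hN⟩ := hgen.joinEntropy_le hν hξ hε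
    have hlim : Tendsto (fun j : ℕ => wordEntropy ν j / j + wordEntropy ν N / j + ε) atTop
        (𝓝 (hsub.lim + 0 + ε)) :=
      ((hsub.tendsto_lim hbdd).add (tendsto_const_div_atTop_nhds_zero_nat _)).add_const ε
    rw [add_zero] at hlim
    have hlim' := ((continuous_coe_real_ereal.tendsto _).comp hlim).limsup_eq
    rw [← hlim']
    refine limsup_le_limsup ?_
    filter_upwards [eventually_gt_atTop 0] with j hj
    refine EReal.coe_le_coe_iff.2 ?_
    have hj' : (0 : ℝ) < j := by exact_mod_cast hj
    rw [div_le_iff₀ hj', add_mul, add_mul, div_mul_cancel₀ _ hj'.ne', div_mul_cancel₀ _ hj'.ne']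
    linarith [hN j, hsub j N]
  refine EReal.le_of_forall_lt_iff_le.1 fun z hz => ?_
  have h1 : hsub.lim < z := EReal.coe_lt_coe_iff.1 hz
  have := hε (z - hsub.lim) (by linarith)
  rwa [add_sub_cancel] at this

/-- For the partition by the zeroth letter, the cells of the n-fold join are the cylinders of words
of length n. -/
lemma le_measureEntropy [Nonempty X.carrier] (ν : Measure X.carrier) [IsProbabilityMeasure ν]
    {h : ℝ} (hh : ∀ᶠ n : ℕ in atTop, h ≤ wordEntropy ν n / n) :
    (h : EReal) ≤ measureEntropy (shiftMap X) ν := by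
  classical
  obtain ⟨k, ⟨e⟩⟩ := Finite.exists_equiv_fin A
  set ξ : X.carrier → Fin k := fun x => e (x.1 0) with hξdef
  have hξ : Measurable ξ := by
    have hc : Continuous fun x : X.carrier => e (x.1 0) :=
      (continuous_of_discreteTopology (f := e)).comp
        ((continuous_apply 0).comp continuous_subtype_val)
    exact hc.measurable
  refine le_trans ?_ (le_iSup_of_le k (le_iSup_of_le ξ (le_iSup_of_le hξ le_rfl)))
  have hjoin : ∀ n, joinEntropy (shiftMap X) ν ξ n = wordEntropy ν n := by
    intro n
    set l : (Fin n → Fin k) → List A := fun c => List.ofFn fun i => e.symm (c i) with hl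
    have hinj : Function.Injective l := by
      intro c d hcd
      have := List.ofFn_injective hcd
      funext i
      exact e.symm.injective (congrFun this i)
    have h1 : ∀ c, {x : X.carrier | ∀ i : Fin n, ξ ((shiftMap X)^[(i : ℕ)] x) = c i} =
        cyl X (l c) := by
      intro c
      rw [cyl_eq_preimage]
      ext x
      have hlen : (l c).length = n := by simp [hl]
      rw [hlen]
      simp only [Set.mem_ofPred_eq, Set.mem_preimage, Set.mem_singleton_iff, word, hl,
        List.ofFn_inj, funext_iff, hξdef, iterate_shiftMap_apply, add_zero]
      exact forall_congr' fun i => by rw [Equiv.eq_symm_apply]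
    unfold joinEntropy wordEntropy
    simp only [h1]
    rw [← Finset.sum_image (f := fun w => Real.negMulLog (ν.real (cyl X w)))
      fun c _ d _ hcd => hinj hcd]
    symm
    refine Finset.sum_subset ?_ ?_
    · intro w hw
      rw [mem_wordsOfLength] at hw
      obtain ⟨hwL, hlen⟩ := hw
      subst hlen
      rw [Finset.mem_image]
      refine ⟨fun i => e w[i], Finset.mem_univ _, ?_⟩
      simp [hl]
    · intro w hw hw'
      obtain ⟨c, -, rfl⟩ := Finset.mem_image.1 hw
      have hlen : (l c).length = n := by simp [hl]
      have : cyl X (l c) = ∅ := by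
        by_contra hne
        exact hw' (mem_wordsOfLength.2 ⟨Set.nonempty_iff_ne_empty.2 hne, hlen⟩)
      rw [this]
      simp
  unfold partitionEntropy
  refine le_limsup_of_frequently_le (Eventually.frequently ?_)
  filter_upwards [hh] with n hn
  rw [hjoin]
  exact EReal.coe_le_coe_iff.2 hn

end WordEntropy

end Symbolic

/-- Gibbs' inequality against the weights r exp(a_i) / Z, where r is the total of the p_i and Z the
sum of the exp(a_i). The total r is arbitrary so that the bound can be applied to a set of words and
to its complement separately. -/
lemma Entropy.sum_negMulLog_add_le {ι : Type*} (s : Finset ι) {p a : ι → ℝ}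
    (hp : ∀ i ∈ s, 0 ≤ p i) :
    ∑ i ∈ s, (Real.negMulLog (p i) + p i * a i) ≤
      Real.negMulLog (∑ i ∈ s, p i) + (∑ i ∈ s, p i) * Real.log (∑ i ∈ s, Real.exp (a i)) := by
  rcases (Finset.sum_nonneg hp).eq_or_lt with h | h
  · have h0 := (Finset.sum_eq_zero_iff_of_nonneg hp).1 h.symm
    rw [← h, Finset.sum_eq_zero fun i hi => by simp [h0 i hi]]
    simp
  · have hs : s.Nonempty := by
      by_contra hne
      rw [Finset.not_nonempty_iff_eq_empty] at hne
      simp [hne] at h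
    set r := ∑ i ∈ s, p i with hr
    set Z := ∑ i ∈ s, Real.exp (a i) with hZ
    have hZpos : 0 < Z := Finset.sum_pos (fun i _ => Real.exp_pos _) hs
    have hq : ∀ i, 0 < r * Real.exp (a i) / Z := fun i => by positivity
    have hsum : ∑ i ∈ s, r * Real.exp (a i) / Z = r := by
      rw [← Finset.sum_div, ← Finset.mul_sum, ← hZ, mul_div_assoc, div_self hZpos.ne', mul_one]
    have hg := Entropy.sum_negMulLog_le s hp (fun i _ => (hq i).le) (fun i _ _ => hq i) hsum.le
    have hlog : ∀ i, -Real.log (r * Real.exp (a i) / Z) = -Real.log r - a i + Real.log Z := by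
      intro i
      rw [Real.log_div (by positivity) hZpos.ne', Real.log_mul h.ne' (Real.exp_pos _).ne',
        Real.log_exp]
      ring
    have hrw : ∑ i ∈ s, p i * -Real.log (r * Real.exp (a i) / Z) =
        r * (-Real.log r + Real.log Z) - ∑ i ∈ s, p i * a i := by
      rw [hr, Finset.sum_mul, ← hr, ← Finset.sum_sub_distrib]
      refine Finset.sum_congr rfl fun i _ => ?_
      rw [hlog]; ring
    rw [hrw] at hg
    rw [Finset.sum_add_distrib, Real.negMulLog]
    linarith

namespace Symbolic

open Entropy

/-! ### Variational principle; absolute continuity and ergodicity tested on words -/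

section Variational

variable {A I : Type*} [TopologicalSpace A] [AddMonoidWithOne I] [Finite A] [DiscreteTopology A]
  [MeasurableSpace A] [BorelSpace A] [Countable I] {X : Subshift A I} {φ : C(X.carrier, ℝ)}

lemma integral_comp_iterate {ν : Measure X.carrier} [IsFiniteMeasure ν]
    (hν : MeasurePreserving (shiftMap X) ν ν) (k : ℕ) (f : C(X.carrier, ℝ)) :
    ∫ x, f ((shiftMap X)^[k] x) ∂ν = ∫ x, f x ∂ν := by
  have := integral_map (μ := ν) (hν.iterate k).aemeasurable (f := f)
    f.continuous.measurable.aestronglyMeasurable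
  rw [(hν.iterate k).map_eq] at this
  exact this.symm

lemma integrable_of_continuous {ν : Measure X.carrier} [IsFiniteMeasure ν] {f : X.carrier → ℝ}
    (hf : Continuous f) : Integrable f ν := by
  have := (BoundedContinuousFunction.mkOfCompact ⟨f, hf⟩).integrable (μ := ν)
  exact this

lemma integral_S {ν : Measure X.carrier} [IsFiniteMeasure ν]
    (hν : MeasurePreserving (shiftMap X) ν ν) (n : ℕ) :
    ∫ x, S X φ n x ∂ν = n * ∫ x, φ x ∂ν := by
  unfold S birkhoffSum
  rw [integral_finsetSum _ fun k _ => integrable_of_continuous (f := fun x => φ ((shiftMap X)^[k] x))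
    (φ.continuous.comp ((continuous_shiftMap X).iterate k))]
  simp only [integral_comp_iterate hν]
  simp

lemma S_le_wordWeight_word (n : ℕ) (x : X.carrier) :
    S X φ n x ≤ wordWeight X φ (word X n x) := by
  have := S_le_wordWeight φ (mem_cyl_word X n x)
  rwa [length_word] at this

lemma log_gibbs (w : List A) :
    Real.log (gibbs X φ w) = -(w.length : ℝ) * pressure X φ + wordWeight X φ w := by
  rw [gibbs, Real.log_exp]

/-- Since S_n φ ≤ φ_n(w) on [w], the excess of entropy plus energy over nP is bounded by a finite
sum over words, to which `sum_negMulLog_add_le` applies. -/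
lemma wordEntropy_add_integral_le {ν : Measure X.carrier} [IsProbabilityMeasure ν]
    (hν : MeasurePreserving (shiftMap X) ν ν) (n : ℕ) :
    wordEntropy ν n + n * ∫ x, φ x ∂ν - n * pressure X φ ≤
      ∑ w ∈ wordsOfLength (language X) n, (Real.negMulLog (ν.real (cyl X w)) +
        ν.real (cyl X w) * Real.log (gibbs X φ w)) := by
  rw [Finset.sum_add_distrib, ← integral_word ν n fun w => Real.log (gibbs X φ w), ← integral_S hν]
  have h : ∫ x, (S X φ n x - n * pressure X φ) ∂ν ≤
      ∫ x, Real.log (gibbs X φ (word X n x)) ∂ν := by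
    refine integral_mono ((integrable_of_continuous (continuous_S X φ n)).sub
      (integrable_const _)) (integrable_word ν n fun w => Real.log (gibbs X φ w)) fun x => ?_
    simp only [log_gibbs, length_word]
    linarith [S_le_wordWeight_word (φ := φ) n x]
  rw [integral_sub (integrable_of_continuous (continuous_S X φ n)) (integrable_const _)] at h
  simp only [integral_const, probReal_univ, one_smul] at h
  change wordEntropy ν n + _ - _ ≤ wordEntropy ν n + _
  linarith

lemma exp_log_gibbs (w : List A) : Real.exp (Real.log (gibbs X φ w)) = gibbs X φ w :=
  Real.exp_log (gibbs_pos X φ w)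

lemma wordEntropy_add_integral_le_log [Nonempty X.carrier] {ν : Measure X.carrier}
    [IsProbabilityMeasure ν] (hν : MeasurePreserving (shiftMap X) ν ν) (n : ℕ) :
    wordEntropy ν n + n * ∫ x, φ x ∂ν ≤ Real.log (partitionSum X φ (language X) n) := by
  have h1 := wordEntropy_add_integral_le (φ := φ) hν n
  have h2 := sum_negMulLog_add_le (wordsOfLength (language X) n)
    (p := fun w => ν.real (cyl X w)) (a := fun w => Real.log (gibbs X φ w))
    fun _ _ => measureReal_nonneg
  rw [sum_measureReal_cyl] at h2
  simp only [exp_log_gibbs, Real.negMulLog_one, one_mul, zero_add] at h2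
  change _ ≤ Real.log (mass X φ _) at h2
  rw [partitionSum_eq_mass, Real.log_mul (Real.exp_pos _).ne'
    (lt_of_lt_of_le one_pos (one_le_mass X φ n)).ne', Real.log_exp]
  linarith

/-- The easy half of the variational principle. -/
lemma IsGenerating.freeEnergy_le (hgen : IsGenerating X) [Nonempty X.carrier]
    {ν : Measure X.carrier} (hν : IsInvariantProb X ν) :
    freeEnergy X φ ν ≤ (pressure X φ : EReal) := by
  obtain ⟨hprob, hinv⟩ := hν
  have hle : ∀ᶠ n : ℕ in atTop, measureEntropy (shiftMap X) ν ≤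
      ((Real.log (partitionSum X φ (language X) n) / n - ∫ x, φ x ∂ν : ℝ) : EReal) := by
    filter_upwards [eventually_gt_atTop 0] with n hn
    refine (hgen.measureEntropy_le hinv hn.ne').trans (EReal.coe_le_coe_iff.2 ?_)
    have hn' : (0 : ℝ) < n := by exact_mod_cast hn
    rw [le_sub_iff_add_le, le_div_iff₀ hn', add_mul, div_mul_cancel₀ _ hn'.ne']
    linarith [wordEntropy_add_integral_le_log (φ := φ) hinv n]
  have hlim := (continuous_coe_real_ereal.tendsto _).comp
    ((tendsto_log_partitionSum X φ).sub_const (∫ x, φ x ∂ν))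
  have h := ge_of_tendsto hlim hle
  unfold freeEnergy
  calc _ ≤ ((pressure X φ - ∫ x, φ x ∂ν : ℝ) : EReal) + ((∫ x, φ x ∂ν : ℝ) : EReal) := by gcongr
    _ = _ := by rw [← EReal.coe_add, sub_add_cancel]

/-- A collection of words that carries a definite part of a measure of maximal free energy has
a definite mass. -/
lemma IsGenerating.exists_le_mass (hgen : IsGenerating X) [Nonempty X.carrier]
    {ν : Measure X.carrier} (hν : IsInvariantProb X ν)
    (hfree : (pressure X φ : EReal) ≤ freeEnergy X φ ν) {K : ℝ} (hK1 : 1 ≤ K)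
    (hK : ∀ n, mass X φ (wordsOfLength (language X) n) ≤ K) {a : ℝ} (ha : 0 < a) :
    ∃ c : ℝ, 0 < c ∧ ∀ n, 0 < n → ∀ D ⊆ wordsOfLength (language X) n,
      a ≤ ∑ w ∈ D, ν.real (cyl X w) → c ≤ mass X φ D := by
  classical
  obtain ⟨hprob, hinv⟩ := hν
  -- With p the ν-measure of `D`, maximal free energy gives 0 ≤ 1 + p log mass(D) + log K: the two
  -- `negMulLog` terms of the splitting into `D` and its complement add up to at most 1, and the
  -- complement has mass at most K.
  refine ⟨Real.exp (-((Real.log K + 1) / a)), Real.exp_pos _, fun n hn D hD hDa => ?_⟩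
  have hn' : (0 : ℝ) < n := by exact_mod_cast hn
  set L := wordsOfLength (language X) n with hL
  have hDne : D.Nonempty := by
    by_contra hne
    rw [Finset.not_nonempty_iff_eq_empty] at hne
    rw [hne] at hDa
    simp at hDa
    linarith
  have hDpos : 0 < mass X φ D := Finset.sum_pos (fun w _ => gibbs_pos X φ w) hDne
  have hent : n * pressure X φ ≤ wordEntropy ν n + n * ∫ x, φ x ∂ν := by
    have h1 : (pressure X φ : EReal) ≤ ((wordEntropy ν n / n + ∫ x, φ x ∂ν : ℝ) : EReal) := by
      refine hfree.trans ?_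
      rw [EReal.coe_add]
      exact add_le_add_left (hgen.measureEntropy_le hinv hn.ne') _
    rw [EReal.coe_le_coe_iff] at h1
    have := mul_le_mul_of_nonneg_left h1 hn'.le
    rwa [mul_add, mul_div_cancel₀ _ hn'.ne'] at this
  have hsum := wordEntropy_add_integral_le (φ := φ) hinv n
  rw [← hL, ← Finset.sum_sdiff hD] at hsum
  have hs1 := sum_negMulLog_add_le D (p := fun w => ν.real (cyl X w))
    (a := fun w => Real.log (gibbs X φ w)) fun _ _ => measureReal_nonneg
  have hs2 := sum_negMulLog_add_le (L \ D) (p := fun w => ν.real (cyl X w))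
    (a := fun w => Real.log (gibbs X φ w)) fun _ _ => measureReal_nonneg
  simp only [exp_log_gibbs] at hs1 hs2
  change _ ≤ _ + _ * Real.log (mass X φ D) at hs1
  change _ ≤ _ + _ * Real.log (mass X φ (L \ D)) at hs2
  have hp1 : ∑ w ∈ L \ D, ν.real (cyl X w) + ∑ w ∈ D, ν.real (cyl X w) = 1 := by
    rw [Finset.sum_sdiff hD, hL, sum_measureReal_cyl]
  have hp0 : 0 ≤ ∑ w ∈ L \ D, ν.real (cyl X w) := Finset.sum_nonneg fun _ _ => measureReal_nonneg
  set p := ∑ w ∈ D, ν.real (cyl X w) with hp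
  set p' := ∑ w ∈ L \ D, ν.real (cyl X w) with hp'
  have hppos : 0 < p := by linarith
  have e1 : Real.negMulLog p ≤ 1 - p := by
    simpa using negMulLog_le hppos.le zero_le_one (fun _ => one_pos)
  have e2 : Real.negMulLog p' ≤ 1 - p' := by
    simpa using negMulLog_le hp0 zero_le_one (fun _ => one_pos)
  have hlogK : 0 ≤ Real.log K := Real.log_nonneg hK1
  have e3 : Real.log (mass X φ (L \ D)) ≤ Real.log K := by
    rcases (mass_nonneg X φ (L \ D)).eq_or_lt with h0 | h0
    · rw [← h0]; simpa using hlogK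
    · exact Real.log_le_log h0 ((mass_mono X φ Finset.sdiff_subset).trans (hK n))
  have e4 : p' * Real.log (mass X φ (L \ D)) ≤ p' * Real.log K :=
    mul_le_mul_of_nonneg_left e3 hp0
  have e5 : p' * Real.log K ≤ Real.log K := mul_le_of_le_one_left hlogK (by linarith)
  have e6 : -(Real.log K + 1) ≤ p * Real.log (mass X φ D) := by linarith
  rw [← Real.le_log_iff_exp_le hDpos, ← neg_div, div_le_iff₀ ha]
  rcases le_or_gt 0 (Real.log (mass X φ D)) with h0 | h0
  · have : 0 ≤ Real.log (mass X φ D) * a := by positivity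
    linarith
  · nlinarith

/-- Each middle term of the Birkhoff sum is determined up to ε by the word; the m first and N last
terms are bounded trivially. -/
lemma IsGenerating.exists_abs_S_sub_le (hgen : IsGenerating X) {ε : ℝ} (hε : 0 < ε) :
    ∃ C : ℝ, ∀ n, ∀ x y : X.carrier, word X n x = word X n y →
      |S X φ n x - S X φ n y| ≤ n * ε + C := by
  obtain ⟨m, N, -, hmN⟩ := hgen φ ε hε
  refine ⟨2 * (m + N) * ‖φ‖, fun n x y hxy => ?_⟩
  rcases le_or_gt n (m + N) with hn | hn
  · have h1 := abs_le.1 (abs_S_le X φ n x)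
    have h2 := abs_le.1 (abs_S_le X φ n y)
    have h3 : (n : ℝ) * ‖φ‖ ≤ (m + N) * ‖φ‖ := by
      gcongr
      exact_mod_cast hn
    have h4 : 0 ≤ n * ε := by positivity
    rw [abs_le]
    constructor <;> linarith
  · obtain ⟨j, rfl⟩ : ∃ j, n = m + (j + N) := ⟨n - (m + N), by omega⟩
    have hmid : |S X φ j ((shiftMap X)^[m] x) - S X φ j ((shiftMap X)^[m] y)| ≤ j * ε := by
      unfold S birkhoffSum
      rw [← Finset.sum_sub_distrib]
      calc _ ≤ ∑ k ∈ Finset.range j, |φ ((shiftMap X)^[k] ((shiftMap X)^[m] x)) -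
              φ ((shiftMap X)^[k] ((shiftMap X)^[m] y))| := Finset.abs_sum_le_sum_abs _ _
        _ ≤ ∑ k ∈ Finset.range j, ε := by
            refine Finset.sum_le_sum fun k hk => ?_
            rw [Finset.mem_range] at hk
            have hw : word X N ((shiftMap X)^[k] x) = word X N ((shiftMap X)^[k] y) := by
              have hsplit : m + (j + N) = k + (N + (m + j - k)) := by omega
              rw [hsplit, word_add, word_add, word_add, word_add] at hxy
              exact (List.append_inj (List.append_inj hxy (by simp)).2 (by simp)).1
            have := (hmN _ _ hw).le
            rwa [← Function.iterate_add_apply, ← Function.iterate_add_apply, add_comm m,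
              Function.iterate_add_apply, Function.iterate_add_apply] at this
        _ = j * ε := by simp
    rw [S_add, S_add, S_add, S_add]
    have h1 := abs_le.1 (abs_S_le X φ m x)
    have h2 := abs_le.1 (abs_S_le X φ m y)
    have h3 := abs_le.1 (abs_S_le X φ N ((shiftMap X)^[j] ((shiftMap X)^[m] x)))
    have h4 := abs_le.1 (abs_S_le X φ N ((shiftMap X)^[j] ((shiftMap X)^[m] y)))
    have h5 : 0 ≤ (m + N : ℝ) * ε := by positivity
    rw [abs_le] at *
    push_cast
    constructor <;> linarith

/-- An invariant measure that satisfies the upper Gibbs bound has maximal free energy. -/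
lemma IsGenerating.pressure_le_freeEnergy (hgen : IsGenerating X) [Nonempty X.carrier]
    {ν : Measure X.carrier} (hν : IsInvariantProb X ν) {K : ℝ} (hK0 : 0 < K)
    (hK : ∀ w ∈ language X, ν.real (cyl X w) ≤ K * gibbs X φ w) :
    (pressure X φ : EReal) ≤ freeEnergy X φ ν := by
  obtain ⟨hprob, hinv⟩ := hν
  -- One ε pays for the variation of S_n φ on cylinders, the other for the constants `C` and log K,
  -- which are negligible after division by n.
  have key : ∀ ε : ℝ, 0 < ε →
      ((pressure X φ - ∫ x, φ x ∂ν - 2 * ε : ℝ) : EReal) ≤ measureEntropy (shiftMap X) ν := by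
    intro ε hε
    obtain ⟨C, hC⟩ := hgen.exists_abs_S_sub_le (φ := φ) hε
    refine le_measureEntropy ν ?_
    have hlim : Tendsto (fun n : ℕ => (C + Real.log K) / (n : ℝ)) atTop (𝓝 0) :=
      tendsto_const_div_atTop_nhds_zero_nat _
    filter_upwards [eventually_gt_atTop 0, hlim.eventually (ge_mem_nhds hε)] with n hn hCn
    have hn' : (0 : ℝ) < n := by exact_mod_cast hn
    rw [div_le_iff₀ hn'] at hCn
    rw [le_div_iff₀ hn']
    have hweight : ∀ x, wordWeight X φ (word X n x) ≤ S X φ n x + (n * ε + C) := by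
      intro x
      refine wordWeight_le φ (word_mem_language X n x) fun y hy => ?_
      rw [mem_cyl_iff] at hy
      rw [length_word] at hy ⊢
      linarith [(abs_le.1 (hC n y x hy)).2]
    have h1 : ∑ w ∈ wordsOfLength (language X) n, ν.real (cyl X w) *
        (-Real.log (gibbs X φ w) - Real.log K) ≤ wordEntropy ν n := by
      refine Finset.sum_le_sum fun w hw => ?_
      rcases (measureReal_nonneg (μ := ν) (s := cyl X w)).eq_or_lt with h0 | h0
      · simp [← h0]
      · have := Real.log_le_log h0 (hK w (mem_wordsOfLength.1 hw).1)
        rw [Real.log_mul hK0.ne' (gibbs_pos X φ w).ne'] at this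
        unfold Real.negMulLog
        nlinarith
    rw [← integral_word ν n fun w => -Real.log (gibbs X φ w) - Real.log K] at h1
    have h2 : ∫ x, (n * pressure X φ - (n * ε + C) - Real.log K - S X φ n x) ∂ν ≤
        ∫ x, (-Real.log (gibbs X φ (word X n x)) - Real.log K) ∂ν := by
      refine integral_mono ((integrable_const _).sub
        (integrable_of_continuous (continuous_S X φ n)))
        (integrable_word ν n fun w => -Real.log (gibbs X φ w) - Real.log K) fun x => ?_
      simp only [log_gibbs, length_word]
      linarith [hweight x]
    rw [integral_sub (integrable_const _) (integrable_of_continuous (continuous_S X φ n)),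
      integral_S hinv] at h2
    simp only [integral_const, probReal_univ, one_smul] at h2
    nlinarith
  have h : ((pressure X φ - ∫ x, φ x ∂ν : ℝ) : EReal) ≤ measureEntropy (shiftMap X) ν := by
    have hlim : Tendsto (fun n : ℕ => ((pressure X φ - ∫ x, φ x ∂ν - 2 * (1 / ((n : ℝ) + 1)) : ℝ) :
        EReal)) atTop (𝓝 ((pressure X φ - ∫ x, φ x ∂ν - 2 * 0 : ℝ) : EReal)) :=
      (continuous_coe_real_ereal.tendsto _).comp
        ((tendsto_one_div_add_atTop_nhds_zero_nat.const_mul 2).const_sub _)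
    rw [mul_zero, sub_zero] at hlim
    exact le_of_tendsto' hlim fun n => key _ (by positivity)
  unfold freeEnergy
  calc (pressure X φ : EReal)
      = ((pressure X φ - ∫ x, φ x ∂ν : ℝ) : EReal) + ((∫ x, φ x ∂ν : ℝ) : EReal) := by
        rw [← EReal.coe_add, sub_add_cancel]
    _ ≤ _ := by gcongr

lemma measureReal_word_mem (ν : Measure X.carrier) [IsFiniteMeasure ν] {n : ℕ}
    {D : Finset (List A)} (hD : D ⊆ wordsOfLength (language X) n) :
    ν.real {x | word X n x ∈ D} = ∑ w ∈ D, ν.real (cyl X w) := by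
  have heq : {x | word X n x ∈ D} = ⋃ w ∈ D, word X n ⁻¹' {w} := by
    ext x; simp
  rw [heq, measureReal_biUnion_finset]
  · refine Finset.sum_congr rfl fun w hw => ?_
    rw [cyl_eq_preimage, (mem_wordsOfLength.1 (hD hw)).2]
  · intro a _ b _ hab
    exact Disjoint.preimage _ (by simpa using hab)
  · exact fun w _ => measurableSet_word_preimage X n w

lemma measurableSet_word_mem (n : ℕ) (D : Finset (List A)) :
    MeasurableSet {x : X.carrier | word X n x ∈ D} := by
  have heq : {x | word X n x ∈ D} = ⋃ w ∈ D, word X n ⁻¹' {w} := by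
    ext x; simp
  rw [heq]
  exact Finset.measurableSet_biUnion _ fun w _ => measurableSet_word_preimage X n w

lemma IsGenerating.exists_approx_set (hgen : IsGenerating X) [Nonempty X.carrier]
    {ν : Measure X.carrier} [IsFiniteMeasure ν] (hν : MeasurePreserving (shiftMap X) ν ν)
    {B : Set X.carrier} (hB : MeasurableSet B) {ε : ℝ} (hε : 0 < ε) :
    ∃ (m N : ℕ) (D : Finset (List A)), 0 < N ∧ D ⊆ wordsOfLength (language X) N ∧
      ν.real ((shiftMap X)^[m] ⁻¹' B \ {x | word X N x ∈ D}) ≤ ε ∧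
      ν.real ({x | word X N x ∈ D} \ (shiftMap X)^[m] ⁻¹' B) ≤ ε := by
  classical
  set ξ : X.carrier → Fin 2 := B.indicator (fun _ => 1) with hξ
  have hξm : Measurable ξ := measurable_const.indicator hB
  obtain ⟨m, N, g, hN, hg⟩ := hgen.exists_approx hν hξm hε
  refine ⟨m, N, (wordsOfLength (language X) N).filter fun w => g w = 1, hN,
    Finset.filter_subset _ _, (measureReal_mono ?_).trans hg, (measureReal_mono ?_).trans hg⟩
  · rintro x ⟨hx1, hx2⟩
    simp only [Set.mem_ofPred_eq, Finset.mem_filter, word_mem_wordsOfLength, true_and] at hx2 ⊢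
    have : ξ ((shiftMap X)^[m] x) = 1 := Set.indicator_of_mem (s := B) hx1 _
    rw [this]
    exact Ne.symm hx2
  · rintro x ⟨hx1, hx2⟩
    simp only [Set.mem_ofPred_eq, Finset.mem_filter, word_mem_wordsOfLength, true_and] at hx1 ⊢
    have : ξ ((shiftMap X)^[m] x) = 0 := Set.indicator_of_notMem (s := B) hx2 _
    rw [this, hx1]
    decide

/-- Applied to μ + ν, the approximation by words works for both measures with one `D`: a set with μ
B = 0 < ν B would give words of small μ-measure and definite ν-measure. The m shifts are harmless by
invariance. -/
lemma IsGenerating.absolutelyContinuous (hgen : IsGenerating X) [Nonempty X.carrier]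
    {μ ν : Measure X.carrier} (hμ : IsInvariantProb X μ) (hν : IsInvariantProb X ν)
    (h : ∀ a : ℝ, 0 < a → ∃ c : ℝ, 0 < c ∧ ∀ n, 0 < n → ∀ D ⊆ wordsOfLength (language X) n,
      a ≤ ∑ w ∈ D, ν.real (cyl X w) → c ≤ ∑ w ∈ D, μ.real (cyl X w)) :
    ν ≪ μ := by
  obtain ⟨hμp, hμi⟩ := hμ
  obtain ⟨hνp, hνi⟩ := hν
  refine Measure.AbsolutelyContinuous.mk fun B hB hμB => ?_
  by_contra hνB
  have hβ : 0 < ν.real B := by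
    rw [measureReal_def]
    exact ENNReal.toReal_pos hνB (measure_ne_top _ _)
  have hμB' : μ.real B = 0 := by rw [measureReal_def, hμB]; rfl
  obtain ⟨c, hc, hcD⟩ := h (ν.real B / 2) (by positivity)
  set ε := min (ν.real B / 2) (c / 2) with hε
  have hεpos : 0 < ε := by positivity
  have hκ : MeasurePreserving (shiftMap X) (μ + ν) (μ + ν) := by
    refine ⟨measurable_shiftMap, ?_⟩
    rw [Measure.map_add _ _ measurable_shiftMap, hμi.map_eq, hνi.map_eq]
  obtain ⟨m, N, D, hN, hD, h1, h2⟩ := hgen.exists_approx_set hκ hB hεpos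
  rw [measureReal_add_apply] at h1 h2
  have hν1 : ν.real B ≤ ν.real {x | word X N x ∈ D} + ε := by
    rw [← (hνi.iterate m).measureReal_preimage hB.nullMeasurableSet]
    calc _ ≤ ν.real ({x | word X N x ∈ D} ∪
          ((shiftMap X)^[m] ⁻¹' B \ {x | word X N x ∈ D})) :=
          measureReal_mono (by rw [Set.union_sdiff_self]; exact Set.subset_union_right)
      _ ≤ _ := (measureReal_union_le _ _).trans
          (add_le_add le_rfl (by
            linarith [measureReal_nonneg (μ := μ)
              (s := (shiftMap X)^[m] ⁻¹' B \ {x | word X N x ∈ D})]))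
  have hμ1 : μ.real {x | word X N x ∈ D} ≤ ε := by
    have h0 : μ.real ((shiftMap X)^[m] ⁻¹' B) = 0 := by
      rw [(hμi.iterate m).measureReal_preimage hB.nullMeasurableSet, hμB']
    calc _ ≤ μ.real ((shiftMap X)^[m] ⁻¹' B ∪
          ({x | word X N x ∈ D} \ (shiftMap X)^[m] ⁻¹' B)) :=
          measureReal_mono (by rw [Set.union_sdiff_self]; exact Set.subset_union_right)
      _ ≤ _ := (measureReal_union_le _ _).trans (by
            linarith [measureReal_nonneg (μ := ν)
              (s := {x | word X N x ∈ D} \ (shiftMap X)^[m] ⁻¹' B)])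
  rw [measureReal_word_mem ν hD] at hν1
  rw [measureReal_word_mem μ hD] at hμ1
  have := hcD N hN D hD (by linarith [min_le_left (ν.real B / 2) (c / 2)])
  linarith [min_le_right (ν.real B / 2) (c / 2)]

/-- Let `D` approximate an invariant set B and let `E` be its complement among the words. A point of
`D` that reaches `E` is outside B, or its image is in B but outside `D`; both errors are at most
c/3, too small for the assumed correlation c. -/
lemma IsGenerating.ergodic (hgen : IsGenerating X) [Nonempty X.carrier]
    {μ : Measure X.carrier} (hμ : IsInvariantProb X μ)
    (h : ∀ a : ℝ, 0 < a → ∃ c : ℝ, 0 < c ∧ ∀ n, 0 < n → ∀ D ⊆ wordsOfLength (language X) n,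
      ∀ E ⊆ wordsOfLength (language X) n, a ≤ ∑ w ∈ D, μ.real (cyl X w) →
      a ≤ ∑ w ∈ E, μ.real (cyl X w) → ∃ l, c ≤ μ.real ({x | word X n x ∈ D} ∩
        (shiftMap X)^[l] ⁻¹' {x | word X n x ∈ E})) :
    Ergodic (shiftMap X) μ := by
  classical
  obtain ⟨hμp, hμi⟩ := hμ
  refine ⟨hμi, ⟨fun {B} hB hinv => ?_⟩⟩
  rw [eventuallyConst_set']
  by_contra hcon
  rw [not_or, ae_eq_empty, ae_eq_univ] at hcon
  have hB1 : 0 < μ.real B := by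
    rw [measureReal_def]; exact ENNReal.toReal_pos hcon.1 (measure_ne_top _ _)
  have hB2 : 0 < μ.real Bᶜ := by
    rw [measureReal_def]; exact ENNReal.toReal_pos hcon.2 (measure_ne_top _ _)
  set a := min (μ.real B) (μ.real Bᶜ) / 2 with ha
  have hapos : 0 < a := by positivity
  have ha1 : 2 * a ≤ μ.real B := by linarith [min_le_left (μ.real B) (μ.real Bᶜ)]
  have ha2 : 2 * a ≤ μ.real Bᶜ := by linarith [min_le_right (μ.real B) (μ.real Bᶜ)]
  obtain ⟨c, hc, hcD⟩ := h a hapos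
  set ε := min a (c / 3) with hε
  have hεpos : 0 < ε := by positivity
  have hiter : ∀ l, (shiftMap X)^[l] ⁻¹' B = B := by
    intro l
    induction l with
    | zero => rfl
    | succ l ih => rw [Function.iterate_succ, Set.preimage_comp, ih, hinv]
  obtain ⟨m, N, D, hN, hD, h1, h2⟩ := hgen.exists_approx_set hμi hB hεpos
  rw [hiter] at h1 h2
  set E := wordsOfLength (language X) N \ D with hE
  have hEset : {x | word X N x ∈ E} = {x | word X N x ∈ D}ᶜ := by
    ext x
    simp [hE, word_mem_language]
  have hμ1 : μ.real B ≤ μ.real {x | word X N x ∈ D} + ε := by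
    calc _ ≤ μ.real ({x | word X N x ∈ D} ∪ (B \ {x | word X N x ∈ D})) :=
          measureReal_mono (by rw [Set.union_sdiff_self]; exact Set.subset_union_right)
      _ ≤ _ := (measureReal_union_le _ _).trans (add_le_add le_rfl h1)
  have hμ2 : μ.real Bᶜ ≤ μ.real {x | word X N x ∈ E} + ε := by
    rw [hEset]
    calc _ ≤ μ.real ({x | word X N x ∈ D}ᶜ ∪ ({x | word X N x ∈ D} \ B)) :=
          measureReal_mono fun x hx => by
            by_cases hxD : word X N x ∈ D
            · exact Or.inr ⟨hxD, hx⟩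
            · exact Or.inl hxD
      _ ≤ _ := (measureReal_union_le _ _).trans (add_le_add le_rfl h2)
  rw [measureReal_word_mem μ hD] at hμ1
  rw [measureReal_word_mem μ Finset.sdiff_subset] at hμ2
  obtain ⟨l, hl⟩ := hcD N hN D hD E Finset.sdiff_subset
    (by linarith [min_le_left a (c / 3)]) (by linarith [min_le_left a (c / 3)])
  have hsub : {x | word X N x ∈ D} ∩ (shiftMap X)^[l] ⁻¹' {x | word X N x ∈ E} ⊆
      ({x | word X N x ∈ D} \ B) ∪ (shiftMap X)^[l] ⁻¹' (B \ {x | word X N x ∈ D}) := by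
    rintro x ⟨hx1, hx2⟩
    by_cases hxB : x ∈ B
    · right
      rw [hEset] at hx2
      refine ⟨?_, hx2⟩
      rw [← hiter l] at hxB
      exact hxB
    · exact Or.inl ⟨hx1, hxB⟩
  have hle := (measureReal_mono (μ := μ) hsub).trans (measureReal_union_le _ _)
  rw [(hμi.iterate l).measureReal_preimage
    (hB.diff (measurableSet_word_mem N D)).nullMeasurableSet] at hle
  linarith [min_le_right a (c / 3)]

end Variational

/-! ### Weak limits of measures -/

section WeakLimit

variable {A I : Type*} [TopologicalSpace A] [AddMonoidWithOne I] [Finite A] [DiscreteTopology A]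
  [MeasurableSpace A] [BorelSpace A] [Countable I] {X : Subshift A I} {φ : C(X.carrier, ℝ)}

/-- Probability measures on a compact space form a compact space, so they converge along any
ultrafilter. `p₀` only fills in the indices at which `κ n` is not a probability measure. -/
lemma exists_weak_limit [Nonempty X.carrier] (U : Ultrafilter ℕ) (κ : ℕ → Measure X.carrier)
    (hκ : ∀ᶠ n in (U : Filter ℕ), IsProbabilityMeasure (κ n)) :
    ∃ μ : Measure X.carrier, IsProbabilityMeasure μ ∧ ∀ f : C(X.carrier, ℝ),
      Tendsto (fun n => ∫ x, f x ∂(κ n)) U (𝓝 (∫ x, f x ∂μ)) := by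
  classical
  obtain ⟨x₀⟩ := ‹Nonempty X.carrier›
  let p₀ : ProbabilityMeasure X.carrier := ⟨Measure.dirac x₀, inferInstance⟩
  let p : ℕ → ProbabilityMeasure X.carrier := fun n =>
    if h : IsProbabilityMeasure (κ n) then ⟨κ n, h⟩ else p₀
  let μ := (U.map p).lim
  have hlim : Tendsto p U (𝓝 μ) := (U.map p).le_nhds_lim
  refine ⟨μ, inferInstance, fun f => ?_⟩
  have := ProbabilityMeasure.tendsto_iff_forall_integral_tendsto.1 hlim
    (BoundedContinuousFunction.mkOfCompact f)
  refine this.congr' ?_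
  filter_upwards [hκ] with n hn
  have hpn : (p n : Measure X.carrier) = κ n := by
    have : p n = ⟨κ n, hn⟩ := dif_pos hn
    rw [this]
    rfl
  simp only [hpn]
  rfl

/-- The indicator function of a clopen set, as a continuous function. -/
def clopenIndicator {B : Set X.carrier} (hB : IsClopen B) : C(X.carrier, ℝ) :=
  ⟨B.indicator fun _ => 1, continuous_indicator (by simp [hB.frontier_eq]) continuousOn_const⟩

lemma integral_clopenIndicator {B : Set X.carrier} (hB : IsClopen B) (ν : Measure X.carrier) :
    ∫ x, clopenIndicator hB x ∂ν = ν.real B :=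
  integral_indicator_one hB.isOpen.measurableSet

lemma map_shiftMap_eq {μ : Measure X.carrier} [IsProbabilityMeasure μ]
    (h : ∀ f : C(X.carrier, ℝ), ∫ x, f (shiftMap X x) ∂μ = ∫ x, f x ∂μ) :
    MeasurePreserving (shiftMap X) μ μ := by
  refine ⟨measurable_shiftMap, ?_⟩
  have := Measure.isProbabilityMeasure_map (μ := μ) (measurable_shiftMap (X := X)).aemeasurable
  refine ext_of_forall_integral_eq_of_IsFiniteMeasure fun f => ?_
  rw [integral_map measurable_shiftMap.aemeasurable
    f.continuous.measurable.aestronglyMeasurable]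
  exact h f.toContinuousMap

end WeakLimit

/-! ### Finitely supported measures -/

section Atomic

variable {Ω ι : Type*} [MeasurableSpace Ω] (s : Finset ι) (p : ι → ℝ) (z : ι → Ω)

/-- The finite combination of Dirac masses with weights `p i` at the points `z i`. -/
def atomic : Measure Ω := ∑ i ∈ s, ENNReal.ofReal (p i) • Measure.dirac (z i)

instance : IsFiniteMeasure (atomic s p z) := by
  refine ⟨?_⟩
  simp only [atomic, Measure.coe_finsetSum, Finset.sum_apply, Measure.smul_apply,
    smul_eq_mul, measure_univ, mul_one]
  exact ENNReal.sum_lt_top.2 fun _ _ => ENNReal.ofReal_lt_top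

variable {s p z}

lemma isProbabilityMeasure_atomic (hp : ∀ i ∈ s, 0 ≤ p i) (hsum : ∑ i ∈ s, p i = 1) :
    IsProbabilityMeasure (atomic s p z) := by
  refine ⟨?_⟩
  simp only [atomic, Measure.coe_finsetSum, Finset.sum_apply, Measure.smul_apply,
    smul_eq_mul, measure_univ, mul_one]
  rw [← ENNReal.ofReal_sum_of_nonneg hp, hsum, ENNReal.ofReal_one]

lemma integral_atomic (hp : ∀ i ∈ s, 0 ≤ p i) {f : Ω → ℝ} (hf : StronglyMeasurable f) :
    ∫ x, f x ∂(atomic s p z) = ∑ i ∈ s, p i * f (z i) := by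
  unfold atomic
  rw [integral_finsetSum_measure]
  · refine Finset.sum_congr rfl fun i hi => ?_
    rw [integral_smul_measure, integral_dirac' _ _ hf, ENNReal.toReal_ofReal (hp i hi), smul_eq_mul]
  · intro i _
    refine Integrable.smul_measure ?_ ENNReal.ofReal_ne_top
    exact integrable_dirac' hf (by simp)

end Atomic

/-! ### Construction of the Gibbs measure -/

section Construction

variable {A I : Type*} [TopologicalSpace A] [AddMonoidWithOne I] [Finite A] [DiscreteTopology A]
  [MeasurableSpace A] [BorelSpace A] [Countable I] {X : Subshift A I} {φ : C(X.carrier, ℝ)}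

/-- The proportion, by weight, of the words of length `n` whose marked point lies in `B`. -/
def proportion (φ : C(X.carrier, ℝ)) (pt : List A → X.carrier) (n : ℕ) (B : Set X.carrier) : ℝ :=
  (∑ w ∈ wordsOfLength (language X) n, gibbs X φ w * B.indicator (fun _ => 1) (pt w)) /
    mass X φ (wordsOfLength (language X) n)

lemma proportion_eq [Nonempty X.carrier] (pt : List A → X.carrier) (n : ℕ) (B : Set X.carrier)
    [DecidablePred fun w => pt w ∈ B] :
    proportion φ pt n B = mass X φ ((wordsOfLength (language X) n).filter fun w => pt w ∈ B) /
      mass X φ (wordsOfLength (language X) n) := by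
  unfold proportion mass
  rw [Finset.sum_filter]
  congr 1
  refine Finset.sum_congr rfl fun w _ => ?_
  by_cases h : pt w ∈ B <;> simp [h]

lemma mass_language_pos [Nonempty X.carrier] (n : ℕ) :
    0 < mass X φ (wordsOfLength (language X) n) :=
  lt_of_lt_of_le one_pos (one_le_mass X φ n)

lemma proportion_le_one [Nonempty X.carrier] (pt : List A → X.carrier) (n : ℕ)
    (B : Set X.carrier) : proportion φ pt n B ≤ 1 := by
  classical
  rw [proportion_eq, div_le_one (mass_language_pos n)]
  exact mass_mono X φ (Finset.filter_subset _ _)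

lemma proportion_nonneg [Nonempty X.carrier] (pt : List A → X.carrier) (n : ℕ)
    (B : Set X.carrier) : 0 ≤ proportion φ pt n B := by
  classical
  rw [proportion_eq]
  exact div_nonneg (mass_nonneg X φ _) (mass_nonneg X φ _)

/-- The weighted orbit averages along the words of length `n`. -/
def orbitMeasure (φ : C(X.carrier, ℝ)) (pt : List A → X.carrier) (n : ℕ) : Measure X.carrier :=
  atomic (Finset.range n ×ˢ wordsOfLength (language X) n)
    (fun q => gibbs X φ q.2 / (n * mass X φ (wordsOfLength (language X) n)))
    (fun q => (shiftMap X)^[q.1] (pt q.2))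

lemma isProbabilityMeasure_orbitMeasure [Nonempty X.carrier] (pt : List A → X.carrier) {n : ℕ}
    (hn : 0 < n) : IsProbabilityMeasure (orbitMeasure φ pt n) := by
  have hm := mass_language_pos (X := X) (φ := φ) n
  have hn' : (0 : ℝ) < n := by exact_mod_cast hn
  refine isProbabilityMeasure_atomic (fun q _ => div_nonneg (gibbs_pos X φ _).le (by positivity)) ?_
  rw [Finset.sum_product]
  simp only
  rw [Finset.sum_const, Finset.card_range, ← Finset.sum_div, nsmul_eq_mul]
  change (n : ℝ) * (mass X φ _ / _) = 1
  field_simp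

lemma integral_orbitMeasure [Nonempty X.carrier] (pt : List A → X.carrier) (n : ℕ)
    {f : X.carrier → ℝ} (hf : StronglyMeasurable f) :
    ∫ x, f x ∂(orbitMeasure φ pt n) = (∑ k ∈ Finset.range n,
      (∑ w ∈ wordsOfLength (language X) n, gibbs X φ w * f ((shiftMap X)^[k] (pt w))) /
        mass X φ (wordsOfLength (language X) n)) / n := by
  have hm := mass_language_pos (X := X) (φ := φ) n
  unfold orbitMeasure
  rw [integral_atomic (fun q _ => div_nonneg (gibbs_pos X φ _).le (by positivity)) hf,
    Finset.sum_product, Finset.sum_div]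
  refine Finset.sum_congr rfl fun k _ => ?_
  simp only
  rw [Finset.sum_div, Finset.sum_div]
  refine Finset.sum_congr rfl fun w _ => ?_
  rw [div_mul_eq_mul_div, div_div, mul_comm (n : ℝ)]

lemma orbitMeasure_real [Nonempty X.carrier] (pt : List A → X.carrier) (n : ℕ)
    {B : Set X.carrier} (hB : MeasurableSet B) :
    (orbitMeasure φ pt n).real B =
      (∑ k ∈ Finset.range n, proportion φ pt n ((shiftMap X)^[k] ⁻¹' B)) / n := by
  rw [← integral_indicator_one hB,
    integral_orbitMeasure pt n (stronglyMeasurable_one.indicator hB)]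
  rfl

/-- The sum over k telescopes to two end terms, each at most ‖f‖, divided by n. -/
lemma tendsto_integral_orbitMeasure_sub [Nonempty X.carrier] (pt : List A → X.carrier)
    (f : C(X.carrier, ℝ)) :
    Tendsto (fun n => ∫ x, f (shiftMap X x) ∂(orbitMeasure φ pt n) -
      ∫ x, f x ∂(orbitMeasure φ pt n)) atTop (𝓝 0) := by
  refine squeeze_zero_norm (a := fun n : ℕ => 2 * ‖f‖ / n) (fun n => ?_)
    (tendsto_const_div_atTop_nhds_zero_nat _)
  rcases Nat.eq_zero_or_pos n with rfl | hn
  · simp [orbitMeasure, atomic]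
  have hm := mass_language_pos (X := X) (φ := φ) n
  have hn' : (0 : ℝ) < n := by exact_mod_cast hn
  rw [integral_orbitMeasure pt n (f := fun x => f (shiftMap X x))
      (f.continuous.comp (continuous_shiftMap X)).stronglyMeasurable,
    integral_orbitMeasure pt n f.continuous.stronglyMeasurable, ← sub_div,
    ← Finset.sum_sub_distrib]
  simp only [← Function.iterate_succ_apply' (shiftMap X)]
  rw [Finset.sum_range_sub (fun k => (∑ w ∈ wordsOfLength (language X) n,
    gibbs X φ w * f ((shiftMap X)^[k] (pt w))) / mass X φ (wordsOfLength (language X) n)),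
    Real.norm_eq_abs, abs_div, abs_of_pos hn']
  refine div_le_div_of_nonneg_right ?_ hn'.le
  have hb : ∀ k, |(∑ w ∈ wordsOfLength (language X) n,
      gibbs X φ w * f ((shiftMap X)^[k] (pt w))) / mass X φ (wordsOfLength (language X) n)| ≤
        ‖f‖ := by
    intro k
    rw [abs_div, abs_of_pos hm, div_le_iff₀ hm]
    refine (Finset.abs_sum_le_sum_abs _ _).trans ?_
    unfold mass
    rw [Finset.mul_sum]
    refine Finset.sum_le_sum fun w _ => ?_
    rw [abs_mul, abs_of_pos (gibbs_pos X φ w), mul_comm]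
    exact mul_le_mul_of_nonneg_right (f.norm_coe_le_norm _) (gibbs_pos X φ w).le
  refine (abs_sub _ _).trans ?_
  linarith [hb n, hb 0]

/-- A weak limit of the weighted orbit averages is invariant, and the bounds for the proportions
pass to the limit. -/
lemma exists_limit_orbitMeasure [Nonempty X.carrier] (φ : C(X.carrier, ℝ))
    (pt : List A → X.carrier) :
    ∃ μ : Measure X.carrier, IsInvariantProb X μ ∧
      (∀ B : Set X.carrier, IsClopen B → ∀ (c : ℝ) (s : ℕ), 0 ≤ c →
        (∀ n k, s ≤ k → k + s ≤ n → c ≤ proportion φ pt n ((shiftMap X)^[k] ⁻¹' B)) →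
        c ≤ μ.real B) ∧
      ∀ B : Set X.carrier, IsClopen B → ∀ (c : ℝ) (s : ℕ), 0 ≤ c →
        (∀ n k, k + s ≤ n → proportion φ pt n ((shiftMap X)^[k] ⁻¹' B) ≤ c) →
        μ.real B ≤ c := by
  set U : Ultrafilter ℕ := Ultrafilter.of atTop
  have hU : (U : Filter ℕ) ≤ atTop := Ultrafilter.of_le atTop
  have hpos : ∀ᶠ n : ℕ in (U : Filter ℕ), 0 < n := hU (eventually_gt_atTop 0)
  obtain ⟨μ, hμ, hlim⟩ := exists_weak_limit U (orbitMeasure φ pt)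
    (hpos.mono fun n hn => isProbabilityMeasure_orbitMeasure pt hn)
  have hreal : ∀ B : Set X.carrier, IsClopen B →
      Tendsto (fun n => (orbitMeasure φ pt n).real B) U (𝓝 (μ.real B)) := by
    intro B hB
    have := hlim (clopenIndicator hB)
    simpa only [integral_clopenIndicator] using this
  refine ⟨μ, ⟨hμ, map_shiftMap_eq fun f => ?_⟩, ?_, ?_⟩
  · have h1 := (hlim (f.comp ⟨shiftMap X, continuous_shiftMap X⟩)).sub (hlim f)
    have h2 := (tendsto_integral_orbitMeasure_sub (φ := φ) pt f).mono_left hU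
    exact sub_eq_zero.1 (tendsto_nhds_unique h1 h2)
  -- Only the 2s times k near the two ends escape the hypothesis, a fraction that tends to 0.
  · intro B hB c s hc h
    have hl : Tendsto (fun n : ℕ => c - c * (2 * s) / n) U (𝓝 (c - 0)) :=
      ((tendsto_const_div_atTop_nhds_zero_nat (c * (2 * s))).const_sub c).mono_left hU
    rw [sub_zero] at hl
    refine le_of_tendsto_of_tendsto hl (hreal B hB) (hpos.mono fun n hn => ?_)
    dsimp only
    have hn' : (0 : ℝ) < n := by exact_mod_cast hn
    rw [orbitMeasure_real pt n hB.isOpen.measurableSet, le_div_iff₀ hn', sub_mul,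
      div_mul_cancel₀ _ hn'.ne']
    have h1 : ∑ k ∈ Finset.Ico s (n - s), c ≤
        ∑ k ∈ Finset.range n, proportion φ pt n ((shiftMap X)^[k] ⁻¹' B) := by
      refine (Finset.sum_le_sum fun k hk => ?_).trans (Finset.sum_le_sum_of_subset_of_nonneg
        (fun k hk => ?_) fun k _ _ => proportion_nonneg pt n _)
      · rw [Finset.mem_Ico] at hk
        exact h n k hk.1 (by omega)
      · rw [Finset.mem_Ico] at hk
        rw [Finset.mem_range]
        omega
    rw [Finset.sum_const, Nat.card_Ico, nsmul_eq_mul] at h1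
    have h2 : (n : ℝ) - 2 * s ≤ ((n - s - s : ℕ) : ℝ) := by
      have : n ≤ (n - s - s) + 2 * s := by omega
      have : (n : ℝ) ≤ ((n - s - s : ℕ) : ℝ) + 2 * s := by exact_mod_cast this
      linarith
    nlinarith
  · intro B hB c s hc h
    have hl : Tendsto (fun n : ℕ => c + s / (n : ℝ)) U (𝓝 (c + 0)) :=
      ((tendsto_const_div_atTop_nhds_zero_nat (s : ℝ)).const_add c).mono_left hU
    rw [add_zero] at hl
    refine le_of_tendsto_of_tendsto (hreal B hB) hl (hpos.mono fun n hn => ?_)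
    dsimp only
    have hn' : (0 : ℝ) < n := by exact_mod_cast hn
    rw [orbitMeasure_real pt n hB.isOpen.measurableSet, div_le_iff₀ hn', add_mul,
      div_mul_cancel₀ _ hn'.ne']
    calc ∑ k ∈ Finset.range n, proportion φ pt n ((shiftMap X)^[k] ⁻¹' B)
        ≤ ∑ k ∈ Finset.range n, (c + if k + s ≤ n then 0 else 1) := by
          refine Finset.sum_le_sum fun k _ => ?_
          split_ifs with hk
          · linarith [h n k hk]
          · linarith [proportion_le_one (φ := φ) pt n ((shiftMap X)^[k] ⁻¹' B)]
      _ ≤ c * n + s := by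
          rw [Finset.sum_add_distrib, Finset.sum_const, Finset.card_range, nsmul_eq_mul, mul_comm]
          refine add_le_add le_rfl ?_
          have h1 : ∑ k ∈ Finset.range n, (if k + s ≤ n then (0 : ℝ) else 1) =
              (((Finset.range n).filter fun k => ¬ k + s ≤ n).card : ℝ) := by
            rw [Finset.card_filter]
            push_cast
            refine Finset.sum_congr rfl fun k _ => ?_
            split_ifs <;> simp_all
          rw [h1]
          have h2 : ((Finset.range n).filter fun k => ¬ k + s ≤ n) ⊆ Finset.Ico (n - s) n := by
            intro k hk
            simp only [Finset.mem_filter, Finset.mem_range, Finset.mem_Ico] at hk ⊢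
            omega
          have h3 := Finset.card_le_card h2
          rw [Nat.card_Ico] at h3
          exact_mod_cast h3.trans (by omega)

/-- A word showing `w` at position k splits as prefix, `w`, suffix; prefixes and suffixes have mass
at most K each, while the normalising mass is at least 1. -/
lemma proportion_cyl_le [Nonempty X.carrier] {pt : List A → X.carrier}
    (hpt : ∀ w ∈ language X, pt w ∈ cyl X w) {K : ℝ} (hK1 : 1 ≤ K)
    (hK : ∀ n, mass X φ (wordsOfLength (language X) n) ≤ K) (w : List A) {n k : ℕ}
    (hk : k + w.length ≤ n) :
    proportion φ pt n ((shiftMap X)^[k] ⁻¹' cyl X w) ≤ K * K * gibbs X φ w := by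
  classical
  have hm := one_le_mass X φ n
  rw [proportion_eq, div_le_iff₀ (mass_language_pos n)]
  have h1 : mass X φ ((wordsOfLength (language X) n).filter
      fun r => pt r ∈ (shiftMap X)^[k] ⁻¹' cyl X w) ≤
      ∑ p ∈ wordsOfLength (language X) k ×ˢ wordsOfLength (language X) (n - k - w.length),
        gibbs X φ p.1 * (gibbs X φ w * gibbs X φ p.2) := by
    refine sum_le_sum_of_section (fun p => p.1 ++ (w ++ p.2)) ?_ fun p _ =>
      mul_nonneg (gibbs_pos X φ _).le (mul_nonneg (gibbs_pos X φ _).le (gibbs_pos X φ _).le)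
    intro r hr
    rw [Finset.mem_filter, mem_wordsOfLength] at hr
    obtain ⟨⟨hrL, hrn⟩, hrw⟩ := hr
    have hr' := (mem_cyl_iff X).1 (hpt r hrL)
    rw [hrn, show n = k + (w.length + (n - k - w.length)) by omega, word_add, word_add,
      (mem_cyl_iff X).1 hrw] at hr'
    refine ⟨(word X k (pt r), word X (n - k - w.length)
      ((shiftMap X)^[w.length] ((shiftMap X)^[k] (pt r)))), ?_, hr', ?_⟩
    · simp [word_mem_language]
    · rw [← hr'] at hrL
      have e1 := gibbs_append_le φ hrL
      have e2 := gibbs_append_le φ (right_mem_language hrL)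
      rw [hr'] at e1
      exact e1.trans (mul_le_mul_of_nonneg_left e2 (gibbs_pos X φ _).le)
  refine h1.trans ?_
  rw [Finset.sum_product]
  simp only
  simp_rw [← Finset.mul_sum]
  rw [← Finset.sum_mul]
  change mass X φ _ * (_ * mass X φ _) ≤ _
  have hw := gibbs_pos X φ w
  have e1 := mass_nonneg X φ (wordsOfLength (language X) (n - k - w.length))
  calc _ ≤ K * (gibbs X φ w * K) := by gcongr <;> exact hK _
    _ = K * K * gibbs X φ w * 1 := by ring
    _ ≤ _ := by gcongr

variable {Cp G Cs : Set (List A)}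

/-- Five good blocks are glued: a filler, a word of `E`, one letter, a word of `F`, a filler. The
outer lengths a and b put the word of `E` exactly at position k and make the total length n. The
three fillers have mass at least 1/2 each, and division by mass(L_n) ≤ K gives the factor 1 / (8K).
-/
lemma le_proportion_pair [Nonempty X.carrier] {pt : List A → X.carrier}
    (hpt : ∀ w ∈ language X, pt w ∈ cyl X w) {K : ℝ} (hK1 : 1 ≤ K)
    (hK : ∀ n, mass X φ (wordsOfLength (language X) n) ≤ K) {D : Set (List A)} {t : ℕ}
    (hD : HasSpecS X D t) {V : ℝ}
    (hV : ∀ w ∈ D, ∀ x ∈ cyl X w, wordWeight X φ w - V ≤ S X φ w.length x)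
    (hmass : ∀ n, 0 < n → 1 / 2 ≤ mass X φ (wordsOfLength D n)) {i j : ℕ} {E F : Finset (List A)}
    (hE : E ⊆ wordsOfLength D i) (hF : F ⊆ wordsOfLength D j) {n k : ℕ}
    (hk : i + j + 4 * t + 2 ≤ k) (hn : k + (i + j + 4 * t + 2) ≤ n) :
    Real.exp (-((4 + 1) * V + 4 * t * (‖φ‖ + pressure X φ))) / (8 * K) *
      (mass X φ E * mass X φ F) ≤
      proportion φ pt n ((shiftMap X)^[k] ⁻¹' ({x | word X i x ∈ E} ∩
        (shiftMap X)^[i + 2 * t + 1] ⁻¹' {x | word X j x ∈ F})) := by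
  classical
  set a := k - t with ha
  set b := n - (k + (i + 2 * t + 1) + j + t) with hb
  set B := (shiftMap X)^[k] ⁻¹' ({x | word X i x ∈ E} ∩
        (shiftMap X)^[i + 2 * t + 1] ⁻¹' {x | word X j x ∈ F}) with hB
  have h := prod_mass_le_mass_glue X φ hD hV (m := 4) ![a, i, 1, j, b]
    ![wordsOfLength D a, E, wordsOfLength D 1, F, wordsOfLength D b] ?_ (fun r => pt r ∈ B) ?_
  · have hsum : ∑ q, (![a, i, 1, j, b] : Fin 5 → ℕ) q + 4 * t = n := by
      simp [Fin.sum_univ_succ]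
      omega
    rw [hsum] at h
    rw [proportion_eq, le_div_iff₀ (mass_language_pos n)]
    refine le_trans ?_ h
    simp only [Fin.prod_univ_succ, Matrix.cons_val_zero, Matrix.cons_val_succ,
      Finset.univ_eq_empty, Finset.prod_empty, mul_one, Nat.cast_ofNat]
    set c := Real.exp (-((4 + 1) * V + 4 * t * (‖φ‖ + pressure X φ)))
    have hc : 0 < c := Real.exp_pos _
    have e1 := hmass a (by omega)
    have e2 := hmass 1 one_pos
    have e3 := hmass b (by omega)
    have e4 := mass_nonneg X φ E
    have e5 := mass_nonneg X φ F
    calc c / (8 * K) * (mass X φ E * mass X φ F) * mass X φ (wordsOfLength (language X) n)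
        ≤ c / (8 * K) * (mass X φ E * mass X φ F) * K := by gcongr; exact hK n
      _ = c * (1 / 2 * (mass X φ E * (1 / 2 * (mass X φ F * (1 / 2))))) := by
          field_simp; ring
      _ ≤ _ := by gcongr
  · intro q w hw
    fin_cases q
    · exact mem_wordsOfLength.1 hw
    · exact mem_wordsOfLength.1 (hE hw)
    · exact mem_wordsOfLength.1 hw
    · exact mem_wordsOfLength.1 (hF hw)
    · exact mem_wordsOfLength.1 hw
  · rintro r hr ⟨w, hw, hpos⟩
    have hx := hpos _ (hpt r hr)
    have p1 : gluePos t ![a, i, 1, j, b] 1 = k := by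
      rw [gluePos, Fin.sum_univ_five, if_pos (by decide), if_neg (by decide),
        if_neg (by decide), if_neg (by decide), if_neg (by decide)]
      change a + t + 0 + 0 + 0 + 0 = k
      omega
    have p3 : gluePos t ![a, i, 1, j, b] 3 = i + 2 * t + 1 + k := by
      rw [gluePos, Fin.sum_univ_five, if_pos (by decide), if_pos (by decide),
        if_pos (by decide), if_neg (by decide), if_neg (by decide)]
      change a + t + (i + t) + (1 + t) + 0 + 0 = _
      omega
    have x1 := (mem_cyl_iff X).1 (hx 1)
    have x3 := (mem_cyl_iff X).1 (hx 3)
    have w1 : w 1 ∈ E := hw 1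
    have w3 : w 3 ∈ F := hw 3
    rw [p1, (mem_wordsOfLength.1 (hE w1)).2] at x1
    rw [p3, (mem_wordsOfLength.1 (hF w3)).2, Function.iterate_add_apply] at x3
    refine ⟨?_, ?_⟩
    · change word X i _ ∈ E
      rwa [x1]
    · change word X j _ ∈ F
      rwa [x3]

lemma isClopen_word_mem (n : ℕ) (D : Finset (List A)) :
    IsClopen {x : X.carrier | word X n x ∈ D} := by
  have heq : {x : X.carrier | word X n x ∈ D} = ⋃ w ∈ D, word X n ⁻¹' {w} := by
    ext x; simp
  rw [heq]
  refine Set.Finite.isClopen_biUnion D.finite_toSet fun w _ => ?_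
  by_cases h : w.length = n
  · subst h
    rw [← cyl_eq_preimage]; exact isClopen_cyl X w
  · convert isClopen_empty
    ext x
    simp only [Set.mem_preimage, Set.mem_singleton_iff, Set.mem_empty_iff_false, iff_false]
    rintro rfl
    exact h (length_word X n x)

lemma half_le_mass_fatten [Nonempty X.carrier] {M : ℕ}
    (hM : ∀ n, 0 < n → ∀ Y : Finset (List A), (∀ y ∈ Y, y ∈ language X ∧ y.length = n) →
      (∀ y ∈ Y, y ∉ fatten X Cp G Cs M) → mass X φ Y ≤ 1 / 2) (n : ℕ) (hn : 0 < n) :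
    1 / 2 ≤ mass X φ (wordsOfLength (fatten X Cp G Cs M) n) := by
  classical
  set L := wordsOfLength (language X) n with hL
  have h1 := one_le_mass X φ n
  have h2 := hM n hn (L.filter fun y => y ∉ fatten X Cp G Cs M)
    (fun y hy => mem_wordsOfLength.1 (Finset.mem_filter.1 hy).1)
    (fun y hy => (Finset.mem_filter.1 hy).2)
  have h3 : mass X φ (L.filter fun y => y ∈ fatten X Cp G Cs M) ≤
      mass X φ (wordsOfLength (fatten X Cp G Cs M) n) := by
    refine mass_mono X φ fun y hy => ?_
    rw [Finset.mem_filter, mem_wordsOfLength] at hy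
    rw [mem_wordsOfLength]
    exact ⟨hy.2, hy.1.2⟩
  have h4 : mass X φ (L.filter fun y => y ∈ fatten X Cp G Cs M) +
      mass X φ (L.filter fun y => y ∉ fatten X Cp G Cs M) = mass X φ L :=
    Finset.sum_filter_add_sum_filter_not _ _ _
  linarith

/-- There is an invariant measure with the Gibbs property that moreover correlates any two
collections of good words. -/
theorem exists_gibbs_measure [Nonempty X.carrier] (hdec : IsDecomposition X Cp G Cs)
    (hspec : ∀ M : ℕ, ∃ t : ℕ, HasSpecS X (fatten X Cp G Cs M) t) (hB : HasBowen X φ G)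
    (hsum : Summable fun n : ℕ => partitionSum X φ (Cp ∪ Cs) (n + 1) *
        Real.exp (-((n + 1 : ℕ) : ℝ) * pressure X φ)) :
    ∃ μ : Measure X.carrier, IsInvariantProb X μ ∧
      (∃ K : ℝ, 0 < K ∧ ∀ w ∈ language X, μ.real (cyl X w) ≤ K * gibbs X φ w) ∧
      (∀ M, ∃ c : ℝ, 0 < c ∧ ∀ w ∈ fatten X Cp G Cs M, c * gibbs X φ w ≤ μ.real (cyl X w)) ∧
      ∀ M, ∃ c : ℝ, 0 < c ∧ ∀ i, ∀ E ⊆ wordsOfLength (fatten X Cp G Cs M) i,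
        ∀ F ⊆ wordsOfLength (fatten X Cp G Cs M) i, ∃ l, c * (mass X φ E * mass X φ F) ≤
          μ.real ({x | word X i x ∈ E} ∩ (shiftMap X)^[l] ⁻¹' {x | word X i x ∈ F}) := by
  classical
  obtain ⟨K, hK1, hK⟩ := exists_mass_language_le hdec hspec hB hsum
  obtain ⟨M₀, hM₀⟩ := exists_mass_filter_not_mem_fatten_le hdec hspec hB hsum
    (show (0 : ℝ) < 1 / 2 by norm_num)
  have hpt : ∃ pt : List A → X.carrier, ∀ w ∈ language X, pt w ∈ cyl X w := by
    obtain ⟨x₀⟩ := ‹Nonempty X.carrier›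
    refine ⟨fun w => if h : (cyl X w).Nonempty then h.some else x₀, fun w hw => ?_⟩
    have hw' : (cyl X w).Nonempty := hw
    simp only [dif_pos hw']
    exact hw'.some_mem
  obtain ⟨pt, hpt⟩ := hpt
  obtain ⟨μ, hμ, hlow, hup⟩ := exists_limit_orbitMeasure φ pt
  have := hμ.1
  -- Passing to max M M₀ puts the given words and fillers of mass at least 1/2 into one collection
  -- with specification.
  have hpair : ∀ M, ∃ c : ℝ, 0 < c ∧ ∀ i j, ∀ E ⊆ wordsOfLength (fatten X Cp G Cs M) i,
      ∀ F ⊆ wordsOfLength (fatten X Cp G Cs (max M M₀)) j, ∃ l, c * (mass X φ E * mass X φ F) ≤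
        μ.real ({x | word X i x ∈ E} ∩ (shiftMap X)^[l] ⁻¹' {x | word X j x ∈ F}) := by
    intro M
    obtain ⟨t, ht⟩ := hspec (max M M₀)
    obtain ⟨V, hV0, hV⟩ := HasBowen.exists_fatten (Cp := Cp) (Cs := Cs) hB (max M M₀)
    refine ⟨Real.exp (-((4 + 1) * V + 4 * t * (‖φ‖ + pressure X φ))) / (8 * K), by positivity,
      fun i j E hE F hF => ⟨i + 2 * t + 1, ?_⟩⟩
    refine hlow _ ?_ _ (i + j + 4 * t + 2) ?_ fun n k hk hn => ?_
    · exact (isClopen_word_mem i E).inter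
        ((isClopen_word_mem j F).preimage ((continuous_shiftMap X).iterate _))
    · exact mul_nonneg (by positivity) (mul_nonneg (mass_nonneg X φ _) (mass_nonneg X φ _))
    · refine le_proportion_pair hpt hK1 hK ht hV (fun n hn =>
        half_le_mass_fatten (hM₀ _ (le_max_right M M₀)) n hn) (fun w hw => ?_) hF hk hn
      have := mem_wordsOfLength.1 (hE hw)
      exact mem_wordsOfLength.2 ⟨fatten_mono (le_max_left M M₀) this.1, this.2⟩
  refine ⟨μ, hμ, ⟨K * K, by positivity, fun w hw => ?_⟩, fun M => ?_, fun M => ?_⟩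
  · exact hup _ (isClopen_cyl X w) _ w.length
      (mul_nonneg (by positivity) (gibbs_pos X φ w).le)
      fun n k hk => proportion_cyl_le hpt hK1 hK w hk
  · obtain ⟨c, hc, h⟩ := hpair M
    refine ⟨c * (1 / 2), by positivity, fun w hw => ?_⟩
    -- With F the set of all good words of length 1, of mass at least 1/2, the correlation bound
    -- becomes a lower bound for μ [w].
    obtain ⟨l, hl⟩ := h w.length 1 {w} (by simpa using hw) _ subset_rfl
    have h1 := half_le_mass_fatten (hM₀ _ (le_max_right M M₀)) 1 one_pos
    have h2 : mass X φ {w} = gibbs X φ w := Finset.sum_singleton _ _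
    have hg := gibbs_pos X φ w
    calc c * (1 / 2) * gibbs X φ w = c * (gibbs X φ w * (1 / 2)) := by ring
      _ ≤ _ := by rw [← h2] at hg ⊢; gcongr
      _ ≤ _ := hl
      _ ≤ _ := measureReal_mono fun x hx => by
          rw [mem_cyl_iff]
          simpa using hx.1
  · obtain ⟨c, hc, h⟩ := hpair M
    refine ⟨c, hc, fun i E hE F hF => h i i E hE F fun w hw => ?_⟩
    have := mem_wordsOfLength.1 (hF hw)
    exact mem_wordsOfLength.2 ⟨fatten_mono (le_max_left M M₀) this.1, this.2⟩

end Construction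

/-! ### Periodic orbit measures -/

section Periodic

variable {A I : Type*} [TopologicalSpace A] [AddMonoidWithOne I] [Finite A] [DiscreteTopology A]
  [MeasurableSpace A] [BorelSpace A] [Countable I] {X : Subshift A I} {φ : C(X.carrier, ℝ)}
  {Cp G Cs : Set (List A)}

lemma IsGenerating.finite_ptsOfPeriod (hgen : IsGenerating X) {n : ℕ} (hn : 0 < n) :
    (Function.ptsOfPeriod (shiftMap X) n).Finite := by
  refine Set.Finite.of_finite_image
    ((wordsOfLength (language X) n).finite_toSet.subset ?_) (f := word X n) ?_
  · rintro _ ⟨x, -, rfl⟩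
    exact word_mem_wordsOfLength X n x
  · intro x hx y hy hxy
    exact hgen.eq_of_forall_word hn hx hy hxy

/-- The normalised weight of a point of period `n`. -/
def periodicWeight (φ : C(X.carrier, ℝ)) (n : ℕ) (x : X.carrier) : ℝ :=
  Real.exp (S X φ n x - n * pressure X φ)

/-- The factors exp(-nP) cancel between numerator and denominator. -/
lemma periodicMeasure_eq {n : ℕ} {s : Finset X.carrier}
    (hs : (s : Set X.carrier) = Function.ptsOfPeriod (shiftMap X) n) :
    periodicMeasure X φ n = atomic s
      (fun x => periodicWeight φ n x / ∑ y ∈ s, periodicWeight φ n y) id := by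
  classical
  unfold periodicMeasure atomic
  have hmem : ∀ x, x ∈ s ↔ x ∈ Function.ptsOfPeriod (shiftMap X) n := by
    intro x; rw [← hs]; rfl
  let _ : Fintype (Function.ptsOfPeriod (shiftMap X) n) := Fintype.ofFinset s hmem
  rw [Measure.sum_fintype, tsum_fintype]
  have h1 := Finset.sum_subtype (F := ‹Fintype (Function.ptsOfPeriod (shiftMap X) n)›) s hmem fun x => ENNReal.ofReal (Real.exp (S X φ n x))
  have h2 := Finset.sum_subtype (F := ‹Fintype (Function.ptsOfPeriod (shiftMap X) n)›) s hmem fun x =>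
    ENNReal.ofReal (Real.exp (S X φ n x)) • (Measure.dirac x : Measure X.carrier)
  rw [← h1, ← h2, Finset.smul_sum]
  refine Finset.sum_congr rfl fun x hx => ?_
  rw [smul_smul]
  congr 1
  rw [← ENNReal.ofReal_sum_of_nonneg fun _ _ => (Real.exp_pos _).le]
  have hpos : 0 < ∑ y ∈ s, Real.exp (S X φ n y) := Finset.sum_pos (fun _ _ => Real.exp_pos _) ⟨x, hx⟩
  rw [← ENNReal.ofReal_inv_of_pos hpos, ← ENNReal.ofReal_mul (by positivity)]
  congr 1
  have hw : ∀ y, periodicWeight φ n y =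
      Real.exp (S X φ n y) * Real.exp (-(n * pressure X φ)) := by
    intro y; rw [periodicWeight, ← Real.exp_add]; rfl
  simp only [hw, ← Finset.sum_mul]
  have := Real.exp_pos (-(n * pressure X φ))
  field_simp

lemma S_shiftMap_of_isPeriodicPt {n : ℕ} {x : X.carrier}
    (hx : Function.IsPeriodicPt (shiftMap X) n x) : S X φ n (shiftMap X x) = S X φ n x := by
  have h1 := S_add X φ n 1 x
  have h2 := S_add X φ 1 n x
  rw [add_comm, hx.eq, h2] at h1
  simp only [Function.iterate_one] at h1
  linarith

/-- The shift permutes the points of period n and preserves S_n φ on them. -/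
lemma sum_shiftMap_of_period {n : ℕ} (hn : 0 < n) {s : Finset X.carrier}
    (hs : (s : Set X.carrier) = Function.ptsOfPeriod (shiftMap X) n) (f : X.carrier → ℝ) :
    ∑ x ∈ s, periodicWeight φ n x * f (shiftMap X x) = ∑ x ∈ s, periodicWeight φ n x * f x := by
  have hmem : ∀ x, x ∈ s ↔ Function.IsPeriodicPt (shiftMap X) n x := by
    intro x; rw [← Finset.mem_coe, hs]; rfl
  refine Finset.sum_bij (fun x _ => shiftMap X x) (fun x hx => ?_) (fun x hx y hy hxy => ?_)
    (fun y hy => ?_) fun x hx => ?_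
  · rw [hmem] at hx ⊢
    exact hx.apply
  · rw [hmem] at hx hy
    have h : ∀ z, (shiftMap X)^[n] z = (shiftMap X)^[n - 1] (shiftMap X z) := by
      intro z
      rw [← Function.iterate_succ_apply, Nat.succ_eq_add_one, Nat.sub_add_cancel hn]
    rw [← hx.eq, ← hy.eq, h x, h y, hxy]
  · rw [hmem] at hy
    refine ⟨(shiftMap X)^[n - 1] y, (hmem _).2 (hy.apply_iterate _), ?_⟩
    rw [← Function.iterate_succ_apply' (shiftMap X), Nat.succ_eq_add_one, Nat.sub_add_cancel hn]
    exact hy.eq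
  · rw [hmem] at hx
    unfold periodicWeight
    rw [S_shiftMap_of_isPeriodicPt hx]

/-- A point of period n in [w] is determined by the n - |w| letters that follow `w`, and these
suffixes have mass at most K. -/
lemma IsGenerating.sum_periodicWeight_cyl_le (hgen : IsGenerating X) {n : ℕ} (hn : 0 < n)
    {s : Finset X.carrier} (hs : ∀ x ∈ s, Function.IsPeriodicPt (shiftMap X) n x) {K : ℝ}
    (hK : ∀ n, mass X φ (wordsOfLength (language X) n) ≤ K) {w : List A} (hw : w.length ≤ n)
    (hsw : ∀ x ∈ s, x ∈ cyl X w) :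
    ∑ x ∈ s, periodicWeight φ n x ≤ K * gibbs X φ w := by
  have h1 : ∑ x ∈ s, periodicWeight φ n x ≤
      ∑ v ∈ wordsOfLength (language X) (n - w.length), gibbs X φ w * gibbs X φ v := by
    have hsplit : ∀ x ∈ s, word X n x =
        w ++ word X (n - w.length) ((shiftMap X)^[w.length] x) := by
      intro x hx
      have := word_add X w.length (n - w.length) x
      rwa [Nat.add_sub_cancel' hw, (mem_cyl_iff X).1 (hsw x hx)] at this
    refine sum_le_sum_of_injOn (fun x => word X (n - w.length) ((shiftMap X)^[w.length] x))
      (fun x hx => ⟨word_mem_wordsOfLength X _ _, ?_⟩) (fun x hx y hy hxy => ?_)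
      fun _ _ => mul_nonneg (gibbs_pos X φ _).le (gibbs_pos X φ _).le
    · have hL := word_mem_language X n x
      rw [hsplit x hx] at hL
      refine le_trans ?_ (gibbs_append_le φ hL)
      rw [← hsplit x hx, gibbs, length_word, periodicWeight, Real.exp_le_exp]
      linarith [S_le_wordWeight_word (φ := φ) n x]
    · refine hgen.eq_of_forall_word hn (hs x hx) (hs y hy) ?_
      rw [hsplit x hx, hsplit y hy]
      exact congrArg (w ++ ·) hxy
  refine h1.trans ?_
  rw [← Finset.mul_sum, mul_comm]
  exact mul_le_mul_of_nonneg_right (hK _) (gibbs_pos X φ w).le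

/-- Periodic specification is needed for a single word only: each w ∈ D of length n - t yields a
point of period n in [w], and distinct words yield distinct points. -/
lemma le_sum_periodicWeight {D : Set (List A)} {t : ℕ} (hD : HasSpecPer X D t) {V : ℝ}
    (hV : ∀ w ∈ D, ∀ x ∈ cyl X w, wordWeight X φ w - V ≤ S X φ w.length x) {n : ℕ}
    (htn : t ≤ n) {s : Finset X.carrier}
    (hs : (s : Set X.carrier) = Function.ptsOfPeriod (shiftMap X) n) :
    Real.exp (-(V + t * (‖φ‖ + pressure X φ))) * mass X φ (wordsOfLength D (n - t)) ≤
      ∑ x ∈ s, periodicWeight φ n x := by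
  unfold mass
  rw [Finset.mul_sum]
  refine sum_le_sum_of_section (fun x => word X (n - t) x) (fun w hw => ?_)
    fun x _ => (Real.exp_pos _).le
  obtain ⟨hwD, hlen⟩ := mem_wordsOfLength.1 hw
  obtain ⟨v, -, -, y, hy, hper⟩ := hD 0 (fun _ => w) fun _ => hwD
  rw [glue_zero] at hy hper
  have hnw : w.length + t = n := by omega
  rw [hnw] at hper
  refine ⟨y, ?_, ?_, ?_⟩
  · rw [← Finset.mem_coe, hs]; exact hper
  · rw [← hlen]; exact (mem_cyl_iff X).1 hy
  · unfold gibbs periodicWeight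
    rw [← Real.exp_add, Real.exp_le_exp, ← hnw, S_add]
    have h1 := hV w hwD y hy
    have h2 := (abs_le.1 (abs_S_le X φ t ((shiftMap X)^[w.length] y))).1
    push_cast
    linarith

/-- The periodic orbit measures converge to the unique equilibrium state. -/
lemma IsGenerating.tendsto_periodicMeasure (hgen : IsGenerating X) [Nonempty X.carrier]
    (hdec : IsDecomposition X Cp G Cs)
    (hspec : ∀ M : ℕ, ∃ t : ℕ, HasSpecS X (fatten X Cp G Cs M) t) (hB : HasBowen X φ G)
    (hsum : Summable fun n : ℕ => partitionSum X φ (Cp ∪ Cs) (n + 1) *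
        Real.exp (-((n + 1 : ℕ) : ℝ) * pressure X φ))
    (hper : ∀ M : ℕ, ∃ t : ℕ, HasSpecPer X (fatten X Cp G Cs M) t) {μ : Measure X.carrier}
    (hμ : ∀ ν : Measure X.carrier, IsEquilibriumState X φ ν → ν = μ) (f : C(X.carrier, ℝ)) :
    Tendsto (fun n : ℕ => ∫ x, f x ∂(periodicMeasure X φ n)) atTop (𝓝 (∫ x, f x ∂μ)) := by
  classical
  obtain ⟨K, hK1, hK⟩ := exists_mass_language_le hdec hspec hB hsum
  obtain ⟨M, hM⟩ := exists_mass_filter_not_mem_fatten_le hdec hspec hB hsum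
    (show (0 : ℝ) < 1 / 2 by norm_num)
  obtain ⟨t, ht⟩ := hper M
  obtain ⟨V, hV0, hV⟩ := HasBowen.exists_fatten (Cp := Cp) (Cs := Cs) hB M
  set c := Real.exp (-(V + t * (‖φ‖ + pressure X φ))) * (1 / 2) with hc
  have hcpos : 0 < c := by positivity
  have hfin : ∀ n, 0 < n → ∃ s : Finset X.carrier,
      (s : Set X.carrier) = Function.ptsOfPeriod (shiftMap X) n := fun n hn =>
    ⟨(hgen.finite_ptsOfPeriod hn).toFinset, by simp⟩
  choose! s hs using hfin
  have hmem : ∀ n, 0 < n → ∀ x, x ∈ s n ↔ Function.IsPeriodicPt (shiftMap X) n x := by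
    intro n hn x; rw [← Finset.mem_coe, hs n hn]; rfl
  set Z : ℕ → ℝ := fun n => ∑ x ∈ s n, periodicWeight φ n x with hZdef
  have hZ : ∀ n, t < n → c ≤ Z n := by
    intro n hn
    refine le_trans ?_ (le_sum_periodicWeight ht hV hn.le (hs n (by omega)))
    exact mul_le_mul_of_nonneg_left
      (half_le_mass_fatten (hM M le_rfl) (n - t) (by omega)) (Real.exp_pos _).le
  have hw0 : ∀ n x, 0 ≤ periodicWeight φ n x / Z n := fun n x =>
    div_nonneg (Real.exp_pos _).le (Finset.sum_nonneg fun _ _ => (Real.exp_pos _).le)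
  have hprob : ∀ n, t < n → IsProbabilityMeasure (periodicMeasure X φ n) := by
    intro n hn
    rw [periodicMeasure_eq (hs n (by omega))]
    refine isProbabilityMeasure_atomic (fun x _ => hw0 n x) ?_
    rw [← Finset.sum_div]
    exact div_self (hcpos.trans_le (hZ n hn)).ne'
  have hint : ∀ n, t < n → ∀ g : X.carrier → ℝ, StronglyMeasurable g →
      ∫ x, g x ∂(periodicMeasure X φ n) = (∑ x ∈ s n, periodicWeight φ n x * g x) / Z n := by
    intro n hn g hg
    rw [periodicMeasure_eq (hs n (by omega)), integral_atomic (fun x _ => hw0 n x) hg,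
      Finset.sum_div]
    exact Finset.sum_congr rfl fun x _ => by rw [id, div_mul_eq_mul_div]
  have hinv : ∀ n, t < n → ∀ g : C(X.carrier, ℝ), ∫ x, g (shiftMap X x) ∂(periodicMeasure X φ n) =
      ∫ x, g x ∂(periodicMeasure X φ n) := by
    intro n hn g
    rw [hint n hn (fun x => g (shiftMap X x))
      (g.continuous.comp (continuous_shiftMap X)).stronglyMeasurable,
      hint n hn _ g.continuous.stronglyMeasurable,
      sum_shiftMap_of_period (by omega) (hs n (by omega))]
  have hgibbs : ∀ w ∈ language X, ∀ n, max t w.length < n →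
      (periodicMeasure X φ n).real (cyl X w) ≤ K / c * gibbs X φ w := by
    intro w _ n hn
    rw [max_lt_iff] at hn
    rw [← integral_indicator_one (measurableSet_cyl X w), hint n hn.1 _
      (stronglyMeasurable_one.indicator (measurableSet_cyl X w)),
      div_le_iff₀ (hcpos.trans_le (hZ n hn.1))]
    have h1 : ∑ x ∈ s n, periodicWeight φ n x * (cyl X w).indicator 1 x =
        ∑ x ∈ (s n).filter fun x => x ∈ cyl X w, periodicWeight φ n x := by
      rw [Finset.sum_filter]
      refine Finset.sum_congr rfl fun x _ => ?_
      by_cases hx : x ∈ cyl X w <;> simp [hx]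
    rw [h1]
    have h2 := hgen.sum_periodicWeight_cyl_le (φ := φ) (n := n) (by omega)
      (s := (s n).filter fun x => x ∈ cyl X w)
      (fun x hx => (hmem n (by omega) x).1 (Finset.mem_filter.1 hx).1) hK hn.2.le
      fun x hx => (Finset.mem_filter.1 hx).2
    refine h2.trans ?_
    have hg := gibbs_pos X φ w
    calc K * gibbs X φ w = K / c * gibbs X φ w * c := by field_simp
      _ ≤ _ := by gcongr; exact hZ n hn.1
  -- It suffices to identify the limit along each ultrafilter: it is invariant and inherits the
  -- upper Gibbs bound, hence is an equilibrium state.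
  rw [tendsto_iff_ultrafilter]
  intro U hU
  have ht' : ∀ᶠ n in (U : Filter ℕ), t < n := hU (eventually_gt_atTop t)
  obtain ⟨κ, hκ, hlim⟩ := exists_weak_limit U (periodicMeasure X φ) (ht'.mono hprob)
  have hκinv : IsInvariantProb X κ := by
    refine ⟨hκ, map_shiftMap_eq fun g => ?_⟩
    refine tendsto_nhds_unique (hlim (g.comp ⟨shiftMap X, continuous_shiftMap X⟩))
      ((hlim g).congr' (ht'.mono fun n hn => (hinv n hn g).symm))
  have hκgibbs : ∀ w ∈ language X, κ.real (cyl X w) ≤ K / c * gibbs X φ w := by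
    intro w hw
    have h1 := hlim (clopenIndicator (isClopen_cyl X w))
    simp only [integral_clopenIndicator] at h1
    have h2 : ∀ᶠ n in (U : Filter ℕ), max t w.length < n := hU (eventually_gt_atTop _)
    exact le_of_tendsto h1 (h2.mono fun n hn => hgibbs w hw n hn)
  have hfree := hgen.pressure_le_freeEnergy hκinv (div_pos (by linarith) hcpos) hκgibbs
  rw [← hμ κ ⟨hκinv, fun ν hν => (hgen.freeEnergy_le hν).trans hfree⟩]
  exact hlim f

end Periodic

/-! ### Uniqueness of the equilibrium state -/

section Uniqueness

variable {A I : Type*} [TopologicalSpace A] [AddMonoidWithOne I] [Finite A] [DiscreteTopology A]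
  [MeasurableSpace A] [BorelSpace A] [Countable I] {X : Subshift A I} {φ : C(X.carrier, ℝ)}
  {Cp G Cs : Set (List A)}

/-- Of a collection of words of definite mass, a definite part is good. -/
lemma exists_half_le_mass_filter [Nonempty X.carrier] (hdec : IsDecomposition X Cp G Cs)
    (hspec : ∀ M : ℕ, ∃ t : ℕ, HasSpecS X (fatten X Cp G Cs M) t) (hB : HasBowen X φ G)
    (hsum : Summable fun n : ℕ => partitionSum X φ (Cp ∪ Cs) (n + 1) *
        Real.exp (-((n + 1 : ℕ) : ℝ) * pressure X φ)) {a : ℝ} (ha : 0 < a) :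
    ∃ M : ℕ, ∀ n, 0 < n → ∀ D ⊆ wordsOfLength (language X) n, a ≤ mass X φ D →
      ∃ E ⊆ D, E ⊆ wordsOfLength (fatten X Cp G Cs M) n ∧ a / 2 ≤ mass X φ E := by
  classical
  obtain ⟨M, hM⟩ := exists_mass_filter_not_mem_fatten_le hdec hspec hB hsum (half_pos ha)
  refine ⟨M, fun n hn D hD hDa => ⟨D.filter fun y => y ∈ fatten X Cp G Cs M,
    Finset.filter_subset _ _, fun y hy => ?_, ?_⟩⟩
  · rw [Finset.mem_filter] at hy
    exact mem_wordsOfLength.2 ⟨hy.2, (mem_wordsOfLength.1 (hD hy.1)).2⟩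
  · have h2 := hM M le_rfl n hn (D.filter fun y => y ∉ fatten X Cp G Cs M)
      (fun y hy => mem_wordsOfLength.1 (hD (Finset.mem_filter.1 hy).1))
      (fun y hy => (Finset.mem_filter.1 hy).2)
    have h4 : mass X φ (D.filter fun y => y ∈ fatten X Cp G Cs M) +
        mass X φ (D.filter fun y => y ∉ fatten X Cp G Cs M) = mass X φ D :=
      Finset.sum_filter_add_sum_filter_not _ _ _
    linarith

theorem IsGenerating.exists_unique_equilibriumState (hgen : IsGenerating X) [Nonempty X.carrier]
    (hdec : IsDecomposition X Cp G Cs)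
    (hspec : ∀ M : ℕ, ∃ t : ℕ, HasSpecS X (fatten X Cp G Cs M) t) (hB : HasBowen X φ G)
    (hsum : Summable fun n : ℕ => partitionSum X φ (Cp ∪ Cs) (n + 1) *
        Real.exp (-((n + 1 : ℕ) : ℝ) * pressure X φ)) :
    ∃ μ : Measure X.carrier, IsEquilibriumState X φ μ ∧
      (∀ ν : Measure X.carrier, IsEquilibriumState X φ ν → ν = μ) ∧
      (∃ K' : ℝ, 0 < K' ∧ ∃ K : ℕ → ℝ, (∀ M, 0 < K M) ∧
        ∀ (M : ℕ), ∀ w ∈ fatten X Cp G Cs M,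
          K M ≤ μ.real (cyl X w) /
            Real.exp (-(w.length : ℝ) * pressure X φ + wordWeight X φ w) ∧
          μ.real (cyl X w) /
            Real.exp (-(w.length : ℝ) * pressure X φ + wordWeight X φ w) ≤ K') ∧
      ((∀ M : ℕ, ∃ t : ℕ, HasSpecPer X (fatten X Cp G Cs M) t) →
        ∀ f : C(X.carrier, ℝ),
          Tendsto (fun n : ℕ => ∫ x, f x ∂(periodicMeasure X φ n)) atTop (𝓝 (∫ x, f x ∂μ))) := by
  obtain ⟨C, hC1, hC⟩ := exists_mass_language_le hdec hspec hB hsum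
  obtain ⟨μ, hμ, ⟨K, hK0, hK⟩, hlow, hpair⟩ := exists_gibbs_measure hdec hspec hB hsum
  have hμprob := hμ.1
  have hfree := hgen.pressure_le_freeEnergy hμ hK0 hK
  have hsumle : ∀ n, ∀ D ⊆ wordsOfLength (language X) n,
      ∑ w ∈ D, μ.real (cyl X w) ≤ K * mass X φ D := by
    intro n D hD
    unfold mass
    rw [Finset.mul_sum]
    exact Finset.sum_le_sum fun w hw => hK w (mem_wordsOfLength.1 (hD hw)).1
  -- The upper Gibbs bound turns μ-measure into mass, a definite part of the mass is good, and good
  -- words correlate.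
  have herg : Ergodic (shiftMap X) μ := by
    refine hgen.ergodic hμ fun a ha => ?_
    obtain ⟨M, hM⟩ := exists_half_le_mass_filter hdec hspec hB hsum (div_pos ha hK0)
    obtain ⟨c, hc, hcM⟩ := hpair M
    refine ⟨c * (a / K / 2 * (a / K / 2)), by positivity, fun n hn D hD E hE hDa hEa => ?_⟩
    have hmass : ∀ F ⊆ wordsOfLength (language X) n, a ≤ ∑ w ∈ F, μ.real (cyl X w) →
        a / K ≤ mass X φ F := by
      intro F hF hFa
      rw [div_le_iff₀' hK0]
      exact hFa.trans (hsumle n F hF)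
    obtain ⟨D', hD'D, hD', hD'a⟩ := hM n hn D hD (hmass D hD hDa)
    obtain ⟨E', hE'E, hE', hE'a⟩ := hM n hn E hE (hmass E hE hEa)
    obtain ⟨l, hl⟩ := hcM n D' hD' E' hE'
    refine ⟨l, le_trans ?_ (hl.trans (measureReal_mono fun x hx => ⟨hD'D hx.1, hE'E hx.2⟩))⟩
    have := mass_nonneg X φ D'
    gcongr
  have huniq : ∀ ν : Measure X.carrier, IsEquilibriumState X φ ν → ν = μ := by
    intro ν hν
    have hνprob := hν.1.1
    -- Definite ν-measure gives definite mass since ν has maximal free energy; a definite part of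
    -- that mass is good, and the lower Gibbs bound returns definite μ-measure.
    refine herg.eq_of_absolutelyContinuous hν.1.2 (hgen.absolutelyContinuous hμ hν.1 fun a ha => ?_)
    obtain ⟨c, hc, hcD⟩ := hgen.exists_le_mass hν.1 (hfree.trans (hν.2 μ hμ)) hC1 hC ha
    obtain ⟨M, hM⟩ := exists_half_le_mass_filter hdec hspec hB hsum hc
    obtain ⟨b, hb, hbM⟩ := hlow M
    refine ⟨b * (c / 2), by positivity, fun n hn D hD hDa => ?_⟩
    obtain ⟨D', hD'D, hD', hD'c⟩ := hM n hn D hD (hcD n hn D hD hDa)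
    calc b * (c / 2) ≤ b * mass X φ D' := by gcongr
      _ ≤ ∑ w ∈ D', μ.real (cyl X w) := by
          unfold mass
          rw [Finset.mul_sum]
          exact Finset.sum_le_sum fun w hw => hbM w (mem_wordsOfLength.1 (hD' hw)).1
      _ ≤ _ := Finset.sum_le_sum_of_subset_of_nonneg hD'D fun _ _ _ => measureReal_nonneg
  choose b hb hbM using hlow
  refine ⟨μ, ⟨hμ, fun ν hν => (hgen.freeEnergy_le hν).trans hfree⟩, huniq,
    ⟨K, hK0, b, hb, fun M w hw => ⟨?_, ?_⟩⟩,
    fun hper => hgen.tendsto_periodicMeasure hdec hspec hB hsum hper huniq⟩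
  · rw [le_div_iff₀ (Real.exp_pos _)]
    exact hbM M w hw
  · rw [div_le_iff₀ (Real.exp_pos _)]
    exact hK w hw.1

end Uniqueness

end Symbolic

end

open Symbolic in
theorem theoremC {A : Type*} [Finite A] [TopologicalSpace A] [DiscreteTopology A]
    [MeasurableSpace A] [BorelSpace A] :
    (∀ (X : Subshift A ℕ) [Nonempty X.carrier] (φ : C(X.carrier, ℝ)) (Cp G Cs : Set (List A)),
      IsDecomposition X Cp G Cs →
      (∀ M : ℕ, ∃ t : ℕ, HasSpecS X (fatten X Cp G Cs M) t) →
      HasBowen X φ G →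
      (Summable fun n : ℕ => partitionSum X φ (Cp ∪ Cs) (n + 1) *
        Real.exp (-((n + 1 : ℕ) : ℝ) * pressure X φ)) →
      ∃ μ : Measure X.carrier,
        IsEquilibriumState X φ μ ∧
        (∀ ν : Measure X.carrier, IsEquilibriumState X φ ν → ν = μ) ∧
        (∃ K' : ℝ, 0 < K' ∧ ∃ K : ℕ → ℝ, (∀ M, 0 < K M) ∧
          ∀ (M : ℕ), ∀ w ∈ fatten X Cp G Cs M,
            K M ≤ μ.real (cyl X w) /
              Real.exp (-(w.length : ℝ) * pressure X φ + wordWeight X φ w) ∧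
            μ.real (cyl X w) /
              Real.exp (-(w.length : ℝ) * pressure X φ + wordWeight X φ w) ≤ K') ∧
        ((∀ M : ℕ, ∃ t : ℕ, HasSpecPer X (fatten X Cp G Cs M) t) →
          ∀ f : C(X.carrier, ℝ),
            Tendsto (fun n : ℕ => ∫ x, f x ∂(periodicMeasure X φ n)) atTop (𝓝 (∫ x, f x ∂μ)))) ∧
    (∀ (X : Subshift A ℤ) [Nonempty X.carrier] (φ : C(X.carrier, ℝ)) (Cp G Cs : Set (List A)),
      IsDecomposition X Cp G Cs →
      (∀ M : ℕ, ∃ t : ℕ, HasSpecS X (fatten X Cp G Cs M) t) →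
      HasBowen X φ G →
      (Summable fun n : ℕ => partitionSum X φ (Cp ∪ Cs) (n + 1) *
        Real.exp (-((n + 1 : ℕ) : ℝ) * pressure X φ)) →
      ∃ μ : Measure X.carrier,
        IsEquilibriumState X φ μ ∧
        (∀ ν : Measure X.carrier, IsEquilibriumState X φ ν → ν = μ) ∧
        (∃ K' : ℝ, 0 < K' ∧ ∃ K : ℕ → ℝ, (∀ M, 0 < K M) ∧
          ∀ (M : ℕ), ∀ w ∈ fatten X Cp G Cs M,
            K M ≤ μ.real (cyl X w) /
              Real.exp (-(w.length : ℝ) * pressure X φ + wordWeight X φ w) ∧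
            μ.real (cyl X w) /
              Real.exp (-(w.length : ℝ) * pressure X φ + wordWeight X φ w) ≤ K') ∧
        ((∀ M : ℕ, ∃ t : ℕ, HasSpecPer X (fatten X Cp G Cs M) t) →
          ∀ f : C(X.carrier, ℝ),
            Tendsto (fun n : ℕ => ∫ x, f x ∂(periodicMeasure X φ n)) atTop (𝓝 (∫ x, f x ∂μ)))) := by
  refine ⟨?_, ?_⟩
  · intro X _ φ Cp G Cs hdec hspec hB hsum
    exact (isGenerating_nat X).exists_unique_equilibriumState hdec hspec hB hsum
  · intro X _ φ Cp G Cs hdec hspec hB hsum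
    exact (isGenerating_int X).exists_unique_equilibriumState hdec hspec hB hsum
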